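/- **Setting.** Let $K$ be an algebraically closed field, $Q$ a finite quiver, and $I$ a two-sided ideal of the path algebra $KQ$ which is admissible (some power of the arrow ideal is contained in $I$, and $I$ is contained in the square of the arrow ideal) and homogeneous with respect to path length. Put $\Lambda = KQ/I$, a finite dimensional algebra, graded by path length, $\Lambda=\bigoplus_{l\ge 0}\Lambda_l$, with Jacobson radical $J$; let $L$ be maximal with $J^L\ne 0$. For a vertex $v$ let $e_v$ be the corresponding primitive idempotent. All modules are left modules. *Varieties* are separated algebraic varieties over $K$ (not necessarily irreducible). *Graded modules* are $\mathbb Z$-graded; two graded modules are *graded-isomorphic* if there is a $\Lambda$-isomorphism between them that is homogeneous of some degree. The *top* of $M$ is $M/JM$ and its *radical layering* is $(J^lM/J^{l+1}M)_{0\le l\le L}$, both up to isomorphism. A *family of graded $d$-dimensional $\Lambda$-modules generated in a single degree*, parametrized by a variety $X$, is an algebraic vector bundle $\Delta$ of rank $d$ over $X$, together with a $K$-algebra homomorphism $\delta:\Lambda\to\operatorname{End}(\Delta)$ and a decomposition $\Delta=\bigoplus_{m\in\mathbb Z}\Delta_m$ into subbundles with $\delta(\Lambda_l)\Delta_m\subseteq\Delta_{l+m}$,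 such that, for some $s\in\mathbb Z$, every fibre $\Delta_x$ is generated as a $\Lambda$-module by its component of degree $s$. Two families over $X$ are *equivalent* if for every $x\in X$ their fibres over $x$ are graded-isomorphic. For a class $\mathcal C$ of $\Lambda$-modules, a variety $Z$ is a *fine moduli space* for the graded $d$-dimensional modules in $\mathcal C$, with *universal family* $\Gamma$, if $\Gamma$ is a family over $Z$ of the above kind with all fibres in $\mathcal C$, and if for every variety $X$ and every such family $\Delta$ over $X$ with all fibres in $\mathcal C$ there is a unique morphism $\tau:X\to Z$ such that $\Delta$ is equivalent to $\tau^*\Gamma$. Let $T$ be a simple $\Lambda$-module. Then there is a vertex $v$ with $T\cong\Lambda e_v/Je_v$. Let $P=\Lambda e_v=\bigoplus_l P_l$ be its projective cover, with the grading inherited from $\Lambda$. For a natural number $d$, let $\operatorname{Gr-}\mathfrak{Grass}^T_d$ be the set of all homogeneous submodules $C$ of $JP$ with $\dim_K P/C=d$, as a subvariety of the classical Grassmannian of $(\dim_K P-d)$-dimensional subspaces of $JP$. Let $(\Gamma,\gamma)$ be the following family over it: the fibre over $C$ is $P/C$ with its natural $\Lambda$-structure and the grading inherited from $P$. The bundle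 structure is as follows. Let $\sigma$ be any set of $d$ paths of $Q$ which start in $v$, do not lie in $I$, and such that $\sigma$ is nonempty and closed under initial subpaths. Then over the set of all $C$ such that, for each $l$, the classes of the elements $pe_v$ with $p\in\sigma$ of length $l$ form a basis of $J^l(P/C)/J^{l+1}(P/C)$, the bundle is trivialized by the sections $C\mapsto pe_v+C$ $(p\in\sigma)$. **Theorem 4.2.** (a) For every $d$, $\operatorname{Gr-}\mathfrak{Grass}^T_d$ is a projective variety and is a fine moduli space for the graded $d$-dimensional $\Lambda$-modules with top $T$, with universal family $(\Gamma,\gamma)$. (b) Let $\mathbb S=(\mathbb S_0,\dots,\mathbb S_L)$ be a $d$-dimensional semisimple sequence with top $T$, that is, the $\mathbb S_l$ are semisimple $\Lambda$-modules, $\mathbb S_0\cong T$, each $\mathbb S_l$ embeds into $J^lP/J^{l+1}P$, and $\sum_l\dim_K\mathbb S_l=d$. Then the subvariety $\operatorname{Gr-}\mathfrak{Grass}(\mathbb S)$ of $\operatorname{Gr-}\mathfrak{Grass}^T_d$, consisting of those $C$ for which $P/C$ has radical layering $\mathbb S$, is a projective variety and is a fine moduli space for the graded $\Lambda$-modules with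 radical layering $\mathbb S$, the restriction of $(\Gamma,\gamma)$ being a universal family. -/

import Mathlib

universe u

noncomputable section

namespace GradedModuli

/-! ## Path algebras -/

section PathAlgebra

/-- A path of the quiver `V`, together with its starting point and its end point. -/
structure QPath (V : Type u) [Quiver.{u} V] : Type u where
  src : V
  tgt : V
  path : Quiver.Path src tgt

variable {V : Type u} [Quiver.{u} V]

/-- The length of a path. -/
def QPath.length (p : QPath V) : ℕ := p.path.length

/-- The path of length zero at `v`. -/
def QPath.nil (v : V) : QPath V := ⟨v, v, Quiver.Path.nil⟩

/-- The product `p q` of paths is "first `q`, then `p`"; it is only defined if `q` ends where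
`p` starts. -/
def QPath.comp (p q : QPath V) : Option (QPath V) :=
  open Classical in
  if h : q.tgt = p.src then some ⟨q.src, p.tgt, (q.path.cast rfl h).comp p.path⟩ else none

theorem QPath.comp_bind_assoc (p q r : QPath V) :
    (QPath.comp p q).bind (fun s => QPath.comp s r) =
      (QPath.comp q r).bind (fun s => QPath.comp p s) := by
  obtain ⟨a, b, p⟩ := p
  obtain ⟨c, d, q⟩ := q
  obtain ⟨e, f, r⟩ := r
  by_cases h1 : d = a
  · by_cases h2 : f = c
    · subst h1 h2
      simp [QPath.comp, Quiver.Path.comp_assoc]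
    · subst h1
      simp [QPath.comp, h2]
  · by_cases h2 : f = c
    · subst h2
      simp [QPath.comp, h1]
    · simp [QPath.comp, h1, h2]

variable (K : Type u) [Field K]

variable (V) in
/-- The underlying vector space of the path algebra `K Q`: it has the paths as a basis. -/
def PathAlgebra : Type u := QPath V →₀ K

instance : AddCommGroup (PathAlgebra V K) := inferInstanceAs (AddCommGroup (QPath V →₀ K))
instance : Module K (PathAlgebra V K) := inferInstanceAs (Module K (QPath V →₀ K))

/-- The basis element of the path algebra given by a path. -/
def ofPath (p : QPath V) : PathAlgebra V K := Finsupp.single p (1 : K)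

/-- A formal composite of paths as an element of the path algebra. -/
def ofOption : Option (QPath V) → PathAlgebra V K
  | none => 0
  | some p => ofPath K p

/-- The bilinear multiplication of the path algebra, extending the product of paths. -/
def mulLin : PathAlgebra V K →ₗ[K] PathAlgebra V K →ₗ[K] PathAlgebra V K :=
  Finsupp.linearCombination K (fun p : QPath V =>
    (Finsupp.linearCombination K (fun q : QPath V => ofOption K (QPath.comp p q)) :
      (QPath V →₀ K) →ₗ[K] PathAlgebra V K))

instance : Mul (PathAlgebra V K) := ⟨fun f g => mulLin K f g⟩

/-- The unit of the path algebra is the sum of the paths of length zero. -/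
instance [Fintype V] : One (PathAlgebra V K) := ⟨∑ v : V, ofPath K (QPath.nil v)⟩

variable {K}

theorem mul_def (f g : PathAlgebra V K) : f * g = mulLin K f g := rfl

theorem ofPath_mul_ofPath (p q : QPath V) :
    ofPath K p * ofPath K q = ofOption K (QPath.comp p q) := by
  have h1 : mulLin K (ofPath K p) =
      (Finsupp.linearCombination K (fun q : QPath V => ofOption K (QPath.comp p q)) :
        (QPath V →₀ K) →ₗ[K] PathAlgebra V K) :=
    (Finsupp.linearCombination_single K (1 : K) p).trans (one_smul K _)
  rw [mul_def, h1]
  exact (Finsupp.linearCombination_single K (1 : K) q).trans (one_smul K _)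

theorem pathAlgebra_induction {P : PathAlgebra V K → Prop} (f : PathAlgebra V K)
    (h0 : P 0) (ha : ∀ f g, P f → P g → P (f + g)) (hs : ∀ (c : K) p, P (c • ofPath K p)) :
    P f := by
  refine Finsupp.induction_linear (motive := P) f h0 ha ?_
  intro p c
  have := hs c p
  have h : (c • ofPath K p : PathAlgebra V K) = Finsupp.single p c := by
    exact (Finsupp.smul_single c p (1 : K)).trans (by rw [smul_eq_mul, mul_one])
  rwa [h] at this

theorem ofOption_mul (o : Option (QPath V)) (r : QPath V) :
    ofOption K o * ofPath K r = ofOption K (o.bind fun s => QPath.comp s r) := by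
  cases o with
  | none => simp [ofOption, mul_def]
  | some s => simpa [ofOption] using ofPath_mul_ofPath s r

theorem mul_ofOption (o : Option (QPath V)) (p : QPath V) :
    ofPath K p * ofOption K o = ofOption K (o.bind fun s => QPath.comp p s) := by
  cases o with
  | none => simp [ofOption, mul_def]
  | some s => simpa [ofOption] using ofPath_mul_ofPath p s

theorem pa_smul_mul (c : K) (f g : PathAlgebra V K) : (c • f) * g = c • (f * g) := by
  simp [mul_def]

theorem pa_mul_smul (c : K) (f g : PathAlgebra V K) : f * (c • g) = c • (f * g) := by
  simp [mul_def]

theorem pa_add_mul (f g h : PathAlgebra V K) : (f + g) * h = f * h + g * h := by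
  simp [mul_def]

theorem pa_mul_add (f g h : PathAlgebra V K) : f * (g + h) = f * g + f * h := by
  simp [mul_def]

theorem pa_zero_mul (f : PathAlgebra V K) : 0 * f = 0 := by
  simp [mul_def]

theorem pa_mul_zero (f : PathAlgebra V K) : f * 0 = 0 := by
  simp [mul_def]

theorem pa_mul_assoc (f g h : PathAlgebra V K) : f * g * h = f * (g * h) := by
  refine pathAlgebra_induction (P := fun f => f * g * h = f * (g * h)) f (by simp only [pa_zero_mul])
    (fun _ _ h1 h2 => by simp only [pa_add_mul, h1, h2]) (fun a p => ?_)
  refine pathAlgebra_induction (P := fun g => (a • ofPath K p) * g * h = (a • ofPath K p) * (g * h))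
    g (by simp only [pa_zero_mul, pa_mul_zero])
    (fun _ _ h1 h2 => by simp only [pa_add_mul, pa_mul_add, h1, h2]) (fun b q => ?_)
  refine pathAlgebra_induction (P := fun h => (a • ofPath K p) * (b • ofPath K q) * h =
      (a • ofPath K p) * ((b • ofPath K q) * h)) h (by simp only [pa_mul_zero])
    (fun _ _ h1 h2 => by simp only [pa_mul_add, h1, h2]) (fun c r => ?_)
  simp only [pa_smul_mul, pa_mul_smul, ofPath_mul_ofPath, ofOption_mul, mul_ofOption,
    QPath.comp_bind_assoc]

theorem nil_comp (v : V) (p : QPath V) [Decidable (p.tgt = v)] :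
    QPath.comp (QPath.nil v) p = if p.tgt = v then some p else none := by
  obtain ⟨a, b, p⟩ := p
  by_cases h : b = v
  · subst h
    simp [QPath.comp, QPath.nil]
  · simp [QPath.comp, QPath.nil, h]

theorem comp_nil (v : V) (p : QPath V) [Decidable (p.src = v)] :
    QPath.comp p (QPath.nil v) = if p.src = v then some p else none := by
  obtain ⟨a, b, p⟩ := p
  by_cases h : a = v
  · subst h
    simp [QPath.comp, QPath.nil]
  · have h' : ¬ v = a := fun h' => h h'.symm
    simp [QPath.comp, QPath.nil, h, h']

variable [Fintype V]

theorem pa_one_mul (f : PathAlgebra V K) : 1 * f = f := by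
  classical
  have hone : (1 : PathAlgebra V K) = ∑ v : V, ofPath K (QPath.nil v) := rfl
  refine pathAlgebra_induction (P := fun f => 1 * f = f) f (pa_mul_zero _)
    (fun _ _ h1 h2 => by rw [pa_mul_add, h1, h2]) (fun a p => ?_)
  rw [pa_mul_smul]
  congr 1
  rw [hone, mul_def, map_sum, LinearMap.sum_apply]
  simp only [← mul_def, ofPath_mul_ofPath, nil_comp]
  rw [Finset.sum_eq_single p.tgt]
  · simp [ofOption]
  · intro b _ hb
    simp [Ne.symm hb, ofOption]
  · simp

theorem pa_mul_one (f : PathAlgebra V K) : f * 1 = f := by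
  classical
  have hone : (1 : PathAlgebra V K) = ∑ v : V, ofPath K (QPath.nil v) := rfl
  refine pathAlgebra_induction (P := fun f => f * 1 = f) f (pa_zero_mul _)
    (fun _ _ h1 h2 => by rw [pa_add_mul, h1, h2]) (fun a p => ?_)
  rw [pa_smul_mul]
  congr 1
  rw [hone, mul_def, map_sum]
  simp only [← mul_def, ofPath_mul_ofPath, comp_nil]
  rw [Finset.sum_eq_single p.src]
  · simp [ofOption]
  · intro b _ hb
    simp [Ne.symm hb, ofOption]
  · simp

instance : Ring (PathAlgebra V K) :=
  { (inferInstance : AddCommGroup (PathAlgebra V K)) with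
    mul := (· * ·)
    one := 1
    left_distrib := pa_mul_add
    right_distrib := pa_add_mul
    zero_mul := pa_zero_mul
    mul_zero := pa_mul_zero
    mul_assoc := pa_mul_assoc
    one_mul := pa_one_mul
    mul_one := pa_mul_one }

instance : Algebra K (PathAlgebra V K) := Algebra.ofModule pa_smul_mul pa_mul_smul

/-- The span of the paths of length at least `n`, that is, the `n`-th power of the ideal
generated by the arrows. -/
def pathsGE (V : Type u) [Quiver.{u} V] (K : Type u) [Field K] (n : ℕ) :
    Submodule K (PathAlgebra V K) :=
  Submodule.span K {x | ∃ p : QPath V, n ≤ p.length ∧ x = ofPath K p}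

/-- The homogeneous component of degree `n` of an element of the path algebra, with respect to
the grading by path lengths. -/
def lengthComponent (n : ℕ) (f : PathAlgebra V K) : PathAlgebra V K :=
  Finsupp.filter (fun p : QPath V => p.length = n) f

/-- A (left) ideal is admissible if it lies between some power of the arrow ideal and the
square of the arrow ideal. -/
def IsAdmissible (I : Ideal (PathAlgebra V K)) : Prop :=
  (∃ m : ℕ, 2 ≤ m ∧ (pathsGE V K m : Set (PathAlgebra V K)) ⊆ I) ∧
    (I : Set (PathAlgebra V K)) ⊆ pathsGE V K 2

/-- An ideal is homogeneous with respect to the grading by path lengths. -/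
def IsLengthHomogeneous (I : Ideal (PathAlgebra V K)) : Prop :=
  ∀ f ∈ I, ∀ n : ℕ, lengthComponent n f ∈ I

variable (I : Ideal (PathAlgebra V K)) [I.IsTwoSided]

/-- The homogeneous component of degree `m` of `K Q / I`: the span of the paths of length `m`
(it is zero for `m < 0`). -/
def lengthGrading (m : ℤ) : Submodule K (PathAlgebra V K ⧸ I) :=
  Submodule.span K {x | ∃ p : QPath V, (p.length : ℤ) = m ∧ x = Ideal.Quotient.mk I (ofPath K p)}

/-- The primitive idempotent of `K Q / I` given by a vertex. -/
def idem (v : V) : PathAlgebra V K ⧸ I := Ideal.Quotient.mk I (ofPath K (QPath.nil v))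

/-- The indecomposable projective left module `Λ e_v`. -/
abbrev Proj (v : V) : Type u :=
  ↥(Submodule.span (PathAlgebra V K ⧸ I) {idem I v} :
    Submodule (PathAlgebra V K ⧸ I) (PathAlgebra V K ⧸ I))

/-- The simple left module `S_v = Λ e_v / J e_v`. -/
abbrev Simple (v : V) : Type u :=
  Proj I v ⧸ (Ring.jacobson (PathAlgebra V K ⧸ I) • ⊤ :
    Submodule (PathAlgebra V K ⧸ I) (Proj I v))

/-- The grading of `Λ e_v` inherited from `Λ`. -/
def projGrading (v : V) (m : ℤ) : Submodule K (Proj I v) :=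
  (lengthGrading I m).comap
    ((Submodule.subtype (Submodule.span (PathAlgebra V K ⧸ I) {idem I v})).restrictScalars K)

/-- The element `p z` of `Λ e_v`, where `p` is a path and `z = e_v` is the distinguished top
element. -/
def pathElt (v : V) (p : QPath V) : Proj I v :=
  Ideal.Quotient.mk I (ofPath K p) • ⟨idem I v, Submodule.mem_span_singleton_self _⟩

end PathAlgebra

/-! ## Varieties, as spaces with a sheaf of `K`-valued functions -/

section Varieties

/-- A topological space with a sheaf of `K`-algebras of `K`-valued functions. The functions are
taken as total functions; only their restriction to `U` matters in `Reg U f`. -/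
structure FunctionSpace (K : Type u) [Field K] where
  carrier : Type u
  top : TopologicalSpace carrier
  /-- `Reg U f`: the set `U` is open and `f` restricts to a regular function on `U`. -/
  Reg : Set carrier → (carrier → K) → Prop
  isOpen_of_reg : ∀ {U f}, Reg U f → IsOpen U
  reg_congr : ∀ {U f g}, Reg U f → (∀ x ∈ U, f x = g x) → Reg U g
  reg_res : ∀ {U V f}, Reg U f → IsOpen V → V ⊆ U → Reg V f
  reg_glue : ∀ {U f}, IsOpen U → (∀ x ∈ U, ∃ V, x ∈ V ∧ Reg V f) → Reg U f
  reg_const : ∀ {U} (c : K), IsOpen U → Reg U (fun _ => c)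
  reg_add : ∀ {U f g}, Reg U f → Reg U g → Reg U (fun x => f x + g x)
  reg_mul : ∀ {U f g}, Reg U f → Reg U g → Reg U (fun x => f x * g x)

variable {K : Type u} [Field K]

instance : CoeSort (FunctionSpace K) (Type u) := ⟨FunctionSpace.carrier⟩

instance (X : FunctionSpace K) : TopologicalSpace X := X.top

/-- The structure induced on `Y` by a map `φ` from `Y` to `X`: the functions are those which
locally are pullbacks of regular functions on `X`. If `φ` is the inclusion of a locally closed
subset of a variety, this is the usual structure of a (reduced) subvariety. -/
def FunctionSpace.induced (X : FunctionSpace K) {Y : Type u} (φ : Y → X) : FunctionSpace K where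
  carrier := Y
  top := TopologicalSpace.induced φ X.top
  Reg U f := @IsOpen Y (TopologicalSpace.induced φ X.top) U ∧
    ∀ y ∈ U, ∃ (W : Set X) (g : X → K), φ y ∈ W ∧ X.Reg W g ∧
      ∀ y' ∈ U, φ y' ∈ W → f y' = g (φ y')
  isOpen_of_reg h := h.1
  reg_congr := by
    rintro U f g ⟨hU, h⟩ hfg
    refine ⟨hU, fun y hy => ?_⟩
    obtain ⟨W, k, hyW, hk, hW⟩ := h y hy
    exact ⟨W, k, hyW, hk, fun y' hy' hw => by rw [← hfg y' hy', hW y' hy' hw]⟩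
  reg_res := by
    rintro U U' f ⟨hU, h⟩ hU' hsub
    refine ⟨hU', fun y hy => ?_⟩
    obtain ⟨W, k, hyW, hk, hW⟩ := h y (hsub hy)
    exact ⟨W, k, hyW, hk, fun y' hy' hw => hW y' (hsub hy') hw⟩
  reg_glue := by
    intro U f hU h
    refine ⟨hU, fun y hy => ?_⟩
    obtain ⟨U', hyU', hU'o, h'⟩ := h y hy
    obtain ⟨W, k, hyW, hk, hW⟩ := h' y hyU'
    obtain ⟨O, hO, rfl⟩ := hU'o
    refine ⟨W ∩ O, k, ⟨hyW, hyU'⟩, X.reg_res hk ?_ Set.inter_subset_left, ?_⟩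
    · exact @IsOpen.inter _ X.top _ _ (X.isOpen_of_reg hk) hO
    · exact fun y' _ hw => hW y' hw.2 hw.1
  reg_const := by
    intro U c hU
    exact ⟨hU, fun y _ => ⟨Set.univ, fun _ => c, trivial,
      X.reg_const c (@isOpen_univ _ X.top), fun _ _ _ => rfl⟩⟩
  reg_add := by
    rintro U f f' ⟨hU, h⟩ ⟨_, h'⟩
    refine ⟨hU, fun y hy => ?_⟩
    obtain ⟨W, k, hyW, hk, hW⟩ := h y hy
    obtain ⟨W', k', hyW', hk', hW'⟩ := h' y hy
    have ho : @IsOpen _ X.top (W ∩ W') :=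
      @IsOpen.inter _ X.top _ _ (X.isOpen_of_reg hk) (X.isOpen_of_reg hk')
    refine ⟨W ∩ W', fun x => k x + k' x, ⟨hyW, hyW'⟩,
      X.reg_add (X.reg_res hk ho Set.inter_subset_left)
        (X.reg_res hk' ho Set.inter_subset_right), fun y' hy' hw => ?_⟩
    simp only [hW y' hy' hw.1, hW' y' hy' hw.2]
  reg_mul := by
    rintro U f f' ⟨hU, h⟩ ⟨_, h'⟩
    refine ⟨hU, fun y hy => ?_⟩
    obtain ⟨W, k, hyW, hk, hW⟩ := h y hy
    obtain ⟨W', k', hyW', hk', hW'⟩ := h' y hy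
    have ho : @IsOpen _ X.top (W ∩ W') :=
      @IsOpen.inter _ X.top _ _ (X.isOpen_of_reg hk) (X.isOpen_of_reg hk')
    refine ⟨W ∩ W', fun x => k x * k' x, ⟨hyW, hyW'⟩,
      X.reg_mul (X.reg_res hk ho Set.inter_subset_left)
        (X.reg_res hk' ho Set.inter_subset_right), fun y' hy' hw => ?_⟩
    simp only [hW y' hy' hw.1, hW' y' hy' hw.2]

/-- The structure induced on a subset. -/
def FunctionSpace.sub (X : FunctionSpace K) (Z : Set X) : FunctionSpace K :=
  X.induced (Subtype.val : Z → X)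

/-- Fractions of functions: given a topology on `Y` and for every `m` a `K`-vector space `A m` of
functions ("forms of degree `m`"), stable under products, the functions which locally are
quotients of two forms of the same degree. -/
def fractionSpace (Y : Type u) (t : TopologicalSpace Y) (A : ℕ → Submodule K (Y → K))
    (hone : (fun _ => 1) ∈ A 0)
    (hmul : ∀ {m n f g}, f ∈ A m → g ∈ A n → (fun y => f y * g y) ∈ A (m + n)) :
    FunctionSpace K where
  carrier := Y
  top := t
  Reg U f := IsOpen U ∧ ∀ y ∈ U, ∃ W : Set Y, IsOpen W ∧ y ∈ W ∧ W ⊆ U ∧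
    ∃ m : ℕ, ∃ F ∈ A m, ∃ G ∈ A m, ∀ y' ∈ W, G y' ≠ 0 ∧ f y' = F y' / G y'
  isOpen_of_reg h := h.1
  reg_congr := by
    rintro U f g ⟨hU, h⟩ hfg
    refine ⟨hU, fun y hy => ?_⟩
    obtain ⟨W, hW, hyW, hWU, m, F, hF, G, hG, h⟩ := h y hy
    exact ⟨W, hW, hyW, hWU, m, F, hF, G, hG, fun y' hy' =>
      ⟨(h y' hy').1, by rw [← hfg y' (hWU hy'), (h y' hy').2]⟩⟩
  reg_res := by
    rintro U U' f ⟨hU, h⟩ hU' hsub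
    refine ⟨hU', fun y hy => ?_⟩
    obtain ⟨W, hW, hyW, hWU, m, F, hF, G, hG, h⟩ := h y (hsub hy)
    exact ⟨W ∩ U', hW.inter hU', ⟨hyW, hy⟩, Set.inter_subset_right, m, F, hF, G, hG,
      fun y' hy' => h y' hy'.1⟩
  reg_glue := by
    intro U f hU h
    refine ⟨hU, fun y hy => ?_⟩
    obtain ⟨U', hyU', hU'o, h'⟩ := h y hy
    obtain ⟨W, hW, hyW, hWU, m, F, hF, G, hG, h⟩ := h' y hyU'
    exact ⟨W ∩ U, hW.inter hU, ⟨hyW, hy⟩, Set.inter_subset_right, m, F, hF, G, hG,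
      fun y' hy' => h y' hy'.1⟩
  reg_const := by
    intro U c hU
    refine ⟨hU, fun y hy => ⟨U, hU, hy, subset_rfl, 0, fun _ => c, ?_, fun _ => 1, hone,
      fun y' _ => ⟨one_ne_zero, by simp⟩⟩⟩
    have := (A 0).smul_mem c hone
    convert this using 1
    funext y
    simp
  reg_add := by
    rintro U f f' ⟨hU, h⟩ ⟨_, h'⟩
    refine ⟨hU, fun y hy => ?_⟩
    obtain ⟨W, hW, hyW, hWU, m, F, hF, G, hG, h⟩ := h y hy
    obtain ⟨W', hW', hyW', hWU', m', F', hF', G', hG', h'⟩ := h' y hy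
    refine ⟨W ∩ W', hW.inter hW', ⟨hyW, hyW'⟩, fun z hz => hWU hz.1, m + m',
      (fun y => F y * G' y) + (fun y => G y * F' y),
      (A _).add_mem (hmul hF hG') (hmul hG hF'), _, hmul hG hG', fun y' hy' => ?_⟩
    have h1 := h y' hy'.1
    have h2 := h' y' hy'.2
    refine ⟨mul_ne_zero h1.1 h2.1, ?_⟩
    simp only [h1.2, h2.2, div_add_div _ _ h1.1 h2.1]
    rfl
  reg_mul := by
    rintro U f f' ⟨hU, h⟩ ⟨_, h'⟩
    refine ⟨hU, fun y hy => ?_⟩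
    obtain ⟨W, hW, hyW, hWU, m, F, hF, G, hG, h⟩ := h y hy
    obtain ⟨W', hW', hyW', hWU', m', F', hF', G', hG', h'⟩ := h' y hy
    refine ⟨W ∩ W', hW.inter hW', ⟨hyW, hyW'⟩, fun z hz => hWU hz.1, m + m', _,
      hmul hF hF', _, hmul hG hG', fun y' hy' => ?_⟩
    have h1 := h y' hy'.1
    have h2 := h' y' hy'.2
    refine ⟨mul_ne_zero h1.1 h2.1, ?_⟩
    simp only [h1.2, h2.2, div_mul_div_comm]

/-- The polynomial functions in given coordinates `h`. -/
def polyFun {Y : Type u} {ι : Type} (h : Y → ι → K) : MvPolynomial ι K →ₗ[K] (Y → K) where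
  toFun F := fun y => MvPolynomial.eval (h y) F
  map_add' F G := by funext y; simp
  map_smul' c F := by funext y; simp [MvPolynomial.smul_eval]

/-- Affine `n`-space: the topology is the Zariski topology, with the basic open sets `F ≠ 0`, and
the regular functions are locally quotients of polynomials. -/
def affineSpace (K : Type u) [Field K] (n : ℕ) : FunctionSpace K :=
  fractionSpace (Fin n → K)
    (TopologicalSpace.generateFrom
      {U | ∃ F : MvPolynomial (Fin n) K, U = {a | MvPolynomial.eval a F ≠ 0}})
    (fun _ => LinearMap.range (polyFun (fun a : Fin n → K => a)))
    ⟨1, by funext y; simp [polyFun]⟩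
    (by
      rintro _ _ _ _ ⟨F, rfl⟩ ⟨G, rfl⟩
      exact ⟨F * G, by funext y; simp [polyFun]⟩)

/-- The structure given on `Y` by homogeneous coordinates `h y` of the points `y` (which need only
be well-defined up to nonzero scalars): the basic open sets are the sets `F ≠ 0`, with `F` a
homogeneous polynomial, and the regular functions are locally quotients of two homogeneous
polynomials of the same degree. -/
def homogeneousSpace (Y : Type u) {ι : Type} (h : Y → ι → K) : FunctionSpace K :=
  fractionSpace Y
    (TopologicalSpace.generateFrom
      {U | ∃ (m : ℕ) (F : MvPolynomial ι K), F.IsHomogeneous m ∧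
        U = {y | MvPolynomial.eval (h y) F ≠ 0}})
    (fun m => (MvPolynomial.homogeneousSubmodule ι K m).map (polyFun h))
    ⟨1, MvPolynomial.isHomogeneous_one ι K, by funext y; simp [polyFun]⟩
    (by
      rintro _ _ _ _ ⟨F, hF, rfl⟩ ⟨G, hG, rfl⟩
      exact ⟨F * G, MvPolynomial.IsHomogeneous.mul hF hG, by funext y; simp [polyFun]⟩)

/-- Projective `n`-space. -/
def projectiveSpace (K : Type u) [Field K] (n : ℕ) : FunctionSpace K :=
  homogeneousSpace (Projectivization K (Fin (n + 1) → K)) (fun p => p.rep)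

/-- Morphisms: continuous maps which pull regular functions back to regular functions. -/
@[ext]
structure Morphism (X Y : FunctionSpace K) where
  toFun : X → Y
  continuous : Continuous toFun
  reg_comp : ∀ (V : Set Y) (g : Y → K), Y.Reg V g → X.Reg (toFun ⁻¹' V) (fun x => g (toFun x))

/-- Two spaces with functions are isomorphic. -/
def Isomorphic (X Y : FunctionSpace K) : Prop :=
  ∃ (f : Morphism X Y) (g : Morphism Y X),
    Function.LeftInverse g.toFun f.toFun ∧ Function.RightInverse g.toFun f.toFun

/-- Affine varieties: isomorphic to a Zariski-closed subset of an affine space. -/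
def IsAffineVariety (X : FunctionSpace K) : Prop :=
  ∃ (n : ℕ) (Z : Set (affineSpace K n)), IsClosed Z ∧ Isomorphic X ((affineSpace K n).sub Z)

/-- Projective varieties: isomorphic to a Zariski-closed subset of a projective space. -/
def IsProjectiveVariety (X : FunctionSpace K) : Prop :=
  ∃ (n : ℕ) (Z : Set (projectiveSpace K n)), IsClosed Z ∧
    Isomorphic X ((projectiveSpace K n).sub Z)

/-- (Not necessarily irreducible) algebraic varieties: there is a finite open cover by affine
varieties, and the space is separated, that is, any two morphisms from an affine variety agree on
a closed set. -/
structure IsVariety (X : FunctionSpace K) : Prop where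
  exists_cover : ∃ (n : ℕ) (U : Fin n → Set X), (∀ i, IsOpen (U i)) ∧ (⋃ i, U i) = Set.univ ∧
    ∀ i, IsAffineVariety (X.sub (U i))
  separated : ∀ Y : FunctionSpace K, IsAffineVariety Y → ∀ f g : Morphism Y X,
    IsClosed {y | f.toFun y = g.toFun y}

end Varieties

/-! ## Graded modules and their families -/

section Families

variable {K : Type u} [Field K] {A : Type u} [Ring A] [Algebra K A]

/-- A grading of the `A`-module `M`, where `A` is graded by the subspaces `𝒜 l`. -/
structure IsModuleGrading (𝒜 : ℤ → Submodule K A) {M : Type u} [AddCommGroup M] [Module K M]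
    [Module A M] (gr : ℤ → Submodule K M) : Prop where
  internal : DirectSum.IsInternal gr
  smul_mem : ∀ (l m : ℤ), ∀ a ∈ 𝒜 l, ∀ x ∈ gr m, a • x ∈ gr (l + m)

/-- Two graded modules are graded-isomorphic: there is an isomorphism which is homogeneous of
some degree `s`. -/
def GradedIsomorphic (A : Type u) [Ring A] [Algebra K A]
    {M N : Type u} [AddCommGroup M] [Module K M] [Module A M]
    [AddCommGroup N] [Module K N] [Module A N]
    (grM : ℤ → Submodule K M) (grN : ℤ → Submodule K N) : Prop :=
  ∃ (s : ℤ) (f : M ≃ₗ[A] N), ∀ m, ∀ x ∈ grM m, f x ∈ grN (m + s)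

/-- The module `M` has top `T`, that is, `M / J M` is isomorphic to `T`. -/
def HasTop (A : Type u) [Ring A] (T : Type u) [AddCommGroup T] [Module A T]
    (M : Type u) [AddCommGroup M] [Module A M] : Prop :=
  Nonempty ((M ⧸ (Ring.jacobson A • ⊤ : Submodule A M)) ≃ₗ[A] T)

/-- The `l`-th radical layer `J^l M / J^(l+1) M`. -/
abbrev RadLayer (A : Type u) [Ring A] (M : Type u) [AddCommGroup M] [Module A M] (l : ℕ) :
    Type u :=
  ↥(Ring.jacobson A ^ l • ⊤ : Submodule A M) ⧸
    (Ring.jacobson A ^ (l + 1) • ⊤ : Submodule A M).submoduleOf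
      (Ring.jacobson A ^ l • ⊤ : Submodule A M)

/-- The module `M` has radical layering `S = (S 0, …, S L)`. -/
def HasRadicalLayering (A : Type u) [Ring A] {L : ℕ} (S : Fin (L + 1) → Type u)
    [∀ l, AddCommGroup (S l)] [∀ l, Module A (S l)]
    (M : Type u) [AddCommGroup M] [Module A M] : Prop :=
  ∀ l : Fin (L + 1), Nonempty (RadLayer A M l ≃ₗ[A] S l)

/-- A local trivialization, over the set `dom`, of a family `E x` of vector spaces. -/
structure LocalTriv {X : Type u} (E : X → Type u) [∀ x, AddCommGroup (E x)] [∀ x, Module K (E x)]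
    (d : ℕ) where
  dom : Set X
  triv : ∀ x ∈ dom, E x ≃ₗ[K] (Fin d → K)

namespace LocalTriv

variable {X : Type u} {E : X → Type u} [∀ x, AddCommGroup (E x)] [∀ x, Module K (E x)] {d : ℕ}

/-- The coordinates of a vector in `E x`, for `x` in the domain. -/
def coord (c : LocalTriv (K := K) E d) (x : X) (e : E x) : Fin d → K :=
  open Classical in if h : x ∈ c.dom then c.triv x h e else 0

/-- The local frame given by the trivialization. -/
def frame (c : LocalTriv (K := K) E d) (j : Fin d) (x : X) : E x :=
  open Classical in if h : x ∈ c.dom then (c.triv x h).symm (Pi.single j 1) else 0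

/-- The pullback of a local trivialization. -/
def pullback {Y : Type u} (c : LocalTriv (K := K) E d) (τ : Y → X) :
    LocalTriv (K := K) (fun y => E (τ y)) d where
  dom := τ ⁻¹' c.dom
  triv y hy := c.triv (τ y) hy

end LocalTriv

/-- The data of a family of graded `A`-modules over `X`: the fibres with their module structures
and gradings, and an atlas of local trivializations. -/
structure FamilyData (K : Type u) [Field K] (A : Type u) [Ring A] [Algebra K A]
    (X : Type u) (d : ℕ) where
  fibre : X → Type u
  [instAddCommGroup : ∀ x, AddCommGroup (fibre x)]
  [instModuleK : ∀ x, Module K (fibre x)]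
  [instModuleA : ∀ x, Module A (fibre x)]
  [instTower : ∀ x, IsScalarTower K A (fibre x)]
  gr : ∀ x, ℤ → Submodule K (fibre x)
  atlas : Set (LocalTriv (K := K) fibre d)

attribute [instance] FamilyData.instAddCommGroup FamilyData.instModuleK FamilyData.instModuleA
  FamilyData.instTower

namespace FamilyData

variable {d : ℕ}

/-- The family induced by a map `τ` into the parametrizing space. -/
def pullback {X Y : Type u} (D : FamilyData K A X d) (τ : Y → X) : FamilyData K A Y d where
  fibre y := D.fibre (τ y)
  gr y := D.gr (τ y)
  atlas := {c | ∃ c₀ ∈ D.atlas, c = c₀.pullback τ}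

/-- Equivalence of families over `X`: the fibres over each point are graded-isomorphic. -/
def Equivalent {X : Type u} (D D' : FamilyData K A X d) : Prop :=
  ∀ x, GradedIsomorphic A (D.gr x) (D'.gr x)

/-- The change of coordinates from `c` to `c'` is given by regular functions. -/
def RegularTransition {X : FunctionSpace K} {E : X → Type u} [∀ x, AddCommGroup (E x)]
    [∀ x, Module K (E x)] (c c' : LocalTriv (K := K) E d) : Prop :=
  ∀ i j, X.Reg (c.dom ∩ c'.dom) (fun x => c'.coord x (c.frame j x) i)

/-- A local trivialization of the vector bundle given by the atlas. -/
def IsBundleTriv {X : FunctionSpace K} (D : FamilyData K A X d)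
    (c : LocalTriv (K := K) D.fibre d) : Prop :=
  IsOpen c.dom ∧ ∀ c' ∈ D.atlas, RegularTransition c c' ∧ RegularTransition c' c

/-- A family of subspaces of the fibres is a subbundle: locally there are trivializations of the
bundle which identify it with the subspace spanned by some of the standard basis vectors. -/
def IsSubbundle {X : FunctionSpace K} (D : FamilyData K A X d)
    (F : ∀ x, Submodule K (D.fibre x)) : Prop :=
  ∀ x₀ : X, ∃ c : LocalTriv (K := K) D.fibre d, D.IsBundleTriv c ∧ x₀ ∈ c.dom ∧
    ∃ s : Set (Fin d), ∀ x ∈ c.dom, ∀ e : D.fibre x, e ∈ F x ↔ ∀ i ∉ s, c.coord x e i = 0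

/-- The data form a family of `d`-dimensional graded `A`-modules parametrized by `X`, each fibre
being generated in the same single degree: an algebraic vector bundle of rank `d` on which `A` acts
by bundle endomorphisms, and which is the direct sum of subbundles making every fibre a
graded module. -/
structure IsFamily {X : FunctionSpace K} (𝒜 : ℤ → Submodule K A) (D : FamilyData K A X d) :
    Prop where
  atlas_compat : ∀ c ∈ D.atlas, D.IsBundleTriv c
  atlas_cover : ∀ x : X, ∃ c ∈ D.atlas, x ∈ c.dom
  smul_regular : ∀ a : A, ∀ c ∈ D.atlas, ∀ i j,
    X.Reg c.dom (fun x => c.coord x (a • c.frame j x) i)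
  grading : ∀ x, IsModuleGrading 𝒜 (D.gr x)
  subbundle : ∀ m : ℤ, D.IsSubbundle (fun x => D.gr x m)
  generated : ∃ s : ℤ, ∀ x, Submodule.span A (D.gr x s : Set (D.fibre x)) = ⊤

end FamilyData

/-- `Z`, with the family `Γ` as universal family, is a fine moduli space for the families of
`d`-dimensional graded `A`-modules in the class `𝒞`, up to graded isomorphism: every family over a
variety `X` is equivalent to the family induced from `Γ` by a unique morphism from `X` to `Z`. -/
structure IsFineModuliSpace (𝒜 : ℤ → Submodule K A) {d : ℕ}
    (𝒞 : ∀ (M : Type u) [AddCommGroup M] [Module A M], Prop)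
    (Z : FunctionSpace K) (Γ : FamilyData K A Z d) : Prop where
  isVariety : IsVariety Z
  isFamily : Γ.IsFamily 𝒜
  mem_class : ∀ z, 𝒞 (Γ.fibre z)
  universal : ∀ X : FunctionSpace K, IsVariety X → ∀ D : FamilyData K A X d, D.IsFamily 𝒜 →
    (∀ x, 𝒞 (D.fibre x)) → ∃! τ : Morphism X Z, D.Equivalent (Γ.pullback τ.toFun)

end Families

/-! ## Grassmannians -/

section Grassmannians

variable {K : Type u} [Field K]

/-- The `k`-dimensional subspaces of `W`. -/
def GrassmannianPoint (K : Type u) [Field K] (W : Type u) [AddCommGroup W] [Module K W] (k : ℕ) :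
    Type u :=
  {C : Submodule K W // Module.finrank K C = k}

/-- The Plücker coordinates of a `k`-dimensional subspace: the maximal minors of the matrix of
coordinates of a basis. -/
def plucker {W : Type u} [AddCommGroup W] [Module K W] [FiniteDimensional K W] {k : ℕ}
    (C : GrassmannianPoint K W k) (s : Fin k ↪o Fin (Module.finrank K W)) : K :=
  Matrix.det (Matrix.of fun i j : Fin k =>
    (Module.finBasis K W).repr (Module.finBasisOfFinrankEq K C.1 C.2 j : W) (s i))

/-- The classical Grassmannian of `k`-dimensional subspaces of `W`, with the structure
given by the Plücker embedding into a projective space. -/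
def grassmannian (K : Type u) [Field K] (W : Type u) [AddCommGroup W] [Module K W]
    [FiniteDimensional K W] (k : ℕ) : FunctionSpace K :=
  homogeneousSpace (GrassmannianPoint K W k) plucker

variable {A : Type u} [Ring A] [Algebra K A]
  {P : Type u} [AddCommGroup P] [Module K P] [Module A P] [IsScalarTower K A P]

instance finiteDimensional_submodule [FiniteDimensional K P] (N : Submodule A P) :
    FiniteDimensional K N :=
  inferInstanceAs (FiniteDimensional K (N.restrictScalars K))

variable (A P) in
/-- The radical `J P` of `P`. -/
abbrev radMod : Submodule A P := Ring.jacobson A • ⊤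

/-- The points of the graded Grassmannian: submodules `C` of `J P` which are homogeneous and
such that `P / C` has dimension `d`. -/
def GrGrassPoint (A : Type u) [Ring A] [Algebra K A] {P : Type u} [AddCommGroup P] [Module K P]
    [Module A P] [IsScalarTower K A P] (grP : ℤ → Submodule K P) (d : ℕ) : Type u :=
  {C : Submodule A P // C ≤ radMod A P ∧ Module.finrank K (P ⧸ C) = d ∧
    C.restrictScalars K = ⨆ m, C.restrictScalars K ⊓ grP m}

variable {grP : ℤ → Submodule K P} {d : ℕ}

theorem finrank_of_grGrass [FiniteDimensional K P] (C : GrGrassPoint A grP d) :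
    Module.finrank K ((C.1.submoduleOf (radMod A P)).restrictScalars K) =
      Module.finrank K P - d := by
  obtain ⟨C, hC, hd, _⟩ := C
  have h1 : Module.finrank K ((C.submoduleOf (radMod A P)).restrictScalars K) =
      Module.finrank K C :=
    LinearEquiv.finrank_eq ((Submodule.submoduleOfEquivOfLe hC).restrictScalars K)
  have h2 : Module.finrank K (P ⧸ C) + Module.finrank K C = Module.finrank K P :=
    Submodule.finrank_quotient_add_finrank (C.restrictScalars K)
  rw [h1]
  omega

/-- A point of the graded Grassmannian as a subspace of `J P`. -/
def GrGrassPoint.toGrassmannian [FiniteDimensional K P] (C : GrGrassPoint A grP d) :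
    GrassmannianPoint K (radMod A P) (Module.finrank K P - d) :=
  ⟨(C.1.submoduleOf (radMod A P)).restrictScalars K, finrank_of_grGrass C⟩

/-- The graded Grassmannian, as a subvariety of the Grassmannian of subspaces of
dimension `dim P - d` of `J P`. -/
def grGrass (A : Type u) [Ring A] [Algebra K A] {P : Type u} [AddCommGroup P] [Module K P]
    [Module A P] [IsScalarTower K A P] [FiniteDimensional K P] (grP : ℤ → Submodule K P) (d : ℕ) :
    FunctionSpace K :=
  (grassmannian K (radMod A P) (Module.finrank K P - d)).induced
    (fun C : GrGrassPoint A grP d => C.toGrassmannian)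

end Grassmannians

/-! ## The graded Grassmannians of local modules and their canonical family -/

section Local

variable {K : Type u} [Field K] {V : Type u} [Quiver.{u} V] [Fintype V]
  (I : Ideal (PathAlgebra V K)) [I.IsTwoSided]

/-- An abstract skeleton with top `S_v`: a nonempty set of paths, not in `I`, starting at `v` and
closed under right subpaths. -/
structure IsSkeleton (v : V) (σ : Set (QPath V)) : Prop where
  nonempty : σ.Nonempty
  src_eq : ∀ p ∈ σ, p.src = v
  notMem : ∀ p ∈ σ, ofPath K p ∉ I
  right_closed : ∀ p q r, QPath.comp p q = some r → r ∈ σ → q ∈ σ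

/-- The quotient `Λ e_v / C` has the skeleton `{p i}`: for each `l`, the classes of the `p z` with
`p` of length `l` in the skeleton form a basis of `J^l M / J^(l+1) M`, where `M = Λ e_v / C`. -/
def HasSkeleton (v : V) {d : ℕ} (p : Fin d → QPath V)
    (C : Submodule (PathAlgebra V K ⧸ I) (Proj I v)) : Prop :=
  ∀ l : ℕ,
    let N : Submodule (PathAlgebra V K ⧸ I) (Proj I v ⧸ C) :=
      Ring.jacobson (PathAlgebra V K ⧸ I) ^ (l + 1) • ⊤
    let b : {i : Fin d // (p i).length = l} → (Proj I v ⧸ C) ⧸ N :=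
      fun i => N.mkQ (C.mkQ (pathElt I v (p i)))
    LinearIndependent K b ∧
      Submodule.span K (Set.range b) =
        ((Ring.jacobson (PathAlgebra V K ⧸ I) ^ l •
          (⊤ : Submodule (PathAlgebra V K ⧸ I) (Proj I v ⧸ C))).map N.mkQ).restrictScalars K

variable [FiniteDimensional K (PathAlgebra V K ⧸ I)]

/-- The variety of homogeneous submodules `C` of `J e_v` with `dim Λ e_v / C = d`. -/
abbrev grGrassTop (v : V) (d : ℕ) : FunctionSpace K :=
  grGrass (PathAlgebra V K ⧸ I) (projGrading I v) d

/-- The canonical family over the graded Grassmannian: the fibre over `C` is `Λ e_v / C` with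
the grading inherited from `Λ e_v`, and for every skeleton `{p i}` the bundle is trivialized,
over the set of all `C` such that `Λ e_v / C` has this skeleton, by the classes of the
elements `p i z`. -/
def canonicalFamily (v : V) (d : ℕ) :
    FamilyData K (PathAlgebra V K ⧸ I) (grGrassTop I v d) d where
  fibre C := Proj I v ⧸ C.1
  gr C m := (projGrading I v m).map (C.1.mkQ.restrictScalars K)
  atlas := {c | ∃ p : Fin d → QPath V, Function.Injective p ∧ IsSkeleton I v (Set.range p) ∧
    c.dom = {C | HasSkeleton I v p C.1} ∧
    ∀ C (hC : C ∈ c.dom) (i : Fin d),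
      c.triv C hC (C.1.mkQ (pathElt I v (p i))) = Pi.single i 1}

variable {L : ℕ} (S : Fin (L + 1) → Type u) [∀ l, AddCommGroup (S l)]
  [∀ l, Module (PathAlgebra V K ⧸ I) (S l)]

/-- The points `C` such that `Λ e_v / C` has radical layering `S`. -/
def layeringLocus (v : V) (d : ℕ) : Set (grGrassTop I v d) :=
  {C | HasRadicalLayering (PathAlgebra V K ⧸ I) S (Proj I v ⧸ C.1)}

/-- The subvariety of the graded Grassmannian given by the radical layering `S`. -/
abbrev grGrassLayering (v : V) (d : ℕ) : FunctionSpace K :=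
  (grGrassTop I v d).sub (layeringLocus I S v d)

/-- The restriction of the canonical family. -/
abbrev canonicalFamilyLayering (v : V) (d : ℕ) :
    FamilyData K (PathAlgebra V K ⧸ I) (grGrassLayering I S v d) d :=
  (canonicalFamily I v d).pullback (Subtype.val : layeringLocus I S v d → grGrassTop I v d)

/-- Semisimple sequences of dimension `d` with top `T`; here `Λ e_v` is the projective cover
of `T`. -/
structure IsSemisimpleSequence [∀ l, Module K (S l)] (v : V) (T : Type u) [AddCommGroup T]
    [Module (PathAlgebra V K ⧸ I) T] (d : ℕ) : Prop where
  semisimple : ∀ l, IsSemisimpleModule (PathAlgebra V K ⧸ I) (S l)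
  top : Nonempty (S 0 ≃ₗ[PathAlgebra V K ⧸ I] T)
  embeds : ∀ l : Fin (L + 1),
    ∃ f : S l →ₗ[PathAlgebra V K ⧸ I] RadLayer (PathAlgebra V K ⧸ I) (Proj I v) l,
      Function.Injective f
  dim : ∑ l, Module.finrank K (S l) = d

end Local

end GradedModuli

end

set_option linter.unusedSectionVars false

/-! Everything rests on the fact that a graded module `M` with simple top, generated in degree `s`,
has an essentially unique generator. Radical elements raise degrees and nothing lives below `s`, so
`J M` meets the component of degree `s` trivially. That component therefore embeds in the top `Λ e_v
/ J e_v`, which is a line over `K`, and any nonzero `g` in it generates `M` (`generator_facts`). The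
relations `C` of `g`, the kernel of `u ↦ u g` on `Λ e_v`, do not change when `g` is rescaled. They
form a point of the graded Grassmannian (`ker_actOn_mem`) with `M` graded-isomorphic to `Λ e_v / C`
(`gradedIsomorphic_ker_actOn`), and no other point has this property (`eq_ker_actOn`). Hence a
family over `X` determines exactly one map from `X` to the Grassmannian.

This map is a morphism because a nowhere vanishing local section of the subbundle of degree `s`
makes `C` the kernel of a regular family of surjections from `Λ e_v` onto a fixed `K ^ d`. By
Cramer's rule such kernels have locally regular Plücker coordinates (`exists_reg_plucker`,
`isMor_of_ker_actOn`).

The canonical family is a bundle because the radical filtration of `Λ e_v / C` is its degree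
filtration. So the paths of a skeleton give bases of all radical layers if and only if their classes
form one basis of the quotient (`IsPathGraded.hasSkeleton_iff`). This is the nonvanishing of a
linear form in the Plücker coordinates, and coordinates in such a basis are ratios of linear forms
(`exists_chartForm`, `reg_coord`). Every quotient has a skeleton by Zorn's lemma
(`exists_skeleton`).

Projectivity: points of the graded Grassmannian are the subspaces of `J P` of the right dimension
which are stable under multiplications and degree projections. On each standard affine chart of
projective space, being the Plücker point of a stable subspace is expressed by regular equations
(`isClosed_plucker_image`).

For a fixed radical layering, two quotients with a common skeleton have isomorphic radical layers
(`nonempty_radLayer_equiv_of_basis`). The layering is thus locally constant and its level sets are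
closed (`isClosed_layeringLocus`). The universal property restricts to them, since isomorphic
modules have the same layering. -/

namespace GradedModuli

/-! ### Regular functions, inverses, and criteria for being a morphism -/

section Varieties

variable {K : Type u} [Field K]

/-- A function space in which the nonvanishing locus of a regular function is open and carries the
inverse function as a regular function. -/
def FunctionSpace.HasInverses (X : FunctionSpace K) : Prop :=
  ∀ (U : Set X) (f : X → K), X.Reg U f →
    IsOpen {x | x ∈ U ∧ f x ≠ 0} ∧ X.Reg {x | x ∈ U ∧ f x ≠ 0} (fun x => (f x)⁻¹)

/-- The algebra of functions which are regular on `U`. -/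
def FunctionSpace.regAlg (X : FunctionSpace K) {U : Set X} (hU : IsOpen U) :
    Subalgebra K (X → K) where
  carrier := {f | X.Reg U f}
  mul_mem' := X.reg_mul
  add_mem' := X.reg_add
  algebraMap_mem' c := X.reg_const c hU

theorem FunctionSpace.mem_regAlg {X : FunctionSpace K} {U : Set X} (hU : IsOpen U) {f : X → K} :
    f ∈ X.regAlg hU ↔ X.Reg U f := Iff.rfl

theorem reg_sum {X : FunctionSpace K} {U : Set X} (hU : IsOpen U) {ι : Type*} (s : Finset ι)
    {f : ι → X → K} (hf : ∀ i ∈ s, X.Reg U (f i)) : X.Reg U (fun x => ∑ i ∈ s, f i x) := by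
  have := (X.regAlg hU).sum_mem (t := s) (f := f) hf
  rw [FunctionSpace.mem_regAlg] at this
  convert this using 1
  funext x
  simp

theorem reg_sub {X : FunctionSpace K} {U : Set X} {f g : X → K} (hf : X.Reg U f)
    (hg : X.Reg U g) : X.Reg U (fun x => f x - g x) :=
  (X.regAlg (X.isOpen_of_reg hf)).sub_mem hf hg

theorem reg_eval {X : FunctionSpace K} {U : Set X} (hU : IsOpen U) {ι : Type*}
    {h : ι → X → K} (hh : ∀ i, X.Reg U (h i)) (F : MvPolynomial ι K) :
    X.Reg U (fun x => MvPolynomial.eval (fun i => h i x) F) := by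
  induction F using MvPolynomial.induction_on with
  | C a => simpa using X.reg_const a hU
  | add p q hp hq => simpa using X.reg_add hp hq
  | mul_X p i hp => simpa using X.reg_mul hp (hh i)

theorem reg_det {X : FunctionSpace K} {U : Set X} (hU : IsOpen U) {n : Type*} [Fintype n]
    [DecidableEq n] {M : X → Matrix n n K} (hM : ∀ i j, X.Reg U (fun x => M x i j)) :
    X.Reg U (fun x => (M x).det) := by
  simp only [Matrix.det_apply]
  refine reg_sum hU _ fun σ _ => ?_
  have h1 : (∏ i, fun x => M x (σ i) i) ∈ X.regAlg hU :=
    (X.regAlg hU).prod_mem fun i _ => hM _ _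
  have h2 := (X.regAlg hU).toSubring.zsmul_mem h1 (Equiv.Perm.sign σ : ℤ)
  refine X.reg_congr (f := ((Equiv.Perm.sign σ : ℤ) • ∏ i, fun x => M x (σ i) i)) h2 ?_
  intro x _
  simp [Units.smul_def]

theorem FunctionSpace.HasInverses.reg_div {X : FunctionSpace K} (hX : X.HasInverses) {U : Set X}
    {f g : X → K} (hf : X.Reg U f) (hg : X.Reg U g) :
    X.Reg {x | x ∈ U ∧ g x ≠ 0} (fun x => f x / g x) := by
  obtain ⟨h1, h2⟩ := hX U g hg
  simp only [div_eq_mul_inv]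
  exact X.reg_mul (X.reg_res hf h1 fun x hx => hx.1) h2

/-- If `f = F / G` locally, then `G / F` is a local fraction for the inverse wherever `F ≠ 0`.
Stating the form of `Reg` as a hypothesis covers affine and homogeneous spaces at once. -/
theorem hasInverses_of_reg_iff {X : FunctionSpace K} (A : ℕ → Submodule K (X → K))
    (hA : ∀ m, ∀ F ∈ A m, IsOpen {y | F y ≠ 0})
    (hX : ∀ U f, X.Reg U f ↔ IsOpen U ∧ ∀ y ∈ U, ∃ W : Set X, IsOpen W ∧ y ∈ W ∧ W ⊆ U ∧
      ∃ m : ℕ, ∃ F ∈ A m, ∃ G ∈ A m, ∀ y' ∈ W, G y' ≠ 0 ∧ f y' = F y' / G y') :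
    X.HasInverses := by
  intro U f hUf
  obtain ⟨hU, h⟩ := (hX U f).1 hUf
  have key : ∀ y ∈ {x | x ∈ U ∧ f x ≠ 0}, ∃ W : Set X, IsOpen W ∧ y ∈ W ∧
      W ⊆ {x | x ∈ U ∧ f x ≠ 0} ∧ ∃ m : ℕ, ∃ F ∈ A m, ∃ G ∈ A m, ∀ y' ∈ W, G y' ≠ 0 ∧
        (f y')⁻¹ = F y' / G y' := by
    rintro y ⟨hy, hfy⟩
    obtain ⟨W, hW, hyW, hWU, m, F, hF, G, hG, h⟩ := h y hy
    refine ⟨W ∩ {y | F y ≠ 0}, hW.inter (hA m F hF), ⟨hyW, ?_⟩, ?_, m, G, hG, F, hF, ?_⟩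
    · intro h0
      exact hfy (by rw [(h y hyW).2, h0, zero_div])
    · rintro z ⟨hz, hFz⟩
      exact ⟨hWU hz, by rw [(h z hz).2]; exact div_ne_zero hFz (h z hz).1⟩
    · rintro z ⟨hz, hFz⟩
      exact ⟨hFz, by rw [(h z hz).2, inv_div]⟩
  have ho : IsOpen {x | x ∈ U ∧ f x ≠ 0} := by
    refine isOpen_iff_forall_mem_open.2 fun y hy => ?_
    obtain ⟨W, hW, hyW, hWU, _⟩ := key y hy
    exact ⟨W, hWU, hW, hyW⟩
  exact ⟨ho, (hX _ _).2 ⟨ho, key⟩⟩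

theorem hasInverses_affineSpace (n : ℕ) : (affineSpace K n).HasInverses := by
  refine hasInverses_of_reg_iff (X := affineSpace K n)
    (fun _ => LinearMap.range (polyFun (fun a : Fin n → K => a))) ?_ fun U f => Iff.rfl
  rintro m _ ⟨F, rfl⟩
  exact TopologicalSpace.isOpen_generateFrom_of_mem ⟨F, rfl⟩

theorem hasInverses_homogeneousSpace (Y : Type u) {ι : Type} (h : Y → ι → K) :
    (homogeneousSpace Y h).HasInverses := by
  refine hasInverses_of_reg_iff (X := homogeneousSpace Y h)
    (fun m => (MvPolynomial.homogeneousSubmodule ι K m).map (polyFun h)) ?_ fun U f => Iff.rfl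
  rintro m _ ⟨F, hF, rfl⟩
  exact TopologicalSpace.isOpen_generateFrom_of_mem ⟨m, F, hF, rfl⟩

theorem induced_continuous (X : FunctionSpace K) {Y : Type u} (φ : Y → X) :
    @Continuous _ _ (X.induced φ).top X.top φ := continuous_induced_dom

theorem FunctionSpace.HasInverses.induced {X : FunctionSpace K} (hX : X.HasInverses) {Y : Type u}
    (φ : Y → X) : (X.induced φ).HasInverses := by
  rintro U f ⟨hU, h⟩
  have ho : IsOpen {x | x ∈ U ∧ f x ≠ 0} := by
    refine isOpen_iff_forall_mem_open.2 fun y hy => ?_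
    obtain ⟨W, g, hyW, hg, hW⟩ := h y hy.1
    have hyg : g (φ y) ≠ 0 := fun h0 => hy.2 ((hW y hy.1 hyW).trans h0)
    refine ⟨U ∩ φ ⁻¹' {x | x ∈ W ∧ g x ≠ 0}, ?_, ?_, hy.1, hyW, hyg⟩
    · rintro z ⟨hz, hzW, hgz⟩
      exact ⟨hz, by rwa [hW z hz hzW]⟩
    · exact @IsOpen.inter _ (X.induced φ).top _ _ hU
        ((induced_continuous X φ).isOpen_preimage _ (hX _ _ hg).1)
  refine ⟨ho, ho, fun y hy => ?_⟩
  obtain ⟨W, g, hyW, hg, hW⟩ := h y hy.1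
  exact ⟨{x | x ∈ W ∧ g x ≠ 0}, _, ⟨hyW, fun h0 => hy.2 ((hW y hy.1 hyW).trans h0)⟩, (hX _ _ hg).2,
    fun z hz hzW => congrArg _ (hW z hz.1 hzW.1)⟩

/-- The property of a map of being a morphism. -/
def IsMor (X Y : FunctionSpace K) (τ : X → Y) : Prop :=
  Continuous τ ∧ ∀ (V : Set Y) (g : Y → K), Y.Reg V g → X.Reg (τ ⁻¹' V) (fun x => g (τ x))

theorem Morphism.isMor {X Y : FunctionSpace K} (f : Morphism X Y) : IsMor X Y f.toFun :=
  ⟨f.continuous, f.reg_comp⟩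

/-- The morphism given by a map which is a morphism. -/
def IsMor.toMorphism {X Y : FunctionSpace K} {τ : X → Y} (h : IsMor X Y τ) : Morphism X Y :=
  ⟨τ, h.1, h.2⟩

theorem IsMor.comp {X Y Z : FunctionSpace K} {g : Y → Z} {f : X → Y} (hg : IsMor Y Z g)
    (hf : IsMor X Y f) : IsMor X Z (fun x => g (f x)) :=
  ⟨hg.1.comp hf.1, fun V k hk => hf.2 _ _ (hg.2 V k hk)⟩

theorem isMor_induced (X : FunctionSpace K) {Y : Type u} (φ : Y → X) :
    IsMor (X.induced φ) X φ := by
  have hc := induced_continuous X φ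
  refine ⟨hc, fun V g hg => ⟨hc.isOpen_preimage _ (X.isOpen_of_reg hg), fun y hy => ?_⟩⟩
  exact ⟨V, g, hy, hg, fun _ _ _ => rfl⟩

/-- The universal property of the induced structure; it is how maps into subvarieties and into the
graded Grassmannian are shown to be morphisms. -/
theorem isMor_to_induced {X Z : FunctionSpace K} {Y : Type u} (φ : Y → Z) {τ : X → Y}
    (h : IsMor X Z (fun x => φ (τ x))) : IsMor X (Z.induced φ) τ := by
  have hc : @Continuous _ _ X.top (Z.induced φ).top τ := continuous_induced_rng.2 h.1
  refine ⟨hc, ?_⟩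
  rintro V f ⟨hV, hf⟩
  have hVo : IsOpen (τ ⁻¹' V) := hc.isOpen_preimage _ hV
  refine X.reg_glue hVo fun x hx => ?_
  obtain ⟨W, g, hW, hg, hfg⟩ := hf _ hx
  have hr := h.2 W g hg
  refine ⟨τ ⁻¹' V ∩ (fun x => φ (τ x)) ⁻¹' W, ⟨hx, hW⟩, ?_⟩
  refine X.reg_congr (X.reg_res hr (hVo.inter (X.isOpen_of_reg hr)) Set.inter_subset_right) ?_
  exact fun x' hx' => (hfg _ hx'.1 hx'.2).symm

/-- A retraction suffices: pull a function back along `g`, invert it on `Y`, and pull the inverse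
back along `f`. -/
theorem FunctionSpace.HasInverses.of_isMor {X Y : FunctionSpace K} (hY : Y.HasInverses)
    {f : X → Y} {g : Y → X} (hf : IsMor X Y f) (hg : IsMor Y X g) (hfg : ∀ x, g (f x) = x) :
    X.HasInverses := by
  intro U k hk
  have h1 := hY _ _ (hg.2 U k hk)
  have h2 := hf.2 _ _ h1.2
  have hs : f ⁻¹' {x | x ∈ g ⁻¹' U ∧ k (g x) ≠ 0} = {x | x ∈ U ∧ k x ≠ 0} := by
    ext x
    simp [hfg]
  simp only [hs, hfg] at h2
  exact ⟨X.isOpen_of_reg h2, h2⟩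

theorem IsAffineVariety.hasInverses {X : FunctionSpace K} (hX : IsAffineVariety X) :
    X.HasInverses := by
  obtain ⟨n, Z, _, f, g, hfg, _⟩ := hX
  exact ((hasInverses_affineSpace n).induced _).of_isMor f.isMor g.isMor hfg

/-- Invertibility is not among the axioms of a function space. It is a local property, inherited
from affine space through the affine charts. -/
theorem IsVariety.hasInverses {X : FunctionSpace K} (hX : IsVariety X) : X.HasInverses := by
  obtain ⟨n, U, hU, hcov, haff⟩ := hX.exists_cover
  intro W f hf
  have key : ∀ x ∈ {x | x ∈ W ∧ f x ≠ 0}, ∃ W', x ∈ W' ∧ W' ⊆ {x | x ∈ W ∧ f x ≠ 0} ∧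
      X.Reg W' (fun x => (f x)⁻¹) := by
    rintro x ⟨hxW, hfx⟩
    obtain ⟨i, hi⟩ := Set.mem_iUnion.1 (hcov ▸ Set.mem_univ x : x ∈ ⋃ i, U i)
    have h1 := (isMor_induced X (Subtype.val : U i → X)).2 W f hf
    obtain ⟨-, ⟨-, h2⟩⟩ := (haff i).hasInverses _ _ h1
    obtain ⟨O, k, hxO, hk, hO⟩ := h2 ⟨x, hi⟩ ⟨hxW, hfx⟩
    obtain ⟨hS, -⟩ := (haff i).hasInverses _ _ h1
    obtain ⟨O', hO', hO'eq⟩ := hS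
    have hmem : ∀ y (hy : y ∈ U i), y ∈ O' ↔ y ∈ W ∧ f y ≠ 0 := fun y hy =>
      Set.ext_iff.1 hO'eq ⟨y, hy⟩
    -- `k` is known to equal `1 / f` only at points of `U i` where `f` is defined and nonzero; `O'`
    -- is an open set of `X` cutting out exactly these points.
    refine ⟨O ∩ (O' ∩ U i), ⟨hxO, (hmem x hi).2 ⟨hxW, hfx⟩, hi⟩, ?_, ?_⟩
    · rintro y ⟨_, hy1, hy2⟩
      exact (hmem y hy2).1 hy1
    · refine X.reg_congr (X.reg_res hk ((X.isOpen_of_reg hk).inter (hO'.inter (hU i)))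
        Set.inter_subset_left) ?_
      rintro y ⟨hy, hy1, hy2⟩
      exact (hO ⟨y, hy2⟩ ((hmem y hy2).1 hy1) hy).symm
  have ho : IsOpen {x | x ∈ W ∧ f x ≠ 0} := by
    refine isOpen_iff_forall_mem_open.2 fun x hx => ?_
    obtain ⟨W', hx, hW', hr⟩ := key x hx
    exact ⟨W', hW', X.isOpen_of_reg hr, hx⟩
  refine ⟨ho, X.reg_glue ho fun x hx => ?_⟩
  obtain ⟨W', hx, hW', hr⟩ := key x hx
  exact ⟨W', hx, hr⟩

/-- Polynomials in regular functions are regular. Inverses are needed twice: for the openness of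
preimages of basic open sets, and for pulling back fractions. -/
theorem isMor_to_affineSpace {X : FunctionSpace K} (hX : X.HasInverses) {n : ℕ}
    {τ : X → affineSpace K n}
    (h : ∀ t, X.Reg Set.univ (fun x => (τ x : Fin n → K) t)) : IsMor X (affineSpace K n) τ := by
  have hp : ∀ F : MvPolynomial (Fin n) K,
      X.Reg Set.univ (fun x => MvPolynomial.eval (τ x : Fin n → K) F) :=
    fun F => reg_eval isOpen_univ h F
  have hc : Continuous τ := by
    refine continuous_generateFrom_iff.2 ?_
    rintro _ ⟨F, rfl⟩
    have := (hX _ _ (hp F)).1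
    simp only [Set.mem_univ, true_and] at this
    exact this
  refine ⟨hc, ?_⟩
  rintro V f ⟨hV, hf⟩
  refine X.reg_glue (hV.preimage hc) fun x hx => ?_
  obtain ⟨W, hW, hxW, hWV, m, _, ⟨F, rfl⟩, _, ⟨G, rfl⟩, hfg⟩ := hf _ hx
  refine ⟨τ ⁻¹' W, hxW, ?_⟩
  refine X.reg_congr (X.reg_res (hX.reg_div (hp F) (hp G)) (hW.preimage hc) ?_) ?_
  · exact fun y hy => ⟨trivial, (hfg _ hy).1⟩
  · exact fun y hy => ((hfg _ hy).2).symm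

theorem eval_smul_of_isHomogeneous {ι : Type*} {F : MvPolynomial ι K} {m : ℕ}
    (hF : F.IsHomogeneous m) (c : K) (a : ι → K) :
    MvPolynomial.eval (c • a) F = c ^ m * MvPolynomial.eval a F := by
  simp only [MvPolynomial.eval_eq, Finset.mul_sum]
  refine Finset.sum_congr rfl fun d hd => ?_
  have h1 : ∑ i ∈ d.support, d i = m := by
    have := hF (MvPolynomial.mem_support_iff.1 hd)
    rw [← this]
    simp [Finsupp.weight_apply, Finsupp.sum]
  simp only [Pi.smul_apply, smul_eq_mul, mul_pow, Finset.prod_mul_distrib]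
  rw [Finset.prod_pow_eq_pow_sum, h1]
  ring

/-- The scalar `c` may depend on `x` in an arbitrary way: a form of degree `m` is multiplied by `c ^
m`, which affects neither its nonvanishing nor a ratio of two forms of degree `m`. -/
theorem isMor_to_homogeneousSpace {X : FunctionSpace K} (hX : X.HasInverses) {Y : Type u}
    {ι : Type} {h : Y → ι → K} {τ : X → homogeneousSpace Y h}
    (H : ∀ x₀ : X, ∃ U : Set X, x₀ ∈ U ∧ IsOpen U ∧ ∃ h' : ι → X → K, (∀ t, X.Reg U (h' t)) ∧
      ∀ x ∈ U, ∃ c : K, c ≠ 0 ∧ h (τ x) = c • fun t => h' t x) :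
    IsMor X (homogeneousSpace Y h) τ := by
  have hc : Continuous τ := by
    refine continuous_generateFrom_iff.2 ?_
    rintro _ ⟨m, F, hF, rfl⟩
    refine isOpen_iff_forall_mem_open.2 fun x₀ hx₀ => ?_
    obtain ⟨U, hxU, hU, h', hr, hh⟩ := H x₀
    have key : ∀ x ∈ U, MvPolynomial.eval (h (τ x)) F ≠ 0 ↔
        MvPolynomial.eval (fun t => h' t x) F ≠ 0 := by
      intro x hx
      obtain ⟨c, hc, hcx⟩ := hh x hx
      rw [hcx, eval_smul_of_isHomogeneous hF]
      simp [hc]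
    exact ⟨_, fun x hx => (key x hx.1).2 hx.2, (hX _ _ (reg_eval hU hr F)).1,
      hxU, (key _ hxU).1 hx₀⟩
  refine ⟨hc, ?_⟩
  rintro V f ⟨hV, hf⟩
  refine X.reg_glue (hV.preimage hc) fun x₀ hx₀ => ?_
  obtain ⟨W, hW, hxW, hWV, m, _, ⟨F, hF, rfl⟩, _, ⟨G, hG, rfl⟩, hfg⟩ := hf _ hx₀
  obtain ⟨U, hxU, hU, h', hr, hh⟩ := H x₀
  have key : ∀ x ∈ τ ⁻¹' W ∩ U, MvPolynomial.eval (fun t => h' t x) G ≠ 0 ∧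
      f (τ x) = MvPolynomial.eval (fun t => h' t x) F / MvPolynomial.eval (fun t => h' t x) G := by
    rintro x ⟨hx, hxU⟩
    obtain ⟨c, hc, hcx⟩ := hh x hxU
    obtain ⟨h1, h2⟩ := hfg _ hx
    simp only [polyFun, LinearMap.coe_mk, AddHom.coe_mk] at h1 h2
    rw [hcx, eval_smul_of_isHomogeneous hG] at h1
    rw [hcx, eval_smul_of_isHomogeneous hG, eval_smul_of_isHomogeneous hF] at h2
    refine ⟨right_ne_zero_of_mul h1, ?_⟩
    rw [h2, mul_div_mul_left _ _ (pow_ne_zero m hc)]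
  refine ⟨τ ⁻¹' W ∩ U, ⟨hxW, hxU⟩, ?_⟩
  refine X.reg_congr (X.reg_res (hX.reg_div (reg_eval hU hr F) (reg_eval hU hr G))
    ((hW.preimage hc).inter hU) ?_) ?_
  · exact fun y hy => ⟨hy.2, (key y hy).1⟩
  · exact fun y hy => ((key y hy).2).symm

/-- The ratio of two linear forms in the homogeneous coordinates is regular where the denominator
does not vanish. -/
theorem reg_homogeneousSpace_div {Y : Type u} {ι : Type} (h : Y → ι → K) {F G : MvPolynomial ι K}
    {m : ℕ} (hF : F.IsHomogeneous m) (hG : G.IsHomogeneous m) :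
    (homogeneousSpace Y h).Reg {y | MvPolynomial.eval (h y) G ≠ 0}
      (fun y => MvPolynomial.eval (h y) F / MvPolynomial.eval (h y) G) := by
  have ho : @IsOpen _ (homogeneousSpace Y h).top {y | MvPolynomial.eval (h y) G ≠ 0} :=
    TopologicalSpace.isOpen_generateFrom_of_mem ⟨m, G, hG, rfl⟩
  refine ⟨ho, fun y hy => ⟨_, ho, hy, subset_rfl, m, _, ⟨F, hF, rfl⟩, _, ⟨G, hG, rfl⟩, ?_⟩⟩
  exact fun y' hy' => ⟨hy', rfl⟩

theorem reg_homogeneousSpace_coord_div {Y : Type u} {ι : Type} (h : Y → ι → K) (s t : ι) :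
    (homogeneousSpace Y h).Reg {y | h y s ≠ 0} (fun y => h y t / h y s) := by
  simpa using reg_homogeneousSpace_div h (MvPolynomial.isHomogeneous_X K t)
    (MvPolynomial.isHomogeneous_X K s)

end Varieties

/-! ### Projective varieties: affine charts, separatedness, closed subsets -/

section ProjectiveVarieties

variable {K : Type u} [Field K]

theorem isMor_sub_val (X : FunctionSpace K) (Z : Set X) :
    IsMor (X.sub Z) X (Subtype.val : Z → X) := isMor_induced X _

theorem isMor_to_sub {X Y : FunctionSpace K} {Z : Set Y} {τ : X → Y} (h : IsMor X Y τ)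
    (hZ : ∀ x, τ x ∈ Z) : IsMor X (Y.sub Z) (fun x => (⟨τ x, hZ x⟩ : Z)) :=
  isMor_to_induced (Z := Y) (Subtype.val : Z → Y) h

/-- A space `X` is isomorphic to a subspace of `Y` if there are mutually inverse morphisms. -/
theorem isomorphic_sub {X Y : FunctionSpace K} {Z : Set Y} {f : X → Y} {g : Z → X}
    (hf : IsMor X Y f) (hfZ : ∀ x, f x ∈ Z) (hg : IsMor (Y.sub Z) X g)
    (hgf : ∀ x, g ⟨f x, hfZ x⟩ = x) (hfg : ∀ z : Z, f (g z) = z) : Isomorphic X (Y.sub Z) :=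
  ⟨(isMor_to_sub hf hfZ).toMorphism, hg.toMorphism, hgf, fun z => Subtype.ext (hfg z)⟩

/-- The point of projective space with given homogeneous coordinates. -/
noncomputable def projPoint {n : ℕ} (a : Fin (n + 1) → K) : projectiveSpace K n :=
  open Classical in
  if h : a ≠ 0 then Projectivization.mk K a h
  -- An arbitrary value at the zero vector, which makes the map total.
  else Projectivization.mk K (fun _ => 1) (fun h => one_ne_zero (congrFun h 0))

/-- Homogeneous coordinates of a point of projective space. -/
noncomputable def projCoord {n : ℕ} (p : projectiveSpace K n) : Fin (n + 1) → K :=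
  Projectivization.rep (K := K) (V := Fin (n + 1) → K) p

theorem projCoord_ne_zero {n : ℕ} (p : projectiveSpace K n) : projCoord p ≠ 0 :=
  Projectivization.rep_nonzero _

theorem exists_projCoord_ne_zero {n : ℕ} (p : projectiveSpace K n) : ∃ i, projCoord p i ≠ 0 :=
  Function.ne_iff.1 (projCoord_ne_zero p)

theorem projPoint_eq_mk {n : ℕ} {a : Fin (n + 1) → K} (ha : a ≠ 0) :
    projPoint a = (Projectivization.mk K a ha : Projectivization K (Fin (n + 1) → K)) :=
  dif_pos ha

theorem projCoord_projPoint {n : ℕ} {a : Fin (n + 1) → K} (ha : a ≠ 0) :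
    ∃ c : K, c ≠ 0 ∧ projCoord (projPoint a) = c • a := by
  obtain ⟨c, hc⟩ := Projectivization.exists_smul_eq_mk_rep K a ha
  exact ⟨c, c.ne_zero, (congrArg projCoord (projPoint_eq_mk ha)).trans hc.symm⟩

theorem projPoint_eq_of_smul {n : ℕ} {p : projectiveSpace K n} {a : Fin (n + 1) → K} {c : K}
    (hc : c ≠ 0) (h : a = c • projCoord p) : projPoint a = p := by
  have ha : a ≠ 0 := by
    rw [h]
    exact smul_ne_zero hc (projCoord_ne_zero p)
  rw [projPoint_eq_mk ha]
  refine Eq.trans ?_ (Projectivization.mk_rep (K := K) (V := Fin (n + 1) → K) p)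
  exact (Projectivization.mk_eq_mk_iff' K _ _ _ _).2 ⟨c, h.symm⟩

theorem isMor_projPoint {X : FunctionSpace K} (hX : X.HasInverses) {n : ℕ}
    {h : Fin (n + 1) → X → K} (hr : ∀ t, X.Reg Set.univ (h t)) (h0 : ∀ x, ∃ t, h t x ≠ 0) :
    IsMor X (projectiveSpace K n) (fun x => projPoint fun t => h t x) := by
  refine isMor_to_homogeneousSpace hX fun x₀ => ⟨Set.univ, trivial, isOpen_univ, h, hr,
    fun x _ => ?_⟩
  exact projCoord_projPoint (Function.ne_iff.2 (h0 x))

theorem reg_projCoord_div {n : ℕ} (i t : Fin (n + 1)) :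
    (projectiveSpace K n).Reg {p | projCoord p i ≠ 0} (fun p => projCoord p t / projCoord p i) :=
  reg_homogeneousSpace_coord_div _ i t

theorem isOpen_projCoord_ne_zero {n : ℕ} (i : Fin (n + 1)) :
    IsOpen {p : projectiveSpace K n | projCoord p i ≠ 0} :=
  (projectiveSpace K n).isOpen_of_reg (reg_projCoord_div i i)

theorem hasInverses_projectiveSpace (n : ℕ) : (projectiveSpace K n).HasInverses :=
  hasInverses_homogeneousSpace _ _

theorem isOpen_of_isOpen_sub {X : FunctionSpace K} {U : Set X} (hU : IsOpen U)
    {W : Set (X.sub U)} (hW : IsOpen W) : IsOpen ((Subtype.val : U → X) '' W) := by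
  obtain ⟨O, hO, rfl⟩ := hW
  rw [Subtype.image_preimage_coe]
  exact hU.inter hO

theorem reg_affine_coord {n : ℕ} (t : Fin n) :
    (affineSpace K n).Reg Set.univ (fun a => (a : Fin n → K) t) := by
  have ho : @IsOpen _ (affineSpace K n).top Set.univ := isOpen_univ (X := affineSpace K n)
  refine ⟨ho, fun y hy => ⟨_, ho, hy, subset_rfl, 0, _,
    ⟨MvPolynomial.X t, rfl⟩, _, ⟨1, rfl⟩, ?_⟩⟩
  intro y' _
  simp [polyFun]

/-- The cone chart of a closed subset of projective space is closed in affine space. -/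
theorem isClosed_chart {n : ℕ} {Z : Set (projectiveSpace K n)} (hZ : IsClosed Z)
    (i : Fin (n + 1)) :
    IsClosed {a : affineSpace K (n + 1) | (a : Fin (n + 1) → K) i = 1 ∧ projPoint a ∈ Z} := by
  set A := affineSpace K (n + 1)
  have hA : A.HasInverses := hasInverses_affineSpace _
  have h1 : IsOpen {a : A | (a : Fin (n + 1) → K) i - 1 ≠ 0} := by
    have := (hA _ _ (reg_sub (reg_affine_coord i) (A.reg_const 1 isOpen_univ))).1
    simpa using this
  have h2 : IsOpen {a : A | (a : Fin (n + 1) → K) i ≠ 0} := by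
    have := (hA _ _ (reg_affine_coord i)).1
    simpa using this
  -- `projPoint` is a morphism only away from the zero vector. The condition on `Z` is therefore
  -- tested on this open set, which contains the slice where coordinate `i` is `1`.
  set D : Set A := {a | (a : Fin (n + 1) → K) i ≠ 0} with hD
  have h3 : IsMor (A.sub D) (projectiveSpace K n)
      (fun x => projPoint fun t => (x.1 : Fin (n + 1) → K) t) := by
    refine isMor_projPoint (hA.induced _) (h := fun t (x : A.sub D) => (x.1 : Fin (n + 1) → K) t)
      (fun t => ?_) fun x => ⟨i, x.2⟩
    exact (isMor_sub_val A D).2 _ _ (reg_affine_coord t)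
  have h4 := isOpen_of_isOpen_sub h2 (h3.1.isOpen_preimage _ hZ.isOpen_compl)
  rw [← isOpen_compl_iff]
  convert h1.union h4 using 1
  ext a
  simp only [Set.mem_compl_iff, Set.mem_ofPred_eq, not_and, Set.mem_union, ne_eq, sub_eq_zero]
  constructor
  · intro h
    by_cases ha : (a : Fin (n + 1) → K) i = 1
    · right
      refine ⟨⟨a, ?_⟩, h ha, rfl⟩
      simp [hD, ha]
    · exact Or.inl ha
  · rintro (h | ⟨b, hb, rfl⟩) h'
    · exact absurd h' h
    · exact hb

/-- The chart `x i ≠ 0` is identified with the slice `a i = 1` of affine `(n + 1)`-space, by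
dividing the homogeneous coordinates by the `i`-th one. Separatedness holds because proportionality
of two coordinate vectors is given by regular equations. -/
theorem IsProjectiveVariety.isVariety {X : FunctionSpace K} (hX : IsProjectiveVariety X) :
    IsVariety X := by
  obtain ⟨n, Z, hZ, f, g, hgf, hfg⟩ := hX
  have hXi : X.HasInverses :=
    ((hasInverses_projectiveSpace n).induced _).of_isMor f.isMor g.isMor hgf
  set j : X → projectiveSpace K n := fun x => (f.toFun x : Z).1 with hj
  have hjm : IsMor X (projectiveSpace K n) j := (isMor_sub_val _ Z).comp f.isMor
  have hjZ : ∀ x, j x ∈ Z := fun x => (f.toFun x : Z).2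
  have hreg : ∀ i t, X.Reg {x | projCoord (j x) i ≠ 0}
      (fun x => projCoord (j x) t / projCoord (j x) i) :=
    fun i t => hjm.2 _ _ (reg_projCoord_div i t)
  refine ⟨⟨n + 1, fun i => {x | projCoord (j x) i ≠ 0}, fun i => X.isOpen_of_reg (hreg i i), ?_,
    fun i => ?_⟩, ?_⟩
  · ext x
    simpa using exists_projCoord_ne_zero (j x)
  · set U : Set X := {x | projCoord (j x) i ≠ 0} with hU
    set A := affineSpace K (n + 1)
    set Z' : Set A := {a | (a : Fin (n + 1) → K) i = 1 ∧ projPoint a ∈ Z} with hZ'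
    refine ⟨n + 1, Z', isClosed_chart hZ i, ?_⟩
    set α : X.sub U → A := fun x => (fun t => projCoord (j x.1) t / projCoord (j x.1) i :
      Fin (n + 1) → K) with hα
    have hαp : ∀ x, projPoint (α x) = j x.1 := fun x =>
      projPoint_eq_of_smul (inv_ne_zero x.2) (by
        funext t
        simp only [hα, Pi.smul_apply, smul_eq_mul, div_eq_inv_mul])
    have hαm : IsMor (X.sub U) A α := by
      refine isMor_to_affineSpace (hXi.induced _) fun t => ?_
      have := (isMor_sub_val X U).2 _ _ (hreg i t)
      exact (X.sub U).reg_res this (isOpen_univ (X := X.sub U)) fun x _ => x.2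
    have hαZ : ∀ x, α x ∈ Z' := fun x => ⟨div_self x.2, by rw [hαp]; exact hjZ _⟩
    set β : Z' → X := fun a => g.toFun (⟨projPoint a.1, a.2.2⟩ : Z) with hβ
    have hjβ : ∀ a, j (β a) = projPoint a.1 := fun a => congrArg Subtype.val (hfg ⟨_, a.2.2⟩)
    have hβm : IsMor (A.sub Z') X β := by
      refine g.isMor.comp (isMor_to_sub (X := A.sub Z') (τ := fun a => projPoint a.1) ?_ _)
      refine isMor_projPoint ((hasInverses_affineSpace _).induced _)
        (h := fun t (x : A.sub Z') => (x.1 : Fin (n + 1) → K) t) (fun t => ?_) fun x => ⟨i, ?_⟩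
      · exact (isMor_sub_val A Z').2 _ _ (reg_affine_coord t)
      · exact x.2.1 ▸ one_ne_zero
    have hcoord : ∀ a : Z', ∃ c : K, c ≠ 0 ∧ projCoord (j (β a)) = c • (id a.1 : Fin (n + 1) → K) := by
      intro a
      rw [hjβ]
      refine projCoord_projPoint fun h => ?_
      exact zero_ne_one ((congrFun h i).symm.trans a.2.1)
    have hβU : ∀ a, β a ∈ U := by
      intro a
      obtain ⟨c, hc, h⟩ := hcoord a
      have h1 : projCoord (j (β a)) i = c * 1 := (congrFun h i).trans (congrArg (c * ·) a.2.1)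
      rw [hU, Set.mem_ofPred_eq, h1, mul_one]
      exact hc
    refine isomorphic_sub (g := fun a => (⟨β a, hβU a⟩ : U)) hαm hαZ (isMor_to_sub hβm hβU) ?_ ?_
    · intro x
      refine Subtype.ext ?_
      have : (⟨projPoint (α x), (hαZ x).2⟩ : Z) = f.toFun x.1 := Subtype.ext (hαp x)
      simp only [hβ]
      rw [this]
      exact hgf x.1
    · intro a
      obtain ⟨c, hc, h⟩ := hcoord a
      funext t
      have h1 : projCoord (j (β a)) i = c * 1 := (congrFun h i).trans (congrArg (c * ·) a.2.1)
      have h2 : projCoord (j (β a)) t = c * (id a.1 : Fin (n + 1) → K) t := congrFun h t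
      refine Eq.trans (congrArg₂ (· / ·) h2 h1) ?_
      rw [mul_one, mul_div_cancel_left₀ _ hc]
      rfl
  · intro Y hY p q
    have hYi := hY.hasInverses
    rw [← isOpen_compl_iff]
    refine isOpen_iff_forall_mem_open.2 fun y hy => ?_
    obtain ⟨a, ha⟩ := exists_projCoord_ne_zero (j (p.toFun y))
    obtain ⟨b, hb⟩ := exists_projCoord_ne_zero (j (q.toFun y))
    have hp := fun t => p.isMor.2 _ _ (hreg a t)
    have hq := fun t => q.isMor.2 _ _ (hreg b t)
    set O : Set Y := (p.toFun ⁻¹' {x | projCoord (j x) a ≠ 0}) ∩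
      (q.toFun ⁻¹' {x | projCoord (j x) b ≠ 0}) with hO
    have hOo : IsOpen O := (Y.isOpen_of_reg (hp a)).inter (Y.isOpen_of_reg (hq b))
    have hr := fun t => reg_sub (Y.reg_mul (Y.reg_res (hp t) hOo Set.inter_subset_left)
      (Y.reg_res (hq a) hOo Set.inter_subset_right)) (Y.reg_res (hq t) hOo Set.inter_subset_right)
    -- These functions vanish wherever `p` and `q` agree. If all of them vanish at `y`, the
    -- coordinate vectors there are proportional and `p y = q y`. Otherwise one is nonzero on an
    -- open neighbourhood of `y`, where `p` and `q` differ.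
    by_cases hall : ∀ t, projCoord (j (p.toFun y)) t / projCoord (j (p.toFun y)) a *
        (projCoord (j (q.toFun y)) a / projCoord (j (q.toFun y)) b) -
        projCoord (j (q.toFun y)) t / projCoord (j (q.toFun y)) b = 0
    · exfalso
      have h1 : ∀ t, projCoord (j (q.toFun y)) t =
          (projCoord (j (q.toFun y)) a / projCoord (j (p.toFun y)) a) *
            projCoord (j (p.toFun y)) t := by
        intro t
        have := sub_eq_zero.1 (hall t)
        field_simp at this ⊢
        rw [← this]
      have h2 : projCoord (j (q.toFun y)) a ≠ 0 := by
        intro h0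
        apply hb
        rw [h1 b, h0, zero_div, zero_mul]
      have h3 : projPoint (projCoord (j (q.toFun y))) = j (p.toFun y) :=
        projPoint_eq_of_smul (div_ne_zero h2 ha) (funext h1)
      have h4 : projPoint (projCoord (j (q.toFun y))) = j (q.toFun y) :=
        projPoint_eq_of_smul one_ne_zero (by simp)
      have h5 : f.toFun (p.toFun y) = f.toFun (q.toFun y) := Subtype.ext (h3.symm.trans h4)
      exact hy (hgf.injective h5)
    · push Not at hall
      obtain ⟨t, ht⟩ := hall
      refine ⟨_, ?_, (hYi _ _ (hr t)).1, ⟨ha, hb⟩, ht⟩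
      rintro z ⟨⟨hza, hzb⟩, hz⟩ heq
      apply hz
      rw [Set.mem_ofPred_eq] at heq
      have h1 : projCoord (j (q.toFun z)) b ≠ 0 := hzb
      have h2 : projCoord (j (p.toFun z)) a ≠ 0 := hza
      rw [heq] at h2 ⊢
      field_simp
      ring

/-- A closed subset of a projective variety is a projective variety. -/
theorem IsProjectiveVariety.sub_of_isClosed {X : FunctionSpace K} (hX : IsProjectiveVariety X)
    {Z : Set X} (hZ : IsClosed Z) : IsProjectiveVariety (X.sub Z) := by
  obtain ⟨n, Y, hY, f, g, hgf, hfg⟩ := hX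
  set j : X → projectiveSpace K n := fun x => (f.toFun x : Y).1 with hj
  have hjm : IsMor X (projectiveSpace K n) j := (isMor_sub_val _ Y).comp f.isMor
  have hgZ : IsClosed ((Subtype.val : Y → projectiveSpace K n) '' (g.toFun ⁻¹' Z)) := by
    have hc : IsClosed (g.toFun ⁻¹' Z) := hZ.preimage g.continuous
    obtain ⟨O, hO, hOeq⟩ := hc.isOpen_compl
    have : (Subtype.val : Y → projectiveSpace K n) '' (g.toFun ⁻¹' Z) = Y ∩ Oᶜ := by
      ext p
      constructor
      · rintro ⟨y, hy, rfl⟩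
        refine ⟨y.2, fun h => ?_⟩
        have : y ∈ (g.toFun ⁻¹' Z)ᶜ := hOeq ▸ h
        exact this hy
      · rintro ⟨hp, hpO⟩
        refine ⟨⟨p, hp⟩, ?_, rfl⟩
        by_contra hcon
        have : (⟨p, hp⟩ : Y) ∈ (g.toFun ⁻¹' Z)ᶜ := hcon
        rw [← hOeq] at this
        exact hpO this
    rw [this]
    exact hY.inter hO.isClosed_compl
  refine ⟨n, _, hgZ, ?_⟩
  set Z' := (Subtype.val : Y → projectiveSpace K n) '' (g.toFun ⁻¹' Z) with hZ'
  have hZY : ∀ z ∈ Z', z ∈ Y := by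
    rintro _ ⟨y, _, rfl⟩
    exact y.2
  have hZg : ∀ z (hz : z ∈ Z'), g.toFun (⟨z, hZY z hz⟩ : Y) ∈ Z := by
    rintro _ ⟨y, hy, rfl⟩
    exact hy
  refine isomorphic_sub (f := fun x : X.sub Z => j x.1)
    (g := fun z : Z' => (⟨g.toFun (⟨z.1, hZY _ z.2⟩ : Y), hZg _ z.2⟩ : Z))
    (hjm.comp (isMor_sub_val X Z)) ?_ ?_ ?_ ?_
  · intro x
    refine ⟨f.toFun x.1, ?_, rfl⟩
    change g.toFun (f.toFun x.1) ∈ Z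
    rw [hgf]
    exact x.2
  · exact isMor_to_sub (g.isMor.comp (isMor_to_sub (isMor_sub_val _ Z') fun z => hZY _ z.2)) _
  · exact fun x => Subtype.ext (hgf x.1)
  · exact fun z => congrArg Subtype.val (hfg ⟨z.1, hZY _ z.2⟩)

theorem isMor_of_isEmpty {X Y : FunctionSpace K} (hX : IsEmpty X) (f : X → Y) : IsMor X Y f := by
  have ho : ∀ S : Set X, IsOpen S := fun S => by
    rw [Set.eq_empty_of_isEmpty S]
    exact isOpen_empty
  exact ⟨⟨fun S _ => ho _⟩, fun V g _ => X.reg_glue (ho _) fun x => (hX.false x).elim⟩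

/-- Needed because the graded Grassmannian has no points for some `d`, for instance for `d = 0`. -/
theorem isProjectiveVariety_of_isEmpty {X : FunctionSpace K} (hX : IsEmpty X) :
    IsProjectiveVariety X :=
  ⟨0, ∅, isClosed_empty, isomorphic_sub (f := fun x => (hX.false x).elim)
    (g := fun z => z.2.elim) (isMor_of_isEmpty hX _) (fun x => (hX.false x).elim)
    (isMor_of_isEmpty (X := (projectiveSpace K 0).sub ∅)
      ⟨fun z : (∅ : Set (projectiveSpace K 0)) => z.2.elim⟩ _) (fun x => (hX.false x).elim) fun z => z.2.elim⟩

end ProjectiveVarieties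

/-! ### Maximal minors, alternating forms, and reduced matrices -/

section Plucker

variable {K : Type u} [Field K] {W : Type*} [AddCommGroup W] [Module K W] {k N : ℕ}

/-- The maximal minor with the given column indices, as an alternating form. -/
noncomputable def minorAlt (b : Module.Basis (Fin N) K W) (r : Fin k → Fin N) :
    W [⋀^Fin k]→ₗ[K] K :=
  Matrix.detRowAlternating.compLinearMap (LinearMap.pi fun i => b.coord (r i))

theorem minorAlt_apply (b : Module.Basis (Fin N) K W) (r : Fin k → Fin N) (c : Fin k → W) :
    minorAlt b r c = Matrix.det (Matrix.of fun j i => b.repr (c j) (r i)) := rfl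

/-- For `s ≠ t` some column index `s i` is missed by `t`, which gives a zero column. So the minors
with increasing indices are dual to the increasing tuples of basis vectors. -/
theorem minorAlt_basis (b : Module.Basis (Fin N) K W) (s t : Fin k ↪o Fin N) :
    minorAlt b s (fun j => b (t j)) = if s = t then 1 else 0 := by
  rw [minorAlt_apply]
  split_ifs with h
  · subst h
    convert Matrix.det_one (R := K) (n := Fin k)
    ext i j
    simp [Finsupp.single_apply, Matrix.one_apply]
  · have : ∃ i, ∀ j, t j ≠ s i := by
      by_contra! hcon
      apply h
      have hsub : Set.range s ⊆ Set.range t := by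
        rintro _ ⟨i, rfl⟩
        exact hcon i
      refine OrderEmbedding.range_inj.1 (Set.eq_of_subset_of_ncard_le hsub ?_)
      rw [← Set.image_univ, ← Set.image_univ, Set.ncard_image_of_injective _ t.injective,
        Set.ncard_image_of_injective _ s.injective]
    obtain ⟨i, hi⟩ := this
    refine Matrix.det_eq_zero_of_column_eq_zero i fun j => ?_
    simp [Finsupp.single_apply, hi j]

/-- Sorting the values; this reduces an alternating form on tuples of distinct basis vectors to
increasing tuples. -/
theorem exists_orderEmb_perm (v : Fin k → Fin N) (hv : Function.Injective v) :
    ∃ (s : Fin k ↪o Fin N) (σ : Equiv.Perm (Fin k)), v = s ∘ σ := by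
  have hcard : (Finset.univ.image v).card = k := by
    rw [Finset.card_image_of_injective _ hv, Finset.card_univ, Fintype.card_fin]
  set s := (Finset.univ.image v).orderEmbOfFin hcard with hs
  have hr : ∀ j, ∃ i, s i = v j := by
    intro j
    have : v j ∈ Set.range s := by
      rw [hs, Finset.range_orderEmbOfFin]
      simp
    exact this
  choose σ hσ using hr
  have hinj : Function.Injective σ := fun i j hij => hv (by rw [← hσ, ← hσ, hij])
  exact ⟨s, Equiv.ofBijective σ (Finite.injective_iff_bijective.1 hinj), funext fun j => (hσ j).symm⟩

theorem alternatingMap_sum_apply {ι : Type*} (S : Finset ι) (g : ι → W [⋀^Fin k]→ₗ[K] K)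
    (c : Fin k → W) : (∑ s ∈ S, g s) c = ∑ s ∈ S, g s c := by
  classical
  induction S using Finset.induction_on with
  | empty => simp
  | insert a S ha ih => rw [Finset.sum_insert ha, Finset.sum_insert ha, AlternatingMap.add_apply, ih]

/-- An alternating form is a linear combination of the maximal minors. -/
theorem alternating_eq_sum_minorAlt (b : Module.Basis (Fin N) K W) (f : W [⋀^Fin k]→ₗ[K] K)
    (c : Fin k → W) :
    f c = ∑ s : Fin k ↪o Fin N, f (fun j => b (s j)) * minorAlt b s c := by
  have : f = ∑ s : Fin k ↪o Fin N, f (fun j => b (s j)) • minorAlt b s := by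
    refine b.ext_alternating fun v hv => ?_
    obtain ⟨t, σ, rfl⟩ := exists_orderEmb_perm v hv
    have hp : ∀ g : W [⋀^Fin k]→ₗ[K] K, (g fun i => b ((t ∘ σ) i)) =
        Equiv.Perm.sign σ • g (fun i => b (t i)) := fun g =>
      g.map_perm (fun i => b (t i)) σ
    rw [hp, hp]
    congr 1
    rw [alternatingMap_sum_apply]
    simp [minorAlt_basis]
  conv_lhs => rw [this]
  rw [alternatingMap_sum_apply]
  rfl

/-- Two bases of the same subspace have proportional maximal minors. -/
theorem exists_minorAlt_eq_mul (b : Module.Basis (Fin N) K W) {C : Submodule K W}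
    {c c' : Fin k → W} (hc : LinearIndependent K c) (hcC : Submodule.span K (Set.range c) = C)
    (hc' : LinearIndependent K c') (hc'C : Submodule.span K (Set.range c') = C) :
    ∃ a : K, a ≠ 0 ∧ ∀ r : Fin k → Fin N, minorAlt b r c' = a * minorAlt b r c := by
  have key : ∀ {c c' : Fin k → W}, LinearIndependent K c → Submodule.span K (Set.range c) = C →
      LinearIndependent K c' → Submodule.span K (Set.range c') = C →
      ∃ A : Matrix (Fin k) (Fin k) K, ∀ j, c' j = ∑ i, A j i • c i := by
    intro c c' _ hcC _ hc'C
    have h1 : ∀ j, c' j ∈ Submodule.span K (Set.range c) := by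
      intro j
      rw [hcC, ← hc'C]
      exact Submodule.subset_span ⟨j, rfl⟩
    simp only [Submodule.mem_span_range_iff_exists_fun] at h1
    choose A hA using h1
    exact ⟨A, fun j => (hA j).symm⟩
  obtain ⟨A, hA⟩ := key hc hcC hc' hc'C
  obtain ⟨B, hB⟩ := key hc' hc'C hc hcC
  -- The two expansions compose to the identity since `c` is independent; hence the factor `A.det`
  -- is nonzero.
  have hBA : B * A = 1 := by
    ext i j
    have h1 : ∑ j, ((B * A) i j - (1 : Matrix (Fin k) (Fin k) K) i j) • c j = 0 := by
      simp only [sub_smul, Finset.sum_sub_distrib, Matrix.one_apply, ite_smul, one_smul, zero_smul,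
        Finset.sum_ite_eq, Finset.mem_univ, if_true, sub_eq_zero]
      conv_rhs => rw [hB i]
      simp only [hA, Finset.smul_sum, Matrix.mul_apply, Finset.sum_smul, smul_smul]
      exact Finset.sum_comm
    exact sub_eq_zero.1 (Fintype.linearIndependent_iff.1 hc _ h1 j)
  refine ⟨A.det, ?_, fun r => ?_⟩
  · intro h0
    have := congrArg Matrix.det hBA
    rw [Matrix.det_mul, h0, mul_zero, Matrix.det_one] at this
    exact zero_ne_one this
  · rw [minorAlt_apply, minorAlt_apply, ← Matrix.det_mul]
    congr 1
    ext j i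
    simp [hA, Matrix.mul_apply]

/-- A left inverse of `a ↦ ∑ i, a i • c i` carries `c` to the standard basis, so the determinant
composed with it takes the value `1` at `c`. -/
theorem exists_alternating_ne_zero {c : Fin k → W} (hc : LinearIndependent K c) :
    ∃ f : W [⋀^Fin k]→ₗ[K] K, f c ≠ 0 := by
  obtain ⟨L, hL⟩ := (Fintype.linearCombination K c).exists_leftInverse_of_injective
    (LinearMap.ker_eq_bot.2 (by
      intro x y hxy
      have h1 : ∑ i, (x - y) i • c i = 0 := by
        simp only [Fintype.linearCombination_apply] at hxy
        simp [sub_smul, hxy]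
      funext i
      exact sub_eq_zero.1 (Fintype.linearIndependent_iff.1 hc _ h1 i)))
  refine ⟨Matrix.detRowAlternating.compLinearMap L, ?_⟩
  have h1 : ∀ j, L (c j) = Pi.single j 1 := by
    intro j
    have := LinearMap.congr_fun hL (Pi.single j 1)
    simpa [Fintype.linearCombination_apply_single] using this
  rw [AlternatingMap.compLinearMap_apply]
  simp only [h1]
  have : (fun i => Pi.single i 1 : Fin k → Fin k → K) = (1 : Matrix (Fin k) (Fin k) K) := by
    ext i j
    simp [Matrix.one_apply, Pi.single_apply, eq_comm]
  rw [this]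
  have h2 : Matrix.detRowAlternating (1 : Matrix (Fin k) (Fin k) K) = 1 := Matrix.det_one
  rw [h2]
  exact one_ne_zero

theorem exists_minorAlt_ne_zero (b : Module.Basis (Fin N) K W) {c : Fin k → W}
    (hc : LinearIndependent K c) : ∃ s : Fin k ↪o Fin N, minorAlt b s c ≠ 0 := by
  obtain ⟨f, hf⟩ := exists_alternating_ne_zero hc
  by_contra! hcon
  apply hf
  rw [alternating_eq_sum_minorAlt b]
  simp [hcon]

/-- The linear form in the maximal minors which computes the minor with columns `r`. -/
noncomputable def minorForm (b : Module.Basis (Fin N) K W) (r : Fin k → Fin N) :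
    ((Fin k ↪o Fin N) → K) →ₗ[K] K :=
  ∑ s : Fin k ↪o Fin N, minorAlt b r (fun j => b (s j)) • LinearMap.proj s

theorem minorForm_apply (b : Module.Basis (Fin N) K W) (r : Fin k → Fin N)
    (x : (Fin k ↪o Fin N) → K) :
    minorForm b r x = ∑ s : Fin k ↪o Fin N, minorAlt b r (fun j => b (s j)) * x s := by
  simp [minorForm]

theorem minorForm_minorAlt (b : Module.Basis (Fin N) K W) (r : Fin k → Fin N) (c : Fin k → W) :
    minorForm b r (fun s => minorAlt b s c) = minorAlt b r c := by
  rw [minorForm_apply, ← alternating_eq_sum_minorAlt]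

theorem minorForm_orderEmb (b : Module.Basis (Fin N) K W) (s : Fin k ↪o Fin N)
    (x : (Fin k ↪o Fin N) → K) : minorForm b s x = x s := by
  simp [minorForm_apply, minorAlt_basis]

theorem minorAlt_eq_zero_of_not_injective (b : Module.Basis (Fin N) K W) {r : Fin k → Fin N}
    {i j : Fin k} (hij : i ≠ j) (hr : r i = r j) (c : Fin k → W) : minorAlt b r c = 0 :=
  Matrix.det_zero_of_column_eq hij fun l => by simp [hr]

/-- The `j`-th row of the matrix in reduced form, with identity matrix in the columns `s`, which
is given by the maximal minors `x`, normalized such that `x s = 1`. -/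
noncomputable def reducedRow (b : Module.Basis (Fin N) K W) (s : Fin k ↪o Fin N)
    (x : (Fin k ↪o Fin N) → K) (j : Fin k) : W :=
  ∑ i, minorForm b (Function.update s j i) x • b i

theorem repr_reducedRow (b : Module.Basis (Fin N) K W) (s : Fin k ↪o Fin N)
    (x : (Fin k ↪o Fin N) → K) (j : Fin k) (i : Fin N) :
    b.repr (reducedRow b s x j) i = minorForm b (Function.update s j i) x := by
  rw [reducedRow, b.repr_sum_self]

/-- Replacing column `s j` by `s i` with `i ≠ j` repeats a column and kills the minor. The block in
the columns `s` is therefore `x s` times the identity, for any vector `x`. -/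
theorem repr_reducedRow_self (b : Module.Basis (Fin N) K W) (s : Fin k ↪o Fin N)
    (x : (Fin k ↪o Fin N) → K) (i j : Fin k) :
    b.repr (reducedRow b s x j) (s i) = if i = j then x s else 0 := by
  rw [repr_reducedRow]
  split_ifs with h
  · subst h
    rw [Function.update_eq_self, minorForm_orderEmb]
  · rw [minorForm_apply]
    refine Finset.sum_eq_zero fun t _ => ?_
    rw [minorAlt_eq_zero_of_not_injective b h, zero_mul]
    simp [Function.update_of_ne h]

/-- Because of the identity block, the coefficients of a vector of the row space are its own entries
in the columns `s`. This turns membership in the row space into equations. -/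
theorem reducedRow_coord_eq (b : Module.Basis (Fin N) K W) {s : Fin k ↪o Fin N}
    {x : (Fin k ↪o Fin N) → K} (hx : x s = 1) {w : W}
    (hw : w ∈ Submodule.span K (Set.range (reducedRow b s x))) :
    w = ∑ i, b.repr w (s i) • reducedRow b s x i := by
  obtain ⟨a, rfl⟩ := (Submodule.mem_span_range_iff_exists_fun K).1 hw
  refine Finset.sum_congr rfl fun i _ => ?_
  congr 1
  simp [repr_reducedRow_self, hx]

theorem linearIndependent_reducedRow (b : Module.Basis (Fin N) K W) {s : Fin k ↪o Fin N}
    {x : (Fin k ↪o Fin N) → K} (hx : x s = 1) : LinearIndependent K (reducedRow b s x) := by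
  rw [Fintype.linearIndependent_iff]
  intro a ha i
  have := congrArg (fun w => b.repr w (s i)) ha
  simpa [repr_reducedRow_self, hx] using this

theorem minorAlt_reducedRow_self (b : Module.Basis (Fin N) K W) {s : Fin k ↪o Fin N}
    {x : (Fin k ↪o Fin N) → K} (hx : x s = 1) : minorAlt b s (reducedRow b s x) = 1 := by
  rw [minorAlt_apply]
  convert Matrix.det_one (R := K) (n := Fin k)
  ext i j
  simp [repr_reducedRow_self, hx, Matrix.one_apply, eq_comm]

/-- By Cramer's rule the reduced rows are, up to the factor `a`, the rows of the adjugate of the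
block `s` times the matrix of `c`. So they lie in the span of `c`, and they fill it by dimension. -/
theorem span_reducedRow (b : Module.Basis (Fin N) K W) {s : Fin k ↪o Fin N} {c : Fin k → W}
    (hc : LinearIndependent K c) {a : K}
    (ha : a * minorAlt b s c = 1) :
    Submodule.span K (Set.range (reducedRow b s fun t => a * minorAlt b t c)) =
      Submodule.span K (Set.range c) := by
  set x : (Fin k ↪o Fin N) → K := fun t => a * minorAlt b t c with hx
  have hxa : x = a • fun t : Fin k ↪o Fin N => minorAlt b t c := rfl
  have hle : Submodule.span K (Set.range (reducedRow b s x)) ≤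
      Submodule.span K (Set.range c) := by
    rw [Submodule.span_le]
    rintro _ ⟨j, rfl⟩
    set B : Matrix (Fin k) (Fin k) K := Matrix.of fun j i => b.repr (c j) (s i) with hB
    have h1 : ∀ i, minorAlt b (Function.update s j i) c =
        ∑ l, b.repr (c l) i * B.adjugate j l := by
      intro i
      have : (Matrix.of fun l m => b.repr (c l) (Function.update (⇑s) j i m)) =
          B.updateCol j (fun l => b.repr (c l) i) := by
        ext l m
        by_cases hm : m = j
        · subst hm
          simp
        · simp [Function.update_of_ne hm, Matrix.updateCol_ne hm, hB]
      rw [minorAlt_apply, this, ← Matrix.cramer_apply, Matrix.cramer_eq_adjugate_mulVec]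
      simp only [Matrix.mulVec, dotProduct]
      exact Finset.sum_congr rfl fun l _ => mul_comm _ _
    have h2 : reducedRow b s x j = ∑ l, (a * B.adjugate j l) • c l := by
      rw [reducedRow, hxa]
      simp only [map_smul, minorForm_minorAlt, h1, smul_eq_mul, Finset.mul_sum, Finset.sum_smul]
      rw [Finset.sum_comm]
      refine Finset.sum_congr rfl fun l _ => ?_
      conv_rhs => rw [← b.sum_repr (c l), Finset.smul_sum]
      refine Finset.sum_congr rfl fun i _ => ?_
      rw [smul_smul]
      congr 1
      ring
    rw [h2]
    exact Submodule.sum_mem _ fun l _ => Submodule.smul_mem _ _ (Submodule.subset_span ⟨l, rfl⟩)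
  have : Module.Finite K (Submodule.span K (Set.range c)) :=
    Module.Finite.span_of_finite K (Set.finite_range c)
  refine Submodule.eq_of_le_of_finrank_eq hle ?_
  rw [finrank_span_eq_card (linearIndependent_reducedRow b ha), finrank_span_eq_card hc]

theorem map_reducedRow_of_mem (b : Module.Basis (Fin N) K W) {s : Fin k ↪o Fin N}
    {x : (Fin k ↪o Fin N) → K} (hx : x s = 1) {T : W →ₗ[K] W}
    (hT : ∀ j, T (reducedRow b s x j) =
      ∑ i, b.repr (T (reducedRow b s x j)) (s i) • reducedRow b s x i) :
    ∀ w ∈ Submodule.span K (Set.range (reducedRow b s x)),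
      T w ∈ Submodule.span K (Set.range (reducedRow b s x)) := by
  intro w hw
  rw [reducedRow_coord_eq b hx hw, map_sum]
  refine Submodule.sum_mem _ fun j _ => ?_
  rw [map_smul, hT]
  exact Submodule.smul_mem _ _ (Submodule.sum_mem _ fun i _ => Submodule.smul_mem _ _
    (Submodule.subset_span ⟨i, rfl⟩))

end Plucker

/-! ### Plücker coordinates and projectivity of loci of stable subspaces -/

section Grassmannian

variable {K : Type u} [Field K] {W : Type u} [AddCommGroup W] [Module K W]
  [FiniteDimensional K W] {k : ℕ}

/-- The chosen basis of a point of the Grassmannian. -/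
noncomputable def grassBasis (C : GrassmannianPoint K W k) (j : Fin k) : W :=
  (Module.finBasisOfFinrankEq K C.1 C.2 j : W)

theorem linearIndependent_grassBasis (C : GrassmannianPoint K W k) :
    LinearIndependent K (grassBasis C) :=
  (Module.finBasisOfFinrankEq K C.1 C.2).linearIndependent.map' C.1.subtype (by simp)

theorem span_grassBasis (C : GrassmannianPoint K W k) :
    Submodule.span K (Set.range (grassBasis C)) = C.1 := by
  have h1 : Set.range (grassBasis C) =
      C.1.subtype '' Set.range (Module.finBasisOfFinrankEq K C.1 C.2) := by
    rw [← Set.range_comp]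
    rfl
  rw [h1, Submodule.span_image, Module.Basis.span_eq, Submodule.map_top, Submodule.range_subtype]

theorem plucker_eq (C : GrassmannianPoint K W k) (s : Fin k ↪o Fin (Module.finrank K W)) :
    plucker C s = minorAlt (Module.finBasis K W) s (grassBasis C) := by
  rw [plucker, minorAlt_apply, ← Matrix.det_transpose]
  rfl

theorem exists_plucker_ne_zero (C : GrassmannianPoint K W k) : ∃ s, plucker C s ≠ 0 := by
  simp only [plucker_eq]
  exact exists_minorAlt_ne_zero _ (linearIndependent_grassBasis C)

theorem exists_plucker_eq_mul (C : GrassmannianPoint K W k) {c : Fin k → W}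
    (hc : LinearIndependent K c) (hcC : Submodule.span K (Set.range c) = C.1) :
    ∃ a : K, a ≠ 0 ∧ ∀ s, plucker C s = a * minorAlt (Module.finBasis K W) s c := by
  obtain ⟨a, ha, h⟩ := exists_minorAlt_eq_mul (Module.finBasis K W) hc hcC
    (linearIndependent_grassBasis C) (span_grassBasis C)
  exact ⟨a, ha, fun s => by rw [plucker_eq, h]⟩

theorem span_reducedRow_plucker (C : GrassmannianPoint K W k)
    {s : Fin k ↪o Fin (Module.finrank K W)} {a : K} (ha : a * plucker C s = 1) :
    Submodule.span K (Set.range (reducedRow (Module.finBasis K W) s fun t => a * plucker C t)) =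
      C.1 := by
  rw [← span_grassBasis C]
  simp only [plucker_eq] at ha ⊢
  exact span_reducedRow _ (linearIndependent_grassBasis C) ha

/-- A point of the Grassmannian is determined by its Plücker coordinates up to a scalar. -/
theorem eq_of_plucker_eq_mul {C C' : GrassmannianPoint K W k} {a : K}
    (h : ∀ s, plucker C' s = a * plucker C s) : C = C' := by
  obtain ⟨s, hs⟩ := exists_plucker_ne_zero C'
  have h1 := span_reducedRow_plucker C' (inv_mul_cancel₀ hs)
  have h2 := span_reducedRow_plucker C (s := s) (a := (plucker C' s)⁻¹ * a)
    (by rw [mul_assoc, ← h, inv_mul_cancel₀ hs])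
  simp only [mul_assoc, ← h] at h2
  exact Subtype.ext (h2.symm.trans h1)

/-- The subspaces which are stable under a set of operators form a closed subset of the projective
space given by the Plücker coordinates. -/
theorem isClosed_plucker_image (𝒯 : Set (W →ₗ[K] W)) {m : ℕ}
    (e : Fin (m + 1) ≃ (Fin k ↪o Fin (Module.finrank K W))) :
    IsClosed {p : projectiveSpace K m | ∃ C : GrassmannianPoint K W k,
      (∀ T ∈ 𝒯, ∀ w ∈ C.1, T w ∈ C.1) ∧ ∃ a : K, ∀ i, projCoord p i = a * plucker C (e i)} := by
  set b := Module.finBasis K W with hb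
  set ℙ := projectiveSpace K m
  have hinv : (projectiveSpace K m).HasInverses := hasInverses_projectiveSpace m
  rw [← isOpen_compl_iff]
  refine isOpen_iff_forall_mem_open.2 fun p hp => ?_
  obtain ⟨i₀, hi₀⟩ := exists_projCoord_ne_zero p
  set s := e i₀ with hs
  set D : Set ℙ := {p | projCoord p i₀ ≠ 0} with hD
  have hDo : IsOpen D := isOpen_projCoord_ne_zero i₀
  set y : ℙ → (Fin k ↪o Fin (Module.finrank K W)) → K :=
    fun q t => projCoord q (e.symm t) / projCoord q i₀ with hy
  have hys : ∀ q ∈ D, y q s = 1 := by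
    intro q hq
    simp only [hy, hs, Equiv.symm_apply_apply]
    exact div_self hq
  have hyr : ∀ t, ℙ.Reg D (fun q => y q t) := fun t => reg_projCoord_div i₀ (e.symm t)
  set R : ℙ → Fin k → W := fun q => reducedRow b s (y q) with hR
  have hRr : ∀ j i, ℙ.Reg D (fun q => b.repr (R q j) i) := by
    intro j i
    simp only [hR, repr_reducedRow, minorForm_apply]
    exact reg_sum hDo _ fun t _ => ℙ.reg_mul (ℙ.reg_const _ hDo) (hyr t)
  have hTr : ∀ (T : W →ₗ[K] W) j i, ℙ.Reg D (fun q => b.repr (T (R q j)) i) := by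
    intro T j i
    have : ∀ q, b.repr (T (R q j)) i = ∑ l, b.repr (R q j) l * b.repr (T (b l)) i := by
      intro q
      conv_lhs => rw [← b.sum_repr (R q j)]
      simp only [map_sum, map_smul, Finsupp.coe_finsetSum, Finset.sum_apply, Finsupp.smul_apply,
        smul_eq_mul]
    simp only [this]
    exact reg_sum hDo _ fun t _ => ℙ.reg_mul (hRr j t) (ℙ.reg_const _ hDo)
  -- Necessary conditions: if `q` is proportional to the Plücker vector of `C`, the reduced rows
  -- built from `q` span `C`, and their minors give back the normalized coordinates of `q`.
  have hmem : ∀ q ∈ D, ∀ C : GrassmannianPoint K W k, ∀ a : K,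
      (∀ i, projCoord q i = a * plucker C (e i)) →
      (Submodule.span K (Set.range (R q)) = C.1 ∧ ∀ t, y q t = minorAlt b t (R q)) := by
    intro q hq C a ha
    have h0 : projCoord q i₀ ≠ 0 := hq
    have h1 : y q = fun t => (a / projCoord q i₀) * plucker C t := by
      funext t
      simp only [hy, ha (e.symm t), Equiv.apply_symm_apply]
      ring
    have h2 : a / projCoord q i₀ * plucker C s = 1 := by
      rw [div_mul_eq_mul_div, hs, ← ha i₀, div_self h0]
    have h3 : Submodule.span K (Set.range (R q)) = C.1 := by
      simp only [hR, h1]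
      exact span_reducedRow_plucker C h2
    refine ⟨h3, ?_⟩
    obtain ⟨l, hl, hlC⟩ := exists_plucker_eq_mul C (linearIndependent_reducedRow b (hys q hq)) h3
    have h4 := hlC s
    rw [← hb, minorAlt_reducedRow_self b (hys q hq), mul_one] at h4
    intro t
    rw [h1]
    simp only [hlC t]
    rw [← mul_assoc, ← h4, h2, one_mul]
  -- On `D` the set is cut out by two families of equations: `y` consists of the minors of the
  -- reduced rows, and each operator maps each row into the row space. If all hold at `p`, the row
  -- space shows that `p` belongs to the set. Otherwise a failing equation fails on an open
  -- neighbourhood.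
  by_cases hE1 : ∀ t : Fin k ↪o Fin (Module.finrank K W), minorAlt b t (R p) - y p t = 0
  · by_cases hE2 : ∀ T ∈ 𝒯, ∀ j i, b.repr (T (R p j)) i -
        ∑ l, b.repr (T (R p j)) (s l) * b.repr (R p l) i = 0
    · exfalso
      apply hp
      have hli := linearIndependent_reducedRow b (hys p hi₀)
      refine ⟨⟨Submodule.span K (Set.range (R p)), ?_⟩, ?_, ?_⟩
      · rw [finrank_span_eq_card hli, Fintype.card_fin]
      · intro T hT
        refine map_reducedRow_of_mem b (hys p hi₀) fun j => b.repr.injective ?_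
        ext i
        have := sub_eq_zero.1 (hE2 T hT j i)
        rw [this]
        simp [hR]
      · obtain ⟨l, hl, hlC⟩ := exists_plucker_eq_mul (k := k)
          ⟨Submodule.span K (Set.range (R p)), by
            rw [finrank_span_eq_card hli, Fintype.card_fin]⟩ hli rfl
        refine ⟨projCoord p i₀ * l⁻¹, fun i => ?_⟩
        rw [hlC, sub_eq_zero.1 (hE1 (e i))]
        simp only [hy, Equiv.symm_apply_apply]
        field_simp
    · push Not at hE2
      obtain ⟨T, hT, j, i, hne⟩ := hE2
      have hr : ℙ.Reg D (fun q => b.repr (T (R q j)) i -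
          ∑ l, b.repr (T (R q j)) (s l) * b.repr (R q l) i) :=
        reg_sub (hTr T j i) (reg_sum hDo _ fun l _ => ℙ.reg_mul (hTr T j _) (hRr l i))
      refine ⟨_, ?_, (hinv _ _ hr).1, hi₀, hne⟩
      rintro q ⟨hq, hqne⟩ ⟨C, hC, a, ha⟩
      apply hqne
      have h3 := (hmem q hq C a ha).1
      have h4 : T (R q j) ∈ Submodule.span K (Set.range (R q)) := by
        rw [h3]
        refine hC T hT _ ?_
        rw [← h3]
        exact Submodule.subset_span ⟨j, rfl⟩
      have h5 := congrArg (fun w => b.repr w i) (reducedRow_coord_eq b (hys q hq) h4)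
      simp only [map_sum, map_smul, Finsupp.coe_finsetSum, Finset.sum_apply, Finsupp.smul_apply,
        smul_eq_mul] at h5
      rw [sub_eq_zero]
      exact h5
  · push Not at hE1
    obtain ⟨t, ht⟩ := hE1
    have hr : ℙ.Reg D (fun q => minorAlt b t (R q) - y q t) :=
      reg_sub (reg_det hDo fun j i => hRr j (t i)) (hyr t)
    refine ⟨_, ?_, (hinv _ _ hr).1, hi₀, ht⟩
    rintro q ⟨hq, hqne⟩ ⟨C, hC, a, ha⟩
    apply hqne
    rw [sub_eq_zero]
    exact ((hmem q hq C a ha).2 t).symm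

/-- The subvariety of the Grassmannian of all subspaces which are stable under a set of operators is
a projective variety. -/
theorem isProjectiveVariety_induced_grassmannian {Y : Type u} (φ : Y → GrassmannianPoint K W k)
    (hφ : Function.Injective φ) (𝒯 : Set (W →ₗ[K] W))
    (hr : ∀ C, C ∈ Set.range φ ↔ ∀ T ∈ 𝒯, ∀ w ∈ C.1, T w ∈ C.1) :
    IsProjectiveVariety ((grassmannian K W k).induced φ) := by
  rcases isEmpty_or_nonempty Y with hY | ⟨⟨y₀⟩⟩
  · exact isProjectiveVariety_of_isEmpty hY
  -- A point of `Y` guarantees that there is at least one Plücker coordinate, so that their number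
  -- has the form `m + 1`.
  obtain ⟨s₀, -⟩ := exists_plucker_ne_zero (φ y₀)
  obtain ⟨m, hm⟩ : ∃ m, Fintype.card (Fin k ↪o Fin (Module.finrank K W)) = m + 1 :=
    ⟨_, (Nat.succ_pred_eq_of_pos (Fintype.card_pos_iff.2 ⟨s₀⟩)).symm⟩
  set e := ((Fintype.equivFin (Fin k ↪o Fin (Module.finrank K W))).trans (finCongr hm)).symm
  refine ⟨m, _, isClosed_plucker_image 𝒯 e, ?_⟩
  set Z : Set (projectiveSpace K m) := {p | ∃ C : GrassmannianPoint K W k,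
      (∀ T ∈ 𝒯, ∀ w ∈ C.1, T w ∈ C.1) ∧ ∃ a : K, ∀ i, projCoord p i = a * plucker C (e i)}
    with hZ
  set X := (grassmannian K W k).induced φ with hX
  have hXi : X.HasInverses := (hasInverses_homogeneousSpace _ _).induced _
  have hne : ∀ y, (fun i => plucker (φ y) (e i)) ≠ 0 := by
    intro y h0
    obtain ⟨s, hs⟩ := exists_plucker_ne_zero (φ y)
    exact hs (by simpa using congrFun h0 (e.symm s))
  set f : X → projectiveSpace K m := fun y => projPoint fun i => plucker (φ y) (e i) with hf
  have hfc : ∀ y, ∃ c : K, c ≠ 0 ∧ ∀ i, projCoord (f y) i = c * plucker (φ y) (e i) := by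
    intro y
    obtain ⟨c, hc, h⟩ := projCoord_projPoint (hne y)
    exact ⟨c, hc, fun i => congrFun h i⟩
  have hfZ : ∀ y, f y ∈ Z := by
    intro y
    obtain ⟨c, hc, h⟩ := hfc y
    exact ⟨φ y, (hr _).1 ⟨y, rfl⟩, c, h⟩
  have hfm : IsMor X (projectiveSpace K m) f := by
    refine isMor_to_homogeneousSpace hXi fun y₀ => ?_
    obtain ⟨s, hs⟩ := exists_plucker_ne_zero (φ y₀)
    have hreg := fun t => (isMor_induced (grassmannian K W k) φ).2 _ _
      (reg_homogeneousSpace_coord_div plucker s t)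
    refine ⟨_, hs, X.isOpen_of_reg (hreg s), _, fun i => hreg (e i), fun y hy => ?_⟩
    obtain ⟨c, hc, h⟩ := hfc y
    have hy' : plucker (φ y) s ≠ 0 := hy
    refine ⟨c * plucker (φ y) s, mul_ne_zero hc hy', funext fun i => (h i).trans ?_⟩
    simp only [Pi.smul_apply, smul_eq_mul]
    field_simp
  have hex : ∀ z : Z, ∃ y : Y, ∃ a : K, ∀ i, projCoord z.1 i = a * plucker (φ y) (e i) := by
    rintro ⟨z, C, hC, a, ha⟩
    obtain ⟨y, rfl⟩ := (hr C).2 hC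
    exact ⟨y, a, ha⟩
  choose g a ha using hex
  have ha0 : ∀ z, a z ≠ 0 := by
    intro z h0
    obtain ⟨i, hi⟩ := exists_projCoord_ne_zero z.1
    apply hi
    rw [ha, h0, zero_mul]
  -- The choices of `g` and of the scalar `a` carry no regularity. None is needed, since homogeneous
  -- coordinates matter only up to a scalar at each point.
  have hgm : IsMor ((projectiveSpace K m).sub Z) X g := by
    refine isMor_to_induced φ (isMor_to_homogeneousSpace ((hasInverses_projectiveSpace (K := K) m).induced _)
      fun z₀ => ?_)
    obtain ⟨i₀, hi₀⟩ := exists_projCoord_ne_zero z₀.1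
    have hreg := fun t => (isMor_sub_val (projectiveSpace K m) Z).2 _ _ (reg_projCoord_div i₀ t)
    refine ⟨_, hi₀, ((projectiveSpace K m).sub Z).isOpen_of_reg (hreg i₀), _,
      fun t => hreg (e.symm t), fun z hz => ?_⟩
    have hz' : projCoord z.1 i₀ ≠ 0 := hz
    refine ⟨(a z)⁻¹ * projCoord z.1 i₀, mul_ne_zero (inv_ne_zero (ha0 z)) hz', funext fun t => ?_⟩
    have := ha z (e.symm t)
    rw [Equiv.apply_symm_apply] at this
    have h0 := ha0 z
    simp only [Pi.smul_apply, smul_eq_mul, this]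
    field_simp
  refine isomorphic_sub hfm hfZ hgm ?_ ?_
  · intro y
    obtain ⟨c, hc, h⟩ := hfc y
    refine hφ (eq_of_plucker_eq_mul (a := c⁻¹ * a ⟨f y, hfZ y⟩) fun s => ?_)
    have h1 := ha ⟨f y, hfZ y⟩ (e.symm s)
    have h2 := h (e.symm s)
    rw [Equiv.apply_symm_apply] at h1 h2
    rw [mul_assoc, ← h1, h2, ← mul_assoc, inv_mul_cancel₀ hc, one_mul]
  · intro z
    refine projPoint_eq_of_smul (inv_ne_zero (ha0 z)) (funext fun i => ?_)
    simp only [Pi.smul_apply, smul_eq_mul, ha z i]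
    rw [inv_mul_cancel_left₀ (ha0 z)]

/-- The determinant of a basis of a subspace together with vectors `u` is a linear form in
the Plücker coordinates; it detects bases of the quotient and computes coordinates. -/
theorem exists_quotientDet {P : Type u} [AddCommGroup P] [Module K P] [FiniteDimensional K P]
    (ι : W →ₗ[K] P) (hι : Function.Injective ι) {d : ℕ} (hd : Module.finrank K P = k + d) :
    ∃ G : (Fin d → P) → MvPolynomial (Fin k ↪o Fin (Module.finrank K W)) K,
      (∀ u, (G u).IsHomogeneous 1) ∧ ∀ C : GrassmannianPoint K W k,
        (∀ u, MvPolynomial.eval (plucker C) (G u) ≠ 0 ↔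
          LinearIndependent K (fun i => (C.1.map ι).mkQ (u i))) ∧
        ∀ u i v (a : Fin d → K), v - ∑ j, a j • u j ∈ C.1.map ι →
          MvPolynomial.eval (plucker C) (G (Function.update u i v)) =
            a i * MvPolynomial.eval (plucker C) (G u) := by
  obtain ⟨e⟩ : Nonempty (Module.Basis (Fin k ⊕ Fin d) K P) :=
    ⟨(Module.finBasisOfFinrankEq K P hd).reindex finSumFinEquiv.symm⟩
  -- For fixed `u`, the determinant of the joint system `(c, u)` is alternating in `c`. Hence it is
  -- a linear combination of the maximal minors of `c`, that is, a linear form in the Plücker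
  -- coordinates.
  set Φ : (Fin d → P) → W [⋀^Fin k]→ₗ[K] K := fun u =>
    { toFun := fun c => e.det (Sum.elim (fun i => ι (c i)) u)
      map_update_add' := by
        intro inst c i x y
        have h : ∀ z, (Sum.elim (fun j => ι (Function.update c i z j)) u) =
            Function.update (Sum.elim (fun j => ι (c j)) u) (Sum.inl i) (ι z) := by
          intro z
          rw [← Sum.elim_update_left]
          congr 1
          funext j
          exact Function.apply_update (fun _ => ι) c i z j
        rw [h, h, h, map_add, AlternatingMap.map_update_add]
      map_update_smul' := by
        intro inst c i r x
        have h : ∀ z, (Sum.elim (fun j => ι (Function.update c i z j)) u) =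
            Function.update (Sum.elim (fun j => ι (c j)) u) (Sum.inl i) (ι z) := by
          intro z
          rw [← Sum.elim_update_left]
          congr 1
          funext j
          exact Function.apply_update (fun _ => ι) c i z j
        rw [h, h, map_smul, AlternatingMap.map_update_smul]
      map_eq_zero_of_eq' := by
        intro c i j hij hne
        exact e.det.map_eq_zero_of_eq _ (i := Sum.inl i) (j := Sum.inl j) (by simp [hij])
          (by simpa using hne) } with hΦ
  set b := Module.finBasis K W with hb
  refine ⟨fun u => ∑ s, MvPolynomial.C (Φ u fun j => b (s j)) * MvPolynomial.X s, ?_, ?_⟩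
  · intro u
    refine MvPolynomial.IsHomogeneous.sum _ _ _ fun s _ => ?_
    simpa using (MvPolynomial.isHomogeneous_C _ _).mul (MvPolynomial.isHomogeneous_X K s)
  intro C
  have heval : ∀ u, MvPolynomial.eval (plucker C)
      (∑ s, MvPolynomial.C (Φ u fun j => b (s j)) * MvPolynomial.X s) =
        e.det (Sum.elim (fun i => ι (grassBasis C i)) u) := by
    intro u
    have := alternating_eq_sum_minorAlt b (Φ u) (grassBasis C)
    refine Eq.trans ?_ this.symm
    simp [plucker_eq, hb]
  simp only [heval]
  have hspan : Submodule.span K (Set.range fun i => ι (grassBasis C i)) = C.1.map ι := by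
    rw [← span_grassBasis C, Submodule.map_span, ← Set.range_comp]
    rfl
  have hli : LinearIndependent K fun i => ι (grassBasis C i) :=
    (linearIndependent_grassBasis C).map' ι (LinearMap.ker_eq_bot.2 hι)
  have hq : Module.finrank K (P ⧸ C.1.map ι) = d := by
    have h1 := Submodule.finrank_quotient_add_finrank (C.1.map ι)
    have h2 : Module.finrank K (C.1.map ι) = k := by
      rw [← hspan, finrank_span_eq_card hli, Fintype.card_fin]
    omega
  refine ⟨fun u => ?_, fun u i v a hv => ?_⟩
  · rw [← isUnit_iff_ne_zero, ← e.is_basis_iff_det]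
    constructor
    · rintro ⟨-, h⟩
      refine linearIndependent_of_top_le_span_of_card_eq_finrank ?_ (by simp [hq])
      have h1 := congrArg (Submodule.map (C.1.map ι).mkQ) h
      rw [Submodule.map_top, Submodule.range_mkQ, Submodule.map_span] at h1
      rw [← h1, Submodule.span_le]
      rintro _ ⟨_, ⟨(i | i), rfl⟩, rfl⟩
      · have : (C.1.map ι).mkQ (ι (grassBasis C i)) = 0 := by
          rw [Submodule.mkQ_apply, Submodule.Quotient.mk_eq_zero, ← hspan]
          exact Submodule.subset_span ⟨i, rfl⟩
        simp only [Sum.elim_inl, this]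
        exact Submodule.zero_mem _
      · exact Submodule.subset_span ⟨i, rfl⟩
    · intro h
      have h1 : LinearIndependent K (fun i => (⟨ι (grassBasis C i), by
          rw [← hspan]; exact Submodule.subset_span ⟨i, rfl⟩⟩ : C.1.map ι)) :=
        LinearIndependent.of_comp (C.1.map ι).subtype hli
      have h2 := h1.sumElim_of_quotient u h
      refine ⟨h2, ?_⟩
      exact h2.span_eq_top_of_card_eq_finrank' (by simp [hd])
  · rw [← hspan, Submodule.mem_span_range_iff_exists_fun] at hv
    obtain ⟨z, hz⟩ := hv
    have hv' : v = ∑ l, (Sum.elim z a) l • (Sum.elim (fun i => ι (grassBasis C i)) u) l := by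
      rw [Fintype.sum_sum_type]
      simp only [Sum.elim_inl, Sum.elim_inr]
      rw [hz, sub_add_cancel]
    -- Expand `v` in slot `i`: the summands along `C` and along `u l` with `l ≠ i` repeat an entry,
    -- and only `a i` survives.
    rw [Sum.elim_update_right, hv', AlternatingMap.map_update_sum, Finset.sum_eq_single (Sum.inr i)]
    · rw [AlternatingMap.map_update_smul, Function.update_eq_self]
      simp
    · intro l _ hl
      rw [AlternatingMap.map_update_smul, AlternatingMap.map_update_self _ _ hl.symm, smul_zero]
    · exact fun h => absurd (Finset.mem_univ _) h

end Grassmannian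

/-! ### Gradings described by their projections -/

section GradingProjections

variable {K : Type u} [Field K] {M : Type u} [AddCommGroup M] [Module K M]

/-- The projections onto the components of a grading. -/
structure IsGradingProj (gr : ℤ → Submodule K M) (pr : ℤ → M →ₗ[K] M) : Prop where
  mem : ∀ m x, pr m x ∈ gr m
  self : ∀ m, ∀ x ∈ gr m, pr m x = x
  other : ∀ m n, n ≠ m → ∀ x ∈ gr n, pr m x = 0
  iSup_eq_top : ⨆ m, gr m = ⊤

namespace IsGradingProj

variable {gr : ℤ → Submodule K M} {pr : ℤ → M →ₗ[K] M}

theorem exists_eq_sum (h : IsGradingProj gr pr) (x : M) :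
    ∃ s : Finset ℤ, x = ∑ m ∈ s, pr m x := by
  -- Allowing all larger index sets makes the statement stable under addition, where two index sets
  -- are united.
  have key : ∃ s : Finset ℤ, ∀ t, s ⊆ t → x = ∑ m ∈ t, pr m x := by
    have hx : x ∈ ⨆ m, gr m := h.iSup_eq_top ▸ Submodule.mem_top
    refine Submodule.iSup_induction gr (motive := fun x => ∃ s : Finset ℤ, ∀ t, s ⊆ t →
      x = ∑ m ∈ t, pr m x) hx ?_ ?_ ?_
    · intro m x hx
      refine ⟨{m}, fun t ht => ?_⟩
      rw [Finset.sum_eq_single m, h.self m x hx]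
      · exact fun n _ hn => h.other n m hn.symm x hx
      · exact fun hm => absurd (ht (Finset.mem_singleton_self m)) hm
    · exact ⟨∅, fun t _ => by simp⟩
    · rintro x y ⟨s, hs⟩ ⟨s', hs'⟩
      refine ⟨s ∪ s', fun t ht => ?_⟩
      simp only [map_add, Finset.sum_add_distrib]
      rw [← hs t (Finset.union_subset_left ht), ← hs' t (Finset.union_subset_right ht)]
  obtain ⟨s, hs⟩ := key
  exact ⟨s, hs s subset_rfl⟩

theorem mem_iff (h : IsGradingProj gr pr) {m : ℤ} {x : M} : x ∈ gr m ↔ pr m x = x :=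
  ⟨h.self m x, fun hx => hx ▸ h.mem m x⟩

theorem comp_eq (h : IsGradingProj gr pr) (m n : ℤ) (x : M) :
    pr m (pr n x) = if n = m then pr m x else 0 := by
  split_ifs with hmn
  · subst hmn
    exact h.self _ _ (h.mem _ _)
  · exact h.other m n hmn _ (h.mem n x)

theorem isInternal (h : IsGradingProj gr pr) : DirectSum.IsInternal gr := by
  rw [DirectSum.isInternal_submodule_iff_iSupIndep_and_iSup_eq_top]
  refine ⟨fun m => Submodule.disjoint_def.2 fun x hx hx' => ?_, h.iSup_eq_top⟩
  rw [← h.self m x hx]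
  have : (⨆ j, ⨆ (_ : j ≠ m), gr j) ≤ LinearMap.ker (pr m) :=
    iSup₂_le fun j hj x hx => h.other m j hj x hx
  exact this hx'

theorem of_isInternal (hgr : DirectSum.IsInternal gr) :
    ∃ pr : ℤ → M →ₗ[K] M, IsGradingProj gr pr := by
  set e := LinearEquiv.ofBijective (DirectSum.coeLinearMap gr) hgr with he
  have hsymm : ∀ m, ∀ x (hx : x ∈ gr m), e.symm x = DirectSum.lof K ℤ (fun i => gr i) m ⟨x, hx⟩ := by
    intro m x hx
    rw [LinearEquiv.symm_apply_eq]
    exact (DirectSum.coeLinearMap_lof gr m ⟨x, hx⟩).symm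
  refine ⟨fun m => (gr m).subtype ∘ₗ DirectSum.component K ℤ (fun i => gr i) m ∘ₗ e.symm.toLinearMap,
    ⟨fun m x => Subtype.prop _, fun m x hx => ?_, fun m n hmn x hx => ?_, ?_⟩⟩
  · simp [hsymm m x hx, DirectSum.component.lof_self]
  · simp only [LinearMap.coe_comp, Function.comp_apply, LinearEquiv.coe_coe, hsymm n x hx,
      DirectSum.component.of]
    rw [dif_neg hmn]
    simp
  · exact hgr.submodule_iSup_eq_top

end IsGradingProj

end GradingProjections

/-! ### Lengths and initial subpaths -/

section Paths

variable {V : Type u} [Quiver.{u} V]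

theorem length_comp {p q r : QPath V} (h : QPath.comp p q = some r) :
    r.length = p.length + q.length := by
  obtain ⟨a, b, p⟩ := p
  obtain ⟨c, d, q⟩ := q
  by_cases hda : d = a
  · subst hda
    simp only [QPath.comp, dite_true, Option.some.injEq] at h
    subst h
    simp [QPath.length, Quiver.Path.length_comp, add_comm]
  · simp [QPath.comp, hda] at h

theorem src_comp {p q r : QPath V} (h : QPath.comp p q = some r) : r.src = q.src := by
  obtain ⟨a, b, p⟩ := p
  obtain ⟨c, d, q⟩ := q
  by_cases hda : d = a
  · subst hda
    simp only [QPath.comp, dite_true, Option.some.injEq] at h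
    subst h
    rfl
  · simp [QPath.comp, hda] at h

/-- The path obtained by appending an arrow. -/
def QPath.snoc (p : QPath V) {w : V} (a : p.tgt ⟶ w) : QPath V := ⟨p.src, w, p.path.cons a⟩

/-- The path of length one given by an arrow. -/
def QPath.arrow {v w : V} (a : v ⟶ w) : QPath V := ⟨v, w, Quiver.Path.nil.cons a⟩

theorem comp_arrow (p : QPath V) {w : V} (a : p.tgt ⟶ w) :
    QPath.comp (QPath.arrow a) p = some (p.snoc a) := by
  obtain ⟨x, y, p⟩ := p
  simp [QPath.comp, QPath.arrow, QPath.snoc]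

theorem length_snoc (p : QPath V) {w : V} (a : p.tgt ⟶ w) : (p.snoc a).length = p.length + 1 := rfl

theorem length_nil (v : V) : (QPath.nil v).length = 0 := rfl

theorem QPath.eq_nil_or_snoc (p : QPath V) :
    p = QPath.nil p.src ∨ ∃ (q : QPath V) (w : V) (a : q.tgt ⟶ w), p = q.snoc a := by
  obtain ⟨x, y, p⟩ := p
  cases p with
  | nil => exact Or.inl rfl
  | cons p a => exact Or.inr ⟨⟨x, _, p⟩, _, a, rfl⟩

theorem eq_nil_of_length_eq_zero {p : QPath V} (h : p.length = 0) : p = QPath.nil p.src := by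
  rcases p.eq_nil_or_snoc with h' | ⟨q, w, a, rfl⟩
  · exact h'
  · rw [length_snoc] at h
    omega

/-- Compare last arrows: either `p` is trivial and `q` is the whole path, or `p` ends with `a`, and
removing it shows that `q` is an initial subpath of `r`. This is what allows a skeleton to grow by
one arrow. -/
theorem comp_eq_some_snoc {p q r : QPath V} {w : V} {a : r.tgt ⟶ w}
    (h : QPath.comp p q = some (r.snoc a)) :
    q = r.snoc a ∨ ∃ p', QPath.comp p' q = some r := by
  obtain ⟨x, y, p⟩ := p
  obtain ⟨c, d, q⟩ := q
  obtain ⟨e, f, r⟩ := r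
  by_cases hdx : d = x
  · subst hdx
    cases p with
    | nil =>
      left
      simpa [QPath.comp] using h
    | cons p b =>
      right
      refine ⟨⟨d, _, p⟩, ?_⟩
      simp only [QPath.comp, dite_true, Option.some.injEq, QPath.snoc, Quiver.Path.cast_rfl_rfl,
        Quiver.Path.comp_cons] at h ⊢
      obtain ⟨rfl, h⟩ := QPath.mk.inj h
      obtain ⟨rfl, h⟩ := h
      have h4 := eq_of_heq h
      obtain ⟨rfl, h5, -⟩ := Quiver.Path.cons.inj h4
      rw [eq_of_heq h5]
  · simp [QPath.comp, hdx] at h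

end Paths

/-! ### The algebra `K Q / I`: vertex idempotents and the Jacobson radical -/

section PathAlgebraQuotient

variable {K : Type u} [Field K] {V : Type u} [Quiver.{u} V] [Fintype V]
  (I : Ideal (PathAlgebra V K)) [I.IsTwoSided]

/-- The class of a path in `K Q / I`. -/
noncomputable def pathClass (p : QPath V) : (PathAlgebra V K ⧸ I) := Ideal.Quotient.mk I (ofPath K p)

theorem quotient_induction {motive : (PathAlgebra V K ⧸ I) → Prop} (x : (PathAlgebra V K ⧸ I)) (zero : motive 0)
    (add : ∀ x y, motive x → motive y → motive (x + y))
    (smul : ∀ (c : K) p, motive (c • pathClass I p)) : motive x := by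
  obtain ⟨f, rfl⟩ := Ideal.Quotient.mk_surjective x
  refine pathAlgebra_induction (P := fun f => motive (Ideal.Quotient.mk I f)) f ?_ ?_ ?_
  · simpa using zero
  · intro f g hf hg
    rw [map_add]
    exact add _ _ hf hg
  · exact smul

theorem pathClass_mul (p q : QPath V) :
    pathClass I p * pathClass I q = Ideal.Quotient.mk I (ofOption K (QPath.comp p q)) := by
  rw [pathClass, pathClass, ← map_mul, ofPath_mul_ofPath]

theorem pathClass_mul_eq (p q : QPath V) :
    pathClass I p * pathClass I q = 0 ∨
      ∃ r, QPath.comp p q = some r ∧ pathClass I p * pathClass I q = pathClass I r := by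
  rw [pathClass_mul]
  cases h : QPath.comp p q with
  | none => exact Or.inl (by simp [ofOption])
  | some r => exact Or.inr ⟨r, rfl, rfl⟩

open Classical in
theorem idem_mul_pathClass (v : V) (p : QPath V) :
    idem I v * pathClass I p = if p.tgt = v then pathClass I p else 0 := by
  change pathClass I (QPath.nil v) * _ = _
  rw [pathClass_mul, nil_comp]
  split_ifs
  · rfl
  · simp [ofOption]

open Classical in
theorem pathClass_mul_idem (v : V) (p : QPath V) :
    pathClass I p * idem I v = if p.src = v then pathClass I p else 0 := by
  change _ * pathClass I (QPath.nil v) = _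
  rw [pathClass_mul, comp_nil]
  split_ifs
  · rfl
  · simp [ofOption]

theorem idem_mul_self (v : V) : idem I v * idem I v = idem I v := by
  classical
  exact (idem_mul_pathClass I v (QPath.nil v)).trans (if_pos rfl)

theorem sum_idem : ∑ v : V, idem I v = 1 := by
  have : (1 : PathAlgebra V K) = ∑ v : V, ofPath K (QPath.nil v) := rfl
  rw [← map_one (Ideal.Quotient.mk I), this, map_sum]
  rfl

theorem pathClass_snoc (p : QPath V) {w : V} (a : p.tgt ⟶ w) :
    pathClass I (p.snoc a) = pathClass I (QPath.arrow a) * pathClass I p := by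
  rw [pathClass_mul, comp_arrow]
  rfl

/-! ### The length filtration and the radical -/

/-- The span of the classes of the paths of length at least `n`. -/
noncomputable def pathSpan (n : ℕ) : Submodule K (PathAlgebra V K ⧸ I) :=
  Submodule.span K {x | ∃ p : QPath V, n ≤ p.length ∧ x = pathClass I p}

variable {I}

theorem pathClass_mem_pathSpan {n : ℕ} {p : QPath V} (h : n ≤ p.length) :
    pathClass I p ∈ pathSpan I n := Submodule.subset_span ⟨p, h, rfl⟩

theorem mem_pathSpan_zero (x : (PathAlgebra V K ⧸ I)) : x ∈ pathSpan I 0 :=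
  quotient_induction I x (Submodule.zero_mem _) (fun _ _ => Submodule.add_mem _)
    fun c _ => Submodule.smul_mem _ c (pathClass_mem_pathSpan (Nat.zero_le _))

theorem mul_mem_pathSpan {m n : ℕ} {x y : (PathAlgebra V K ⧸ I)} (hx : x ∈ pathSpan I m) (hy : y ∈ pathSpan I n) :
    x * y ∈ pathSpan I (m + n) := by
  induction hx using Submodule.span_induction with
  | zero => simp
  | add x x' _ _ h h' => rw [add_mul]; exact Submodule.add_mem _ h h'
  | smul c x _ h => rw [smul_mul_assoc]; exact Submodule.smul_mem _ _ h
  | mem x hx =>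
    obtain ⟨p, hp, rfl⟩ := hx
    induction hy using Submodule.span_induction with
    | zero => simp
    | add x x' _ _ h h' => rw [mul_add]; exact Submodule.add_mem _ h h'
    | smul c x _ h => rw [mul_smul_comm]; exact Submodule.smul_mem _ _ h
    | mem y hy =>
      obtain ⟨q, hq, rfl⟩ := hy
      rcases pathClass_mul_eq I p q with h | ⟨r, hr, h⟩
      · rw [h]
        exact Submodule.zero_mem _
      · rw [h]
        refine pathClass_mem_pathSpan ?_
        rw [length_comp hr]
        omega

theorem pow_mem_pathSpan {x : (PathAlgebra V K ⧸ I)} (hx : x ∈ pathSpan I 1) (n : ℕ) : x ^ n ∈ pathSpan I n := by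
  induction n with
  | zero => exact mem_pathSpan_zero _
  | succ n ih =>
    rw [pow_succ]
    exact mul_mem_pathSpan ih hx

theorem pathSpan_eq_bot {m : ℕ} (h : (pathsGE V K m : Set (PathAlgebra V K)) ⊆ I) :
    pathSpan I m = ⊥ := by
  rw [eq_bot_iff, pathSpan, Submodule.span_le]
  rintro _ ⟨p, hp, rfl⟩
  exact Ideal.Quotient.eq_zero_iff_mem.2 (h (Submodule.subset_span ⟨p, hp, rfl⟩))

/-- The coefficient functional of the trivial path vanishes on all paths of length at least two,
hence on `I`. -/
theorem idem_ne_zero (hadm : IsAdmissible I) (v : V) : idem I v ≠ 0 := by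
  intro h
  have h1 : ofPath K (QPath.nil v) ∈ pathsGE V K 2 := hadm.2 (Ideal.Quotient.eq_zero_iff_mem.1 h)
  have h2 : pathsGE V K 2 ≤ LinearMap.ker (Finsupp.lapply (QPath.nil v) :
      (QPath V →₀ K) →ₗ[K] K) := by
    refine Submodule.span_le.2 ?_
    rintro _ ⟨p, hp, rfl⟩
    refine Finsupp.single_eq_of_ne ?_
    rintro rfl
    rw [length_nil] at hp
    omega
  have h3 : (Finsupp.single (QPath.nil v) (1 : K)) (QPath.nil v) = 0 := h2 h1
  rw [Finsupp.single_eq_same] at h3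
  exact one_ne_zero h3

/-- A product `y * x` is again a combination of paths of positive length, hence nilpotent because
long paths lie in `I`. So `1 + y * x` is a unit. -/
theorem pathSpan_one_le_jacobson (hadm : IsAdmissible I) {x : (PathAlgebra V K ⧸ I)} (hx : x ∈ pathSpan I 1) :
    x ∈ Ring.jacobson (PathAlgebra V K ⧸ I) := by
  obtain ⟨⟨m, -, hm⟩, -⟩ := hadm
  rw [← Ideal.jacobson_bot, Ideal.mem_jacobson_iff]
  intro y
  have h1 : y * x ∈ pathSpan I 1 := by
    simpa using mul_mem_pathSpan (mem_pathSpan_zero y) hx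
  have h2 : IsNilpotent (y * x) := by
    refine ⟨m, ?_⟩
    have := pow_mem_pathSpan h1 m
    rwa [pathSpan_eq_bot hm, Submodule.mem_bot] at this
  obtain ⟨u, hu⟩ := h2.isUnit_one_add
  refine ⟨((u⁻¹ : (PathAlgebra V K ⧸ I)ˣ) : (PathAlgebra V K ⧸ I)), ?_⟩
  rw [Submodule.mem_bot]
  have : ((u⁻¹ : (PathAlgebra V K ⧸ I)ˣ) : (PathAlgebra V K ⧸ I)) * (1 + y * x) = 1 := by rw [← hu, Units.inv_mul]
  rw [mul_add, mul_one] at this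
  rw [mul_assoc, ← this]
  abel

/-- `1 - e` has a left inverse, while `(1 - e) * e = 0`. -/
theorem eq_zero_of_idempotent_mem_jacobson {R : Type*} [Ring R] {e : R} (he : e * e = e)
    (h : e ∈ Ring.jacobson R) : e = 0 := by
  rw [← Ideal.jacobson_bot, Ideal.mem_jacobson_iff] at h
  obtain ⟨z, hz⟩ := h (-1)
  rw [Submodule.mem_bot] at hz
  have h1 : z * (1 - e) = 1 := by
    rw [mul_sub, mul_one]
    rw [mul_neg, mul_one, neg_mul, sub_eq_zero] at hz
    rw [← hz]
    abel
  calc e = z * (1 - e) * e := by rw [h1, one_mul]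
    _ = 0 := by rw [mul_assoc, sub_mul, he, one_mul, sub_self, mul_zero]

/-- Paths of length zero are the vertex idempotents, so these span modulo the paths of positive
length. -/
theorem exists_eq_sum_idem (x : (PathAlgebra V K ⧸ I)) : ∃ c : V → K, x - ∑ v, c v • idem I v ∈ pathSpan I 1 := by
  classical
  refine quotient_induction I (motive := fun x => ∃ c : V → K,
    x - ∑ v, c v • idem I v ∈ pathSpan I 1) x ⟨0, by simp⟩ ?_ ?_
  · rintro x y ⟨c, hc⟩ ⟨c', hc'⟩
    refine ⟨c + c', ?_⟩
    convert Submodule.add_mem _ hc hc' using 1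
    simp only [Pi.add_apply, add_smul, Finset.sum_add_distrib]
    abel
  · intro a p
    rcases Nat.eq_zero_or_pos p.length with h | h
    · refine ⟨Pi.single p.src a, ?_⟩
      have : ∑ v, (Pi.single p.src a : V → K) v • idem I v = a • idem I p.src := by
        rw [Finset.sum_eq_single p.src]
        · simp
        · intro v _ hv
          rw [Pi.single_eq_of_ne hv, zero_smul]
        · exact fun h => absurd (Finset.mem_univ _) h
      rw [this, eq_nil_of_length_eq_zero h]
      change a • pathClass I (QPath.nil p.src) - a • pathClass I (QPath.nil p.src) ∈ _
      rw [sub_self]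
      exact Submodule.zero_mem _
    · refine ⟨0, ?_⟩
      simpa using Submodule.smul_mem _ a (pathClass_mem_pathSpan h)

theorem idem_mul_idem_of_ne {v w : V} (h : v ≠ w) : idem I v * idem I w = 0 := by
  classical
  exact (idem_mul_pathClass I v (QPath.nil w)).trans (if_neg fun h' => h (Eq.symm h'))

/-- The Jacobson radical is spanned by the paths of positive length. -/
theorem mem_jacobson_iff (hadm : IsAdmissible I) {x : (PathAlgebra V K ⧸ I)} :
    x ∈ Ring.jacobson (PathAlgebra V K ⧸ I) ↔ x ∈ pathSpan I 1 := by
  refine ⟨fun hx => ?_, pathSpan_one_le_jacobson hadm⟩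
  obtain ⟨c, hc⟩ := exists_eq_sum_idem x
  have h1 : ∑ v, c v • idem I v ∈ Ring.jacobson (PathAlgebra V K ⧸ I) := by
    have := Ideal.sub_mem _ hx (pathSpan_one_le_jacobson hadm hc)
    simpa using this
  have h2 : ∀ v, c v = 0 := by
    intro v
    by_contra hcv
    -- Multiplying by the idempotent at `v` isolates one coefficient; were it nonzero, a nonzero
    -- idempotent would lie in the radical.
    have h3 : (∑ w, c w • idem I w) * idem I v = c v • idem I v := by
      rw [Finset.sum_mul, Finset.sum_eq_single v]
      · rw [smul_mul_assoc, idem_mul_self]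
      · intro w _ hw
        rw [smul_mul_assoc, idem_mul_idem_of_ne hw, smul_zero]
      · exact fun h => absurd (Finset.mem_univ _) h
    have h4 : c v • idem I v ∈ Ring.jacobson (PathAlgebra V K ⧸ I) := h3 ▸ Ideal.mul_mem_right _ _ h1
    have h5 : idem I v ∈ Ring.jacobson (PathAlgebra V K ⧸ I) := by
      have := Submodule.smul_of_tower_mem (Ring.jacobson (PathAlgebra V K ⧸ I)) (c v)⁻¹ h4
      rwa [smul_smul, inv_mul_cancel₀ hcv, one_smul] at this
    exact idem_ne_zero hadm v (eq_zero_of_idempotent_mem_jacobson (idem_mul_self I v) h5)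
  simpa [h2] using hc

end PathAlgebraQuotient

/-! ### Graded cyclic modules: the radical filtration is the degree filtration -/

section CyclicModules

variable {K : Type u} [Field K] {V : Type u} [Quiver.{u} V] [Fintype V]
  {I : Ideal (PathAlgebra V K)} [I.IsTwoSided]

/-- `C` is an `A`-submodule but `f` is only `K`-linear, so the lift is made after restricting
scalars. -/
theorem exists_quotient_lift {A : Type*} [Ring A] [Algebra K A] {P N : Type*} [AddCommGroup P]
    [Module K P] [Module A P] [IsScalarTower K A P] [AddCommGroup N] [Module K N]
    (C : Submodule A P) (f : P →ₗ[K] N) (hf : ∀ x ∈ C, f x = 0) :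
    ∃ g : (P ⧸ C) →ₗ[K] N, ∀ x, g (C.mkQ x) = f x :=
  ⟨(C.restrictScalars K).liftQ f hf ∘ₗ (Submodule.Quotient.restrictScalarsEquiv K C).symm.toLinearMap,
    fun _ => rfl⟩

variable {M : Type u} [AddCommGroup M] [Module K M] [Module (PathAlgebra V K ⧸ I) M] [IsScalarTower K (PathAlgebra V K ⧸ I) M]

theorem cyclic_induction {z : M} (hz : ∀ x : M, ∃ a : (PathAlgebra V K ⧸ I), x = a • z) {motive : M → Prop} (x : M)
    (zero : motive 0) (add : ∀ x y, motive x → motive y → motive (x + y))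
    (smul : ∀ (c : K) p, motive (c • pathClass I p • z)) : motive x := by
  obtain ⟨a, rfl⟩ := hz x
  refine quotient_induction I (motive := fun a => motive (a • z)) a (by simpa using zero)
    (fun a b ha hb => by rw [add_smul]; exact add _ _ ha hb) fun c p => ?_
  rw [smul_assoc]
  exact smul c p

theorem pathClass_smul_mem_span {n l : ℕ} {z y : M} {q : QPath V} (hq : n ≤ q.length)
    (hy : y ∈ Submodule.span K {y | ∃ p : QPath V, l ≤ p.length ∧ y = pathClass I p • z}) :
    pathClass I q • y ∈
      Submodule.span K {y | ∃ p : QPath V, n + l ≤ p.length ∧ y = pathClass I p • z} := by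
  induction hy using Submodule.span_induction with
  | zero => simp
  | add x y _ _ hx hy => rw [smul_add]; exact Submodule.add_mem _ hx hy
  | smul c x _ hx => rw [smul_comm]; exact Submodule.smul_mem _ _ hx
  | mem x hx =>
    obtain ⟨p, hp, rfl⟩ := hx
    rw [smul_smul]
    rcases pathClass_mul_eq I q p with h | ⟨r, hr, h⟩
    · rw [h, zero_smul]
      exact Submodule.zero_mem _
    · rw [h]
      refine Submodule.subset_span ⟨r, ?_, rfl⟩
      rw [length_comp hr]
      omega

theorem ideal_pow_zero_smul {R N : Type*} [Ring R] [AddCommGroup N] [Module R N] (J : Ideal R) :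
    (J ^ 0 • ⊤ : Submodule R N) = ⊤ := by
  rw [Submodule.pow_zero]
  exact Submodule.one_smul _

theorem ideal_pow_succ_smul {R N : Type*} [Ring R] [AddCommGroup N] [Module R N] (J : Ideal R)
    (l : ℕ) : (J ^ (l + 1) • ⊤ : Submodule R N) = J • (J ^ l • ⊤ : Submodule R N) := by
  cases l with
  | zero => rw [ideal_pow_zero_smul, zero_add, Submodule.pow_one]
  | succ l => rw [Submodule.pow_succ' _ l.succ_ne_zero, Submodule.mul_smul]

/-- The radical filtration of a cyclic module is given by the lengths of paths. -/
theorem mem_jacobson_pow_smul_top_iff_mem_span (hadm : IsAdmissible I) {z : M}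
    (hz : ∀ x : M, ∃ a : (PathAlgebra V K ⧸ I), x = a • z) (l : ℕ) {x : M} :
    x ∈ (Ring.jacobson (PathAlgebra V K ⧸ I) ^ l • ⊤ : Submodule (PathAlgebra V K ⧸ I) M) ↔
      x ∈ Submodule.span K {y | ∃ p : QPath V, l ≤ p.length ∧ y = pathClass I p • z} := by
  induction l generalizing x with
  | zero =>
    rw [ideal_pow_zero_smul]
    refine ⟨fun _ => ?_, fun _ => trivial⟩
    exact cyclic_induction hz x (Submodule.zero_mem _) (fun _ _ => Submodule.add_mem _)
      fun c p => Submodule.smul_mem _ c (Submodule.subset_span ⟨p, Nat.zero_le _, rfl⟩)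
  | succ l ih =>
    rw [ideal_pow_succ_smul]
    constructor
    · intro hx
      refine Submodule.smul_induction_on hx ?_ fun x y => Submodule.add_mem _
      intro a ha n hn
      rw [mem_jacobson_iff hadm] at ha
      rw [ih] at hn
      induction ha using Submodule.span_induction with
      | zero => simp
      | add x y _ _ hx hy => rw [add_smul]; exact Submodule.add_mem _ hx hy
      | smul c x _ hx => rw [smul_assoc]; exact Submodule.smul_mem _ _ hx
      | mem a ha =>
        obtain ⟨q, hq, rfl⟩ := ha
        rw [add_comm l 1]
        exact pathClass_smul_mem_span hq hn
    · intro hx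
      induction hx using Submodule.span_induction with
      | zero => exact Submodule.zero_mem _
      | add x y _ _ hx hy => exact Submodule.add_mem _ hx hy
      | smul c x _ hx => exact Submodule.smul_of_tower_mem _ c hx
      | mem a ha =>
        obtain ⟨q, hq, rfl⟩ := ha
        rcases q.eq_nil_or_snoc with h | ⟨r, w, b, rfl⟩
        · rw [h, length_nil] at hq
          omega
        · rw [length_snoc] at hq
          rw [pathClass_snoc, mul_smul]
          refine Submodule.smul_mem_smul ((mem_jacobson_iff hadm).2
            (pathClass_mem_pathSpan le_rfl)) (ih.2 (Submodule.subset_span ⟨r, ?_, rfl⟩))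
          omega

variable (I) in
/-- The module `M` is generated by `z` and has projections `pr` onto the components of a grading in
which `z` has degree `0`. -/
structure IsPathGraded (z : M) (pr : ℤ → M →ₗ[K] M) : Prop where
  gen : ∀ x : M, ∃ a : (PathAlgebra V K ⧸ I), x = a • z
  pr_path : ∀ m (p : QPath V), pr m (pathClass I p • z) =
    if (p.length : ℤ) = m then pathClass I p • z else 0

namespace IsPathGraded

variable {z : M} {pr : ℤ → M →ₗ[K] M}

theorem exists_sum_pr (h : IsPathGraded I z pr) (x : M) : ∃ s : Finset ℤ, x = ∑ m ∈ s, pr m x := by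
  have key : ∃ s : Finset ℤ, ∀ t, s ⊆ t → x = ∑ m ∈ t, pr m x := by
    refine cyclic_induction h.gen (motive := fun x => ∃ s : Finset ℤ, ∀ t, s ⊆ t →
      x = ∑ m ∈ t, pr m x) x ⟨∅, fun t _ => by simp⟩ ?_ ?_
    · rintro x y ⟨s, hs⟩ ⟨s', hs'⟩
      refine ⟨s ∪ s', fun t ht => ?_⟩
      simp only [map_add, Finset.sum_add_distrib]
      rw [← hs t (Finset.union_subset_left ht), ← hs' t (Finset.union_subset_right ht)]
    · intro c p
      refine ⟨{(p.length : ℤ)}, fun t ht => ?_⟩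
      simp only [map_smul, h.pr_path, smul_ite, smul_zero, Finset.sum_ite_eq]
      rw [if_pos (ht (Finset.mem_singleton_self _))]
  obtain ⟨s, hs⟩ := key
  exact ⟨s, hs s subset_rfl⟩

theorem pr_comp (h : IsPathGraded I z pr) (m n : ℤ) (x : M) :
    pr m (pr n x) = if n = m then pr m x else 0 := by
  refine cyclic_induction h.gen (motive := fun x => pr m (pr n x) = if n = m then pr m x else 0) x
    (by simp) ?_ ?_
  · intro x y hx hy
    rw [map_add, map_add, hx, hy, map_add]
    split_ifs <;> simp
  · intro c p
    simp only [map_smul, h.pr_path]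
    split_ifs <;> simp_all [h.pr_path]

theorem pr_mem_span (h : IsPathGraded I z pr) (m : ℤ) (x : M) :
    pr m x ∈ Submodule.span K {y | ∃ p : QPath V, (p.length : ℤ) = m ∧ y = pathClass I p • z} := by
  refine cyclic_induction h.gen (motive := fun x => pr m x ∈ Submodule.span K
    {y | ∃ p : QPath V, (p.length : ℤ) = m ∧ y = pathClass I p • z}) x (by simp) ?_ ?_
  · intro x y hx hy
    rw [map_add]
    exact Submodule.add_mem _ hx hy
  · intro c p
    rw [map_smul, h.pr_path]
    refine Submodule.smul_mem _ _ ?_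
    split_ifs with hp
    · exact Submodule.subset_span ⟨p, hp, rfl⟩
    · exact Submodule.zero_mem _

theorem pr_of_neg (h : IsPathGraded I z pr) {m : ℤ} (hm : m < 0) (x : M) : pr m x = 0 := by
  have h1 := h.pr_mem_span m x
  have h2 : {y | ∃ p : QPath V, (p.length : ℤ) = m ∧ y = pathClass I p • z} = ∅ := by
    refine Set.eq_empty_of_forall_notMem ?_
    rintro _ ⟨p, hp, _⟩
    omega
  rwa [h2, Submodule.span_empty, Submodule.mem_bot] at h1

/-- Both sides describe the span of the `p z` with `p` of length at least `l`. Through this lemma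
questions about radical layers become questions about degrees. -/
theorem mem_jacobson_pow_iff (h : IsPathGraded I z pr) (hadm : IsAdmissible I) (l : ℕ) {x : M} :
    x ∈ (Ring.jacobson (PathAlgebra V K ⧸ I) ^ l • ⊤ : Submodule (PathAlgebra V K ⧸ I) M) ↔ ∀ m : ℤ, m < l → pr m x = 0 := by
  rw [mem_jacobson_pow_smul_top_iff_mem_span hadm h.gen]
  constructor
  · intro hx m hm
    induction hx using Submodule.span_induction with
    | zero => simp
    | add x y _ _ hx hy => rw [map_add, hx, hy, add_zero]
    | smul c x _ hx => rw [map_smul, hx, smul_zero]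
    | mem a ha =>
      obtain ⟨q, hq, rfl⟩ := ha
      rw [h.pr_path, if_neg]
      omega
  · intro hx
    obtain ⟨s, hs⟩ := h.exists_sum_pr x
    rw [hs]
    refine Submodule.sum_mem _ fun m _ => ?_
    by_cases hm : m < l
    · rw [hx m hm]
      exact Submodule.zero_mem _
    · refine Submodule.span_mono ?_ (h.pr_mem_span m x)
      rintro _ ⟨p, hp, rfl⟩
      exact ⟨p, by omega, rfl⟩

/-- There are no components of negative degree, so degree `0` is the only condition. -/
theorem mem_jacobson_iff (h : IsPathGraded I z pr) (hadm : IsAdmissible I) {x : M} :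
    x ∈ (Ring.jacobson (PathAlgebra V K ⧸ I) • ⊤ : Submodule (PathAlgebra V K ⧸ I) M) ↔ pr 0 x = 0 := by
  have := h.mem_jacobson_pow_iff hadm 1 (x := x)
  rw [Submodule.pow_one] at this
  rw [this]
  refine ⟨fun hx => hx 0 (by simp), fun hx m hm => ?_⟩
  rcases lt_or_eq_of_le (show m ≤ 0 by push_cast at hm; omega) with h0 | rfl
  · exact h.pr_of_neg h0 x
  · exact hx

/-- The components of degree `l` of a basis of paths. -/
theorem pr_sum_path (h : IsPathGraded I z pr) {d : ℕ} (p : Fin d → QPath V) (a : Fin d → K) (m : ℤ) :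
    pr m (∑ i, a i • pathClass I (p i) • z) =
      ∑ i, (if ((p i).length : ℤ) = m then a i else 0) • pathClass I (p i) • z := by
  rw [map_sum]
  refine Finset.sum_congr rfl fun i _ => ?_
  rw [map_smul, h.pr_path]
  split_ifs <;> simp

theorem pr_repr (h : IsPathGraded I z pr) {d : ℕ} {p : Fin d → QPath V}
    (hp : LinearIndependent K fun i => pathClass I (p i) • z) {a : Fin d → K} {m : ℤ} {i : Fin d}
    (h0 : pr m (∑ i, a i • pathClass I (p i) • z) = 0) (hi : ((p i).length : ℤ) = m) : a i = 0 := by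
  rw [h.pr_sum_path] at h0
  have := Fintype.linearIndependent_iff.1 hp _ h0 i
  rwa [if_pos hi] at this

/-- The classes of a set of paths form bases of the radical layers if and only if they form
a basis of the module. -/
theorem hasSkeleton_iff (h : IsPathGraded I z pr) (hadm : IsAdmissible I) {d : ℕ} (p : Fin d → QPath V) :
    (∀ l : ℕ, LinearIndependent K (fun i : {i : Fin d // (p i).length = l} =>
        (Ring.jacobson (PathAlgebra V K ⧸ I) ^ (l + 1) • ⊤ : Submodule (PathAlgebra V K ⧸ I) M).mkQ (pathClass I (p i) • z)) ∧
      Submodule.span K (Set.range (fun i : {i : Fin d // (p i).length = l} =>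
        (Ring.jacobson (PathAlgebra V K ⧸ I) ^ (l + 1) • ⊤ : Submodule (PathAlgebra V K ⧸ I) M).mkQ (pathClass I (p i) • z))) =
        ((Ring.jacobson (PathAlgebra V K ⧸ I) ^ l • (⊤ : Submodule (PathAlgebra V K ⧸ I) M)).map
          (Ring.jacobson (PathAlgebra V K ⧸ I) ^ (l + 1) • ⊤ : Submodule (PathAlgebra V K ⧸ I) M).mkQ).restrictScalars K) ↔
    (LinearIndependent K fun i => pathClass I (p i) • z) ∧
      Submodule.span K (Set.range fun i => pathClass I (p i) • z) = ⊤ := by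
  classical
  constructor
  · intro H
    constructor
    · rw [Fintype.linearIndependent_iff]
      intro a ha i
      have h1 := (H (p i).length).1
      rw [Fintype.linearIndependent_iff] at h1
      refine h1 (fun j => a j) ?_ ⟨i, rfl⟩
      -- The degree part of a relation involves only paths of one length, and these are independent
      -- already modulo the next power of the radical.
      have h2 := congrArg (pr ((p i).length : ℤ)) ha
      rw [h.pr_sum_path, map_zero] at h2
      have h3 : ∑ j : {j : Fin d // (p j).length = (p i).length}, a j • pathClass I (p j) • z = 0 := by
        simp only [Nat.cast_inj, ite_smul, zero_smul] at h2
        rw [← Finset.sum_filter] at h2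
        rw [← h2]
        exact (Finset.sum_subtype (Finset.univ.filter _) (by simp)
          (fun j => a j • pathClass I (p j) • z)).symm
      have h4 := congrArg (Ring.jacobson (PathAlgebra V K ⧸ I) ^ ((p i).length + 1) • ⊤ : Submodule (PathAlgebra V K ⧸ I) M).mkQ h3
      rw [map_sum, map_zero] at h4
      exact h4
    · rw [eq_top_iff]
      rintro x -
      obtain ⟨s, hs⟩ := h.exists_sum_pr x
      rw [hs]
      refine Submodule.sum_mem _ fun m _ => ?_
      rcases lt_or_ge m 0 with hm | hm
      · rw [h.pr_of_neg hm]
        exact Submodule.zero_mem _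
      · obtain ⟨l, rfl⟩ := Int.eq_ofNat_of_zero_le hm
        have h1 : pr l x ∈ (Ring.jacobson (PathAlgebra V K ⧸ I) ^ l • ⊤ : Submodule (PathAlgebra V K ⧸ I) M) := by
          rw [h.mem_jacobson_pow_iff hadm]
          intro n hn
          rw [h.pr_comp, if_neg]
          omega
        have h2 : (Ring.jacobson (PathAlgebra V K ⧸ I) ^ (l + 1) • ⊤ : Submodule (PathAlgebra V K ⧸ I) M).mkQ (pr l x) ∈
            ((Ring.jacobson (PathAlgebra V K ⧸ I) ^ l • (⊤ : Submodule (PathAlgebra V K ⧸ I) M)).map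
              (Ring.jacobson (PathAlgebra V K ⧸ I) ^ (l + 1) • ⊤ : Submodule (PathAlgebra V K ⧸ I) M).mkQ).restrictScalars K :=
          ⟨_, h1, rfl⟩
        rw [← (H l).2, Submodule.mem_span_range_iff_exists_fun] at h2
        obtain ⟨a, ha⟩ := h2
        have h3 : ∑ i, a i • pathClass I (p i) • z - pr l x ∈
            (Ring.jacobson (PathAlgebra V K ⧸ I) ^ (l + 1) • ⊤ : Submodule (PathAlgebra V K ⧸ I) M) := by
          rw [← Submodule.Quotient.mk_eq_zero, ← Submodule.mkQ_apply, map_sub, ← ha, map_sum,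
            sub_eq_zero]
          rfl
        rw [h.mem_jacobson_pow_iff hadm] at h3
        -- An element of `J ^ (l + 1) M` has no part of degree `l`, so the congruence becomes an
        -- equality there.
        have h4 := h3 l (by push_cast; omega)
        rw [map_sub, h.pr_comp, if_pos rfl, sub_eq_zero, map_sum] at h4
        rw [← h4]
        refine Submodule.sum_mem _ fun i _ => ?_
        rw [map_smul, h.pr_path, if_pos (by exact_mod_cast i.2)]
        exact Submodule.smul_mem _ _ (Submodule.subset_span ⟨i.1, rfl⟩)
  · rintro ⟨hli, hsp⟩ l
    constructor
    · rw [Fintype.linearIndependent_iff]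
      intro a ha i
      have h1 : ∑ i, a i • pathClass I (p i) • z ∈
          (Ring.jacobson (PathAlgebra V K ⧸ I) ^ (l + 1) • ⊤ : Submodule (PathAlgebra V K ⧸ I) M) := by
        rw [← Submodule.Quotient.mk_eq_zero, ← Submodule.mkQ_apply, map_sum]
        exact ha
      rw [h.mem_jacobson_pow_iff hadm] at h1
      have h2 := h1 l (by push_cast; omega)
      have h3 : ∑ i : {i : Fin d // (p i).length = l}, a i • pathClass I (p i) • z = 0 := by
        rw [← h2, map_sum]
        refine Finset.sum_congr rfl fun j _ => ?_
        rw [map_smul, h.pr_path, if_pos (by exact_mod_cast j.2)]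
      exact Fintype.linearIndependent_iff.1 (hli.comp (Subtype.val : {i : Fin d // (p i).length = l} →
        Fin d) Subtype.val_injective) a h3 i
    · refine le_antisymm ?_ ?_
      · rw [Submodule.span_le]
        rintro _ ⟨i, rfl⟩
        refine ⟨pathClass I (p i) • z, ?_, rfl⟩
        refine (mem_jacobson_pow_smul_top_iff_mem_span hadm h.gen l).2 ?_
        exact Submodule.subset_span ⟨p i, i.2.ge, rfl⟩
      · rintro _ ⟨x, hx, rfl⟩
        have hx' : x ∈ Submodule.span K (Set.range fun i => pathClass I (p i) • z) :=
          hsp ▸ Submodule.mem_top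
        obtain ⟨a, rfl⟩ := (Submodule.mem_span_range_iff_exists_fun K).1 hx'
        have h1 := (h.mem_jacobson_pow_iff hadm l).1 hx
        rw [map_sum]
        refine Submodule.sum_mem _ fun i _ => ?_
        -- For an element of `J ^ l M`, shorter paths have coefficient zero since its lower
        -- components vanish, and longer paths die in the quotient.
        rcases lt_trichotomy (p i).length l with hi | hi | hi
        · rw [h.pr_repr hli (h1 (p i).length (by exact_mod_cast hi)) rfl, zero_smul, map_zero]
          exact Submodule.zero_mem _
        · exact Submodule.smul_mem _ (a i) (Submodule.subset_span (Set.mem_range_self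
            (⟨i, hi⟩ : {i : Fin d // (p i).length = l})))
        · have : (Ring.jacobson (PathAlgebra V K ⧸ I) ^ (l + 1) • ⊤ : Submodule (PathAlgebra V K ⧸ I) M).mkQ
              (a i • pathClass I (p i) • z) = 0 := by
            rw [Submodule.mkQ_apply, Submodule.Quotient.mk_eq_zero]
            refine Submodule.smul_of_tower_mem _ _ ?_
            refine (mem_jacobson_pow_smul_top_iff_mem_span hadm h.gen _).2 ?_
            exact Submodule.subset_span ⟨p i, hi, rfl⟩
          rw [this]
          exact Submodule.zero_mem _

end IsPathGraded

end CyclicModules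

/-! ### Length gradings on `K Q / I`, on `Λ e_v`, and on its homogeneous quotients -/

section Gradings

variable {K : Type u} [Field K] {V : Type u} [Quiver.{u} V] [Fintype V]
  {I : Ideal (PathAlgebra V K)} [I.IsTwoSided]

/-- Homogeneity of `I` is what makes the component maps of the path algebra descend to the quotient.
Negative degrees get the zero map. -/
theorem exists_lengthProj (hhom : IsLengthHomogeneous I) (m : ℤ) :
    ∃ pr : (PathAlgebra V K ⧸ I) →ₗ[K] (PathAlgebra V K ⧸ I), ∀ p : QPath V,
      pr (pathClass I p) = if (p.length : ℤ) = m then pathClass I p else 0 := by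
  rcases lt_or_ge m 0 with hm | hm
  · refine ⟨0, fun p => ?_⟩
    rw [if_neg (by omega)]
    rfl
  obtain ⟨n, rfl⟩ := Int.eq_ofNat_of_zero_le hm
  set f : PathAlgebra V K →ₗ[K] (PathAlgebra V K ⧸ I) :=
    { toFun := fun x => Ideal.Quotient.mk I (lengthComponent n x)
      map_add' := by
        intro x y
        rw [← map_add]
        exact congrArg _ Finsupp.filter_add
      map_smul' := by
        intro c x
        refine (congrArg (Ideal.Quotient.mk I) (Finsupp.filter_smul (p := fun p : QPath V => p.length = n)
          (b := c) (v := x))).trans rfl } with hf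
  obtain ⟨g, hg⟩ := exists_quotient_lift (A := PathAlgebra V K) I f
    (fun x hx => Ideal.Quotient.eq_zero_iff_mem.2 (hhom x hx n))
  refine ⟨g, fun p => ?_⟩
  refine (hg (ofPath K p)).trans ?_
  have h1 : lengthComponent n (ofPath K p) = if p.length = n then ofPath K p else 0 := by
    split_ifs with h
    · exact Finsupp.filter_single_of_pos (fun p : QPath V => p.length = n) h
    · exact Finsupp.filter_single_of_neg (fun p : QPath V => p.length = n) h
  change Ideal.Quotient.mk I (lengthComponent n (ofPath K p)) = _
  rw [h1]
  by_cases h : p.length = n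
  · rw [if_pos h, if_pos (by exact_mod_cast h)]
    rfl
  · rw [if_neg h, if_neg (by exact_mod_cast h), map_zero]

/-- The projection of `K Q / I` onto the component of degree `m`. -/
noncomputable def lengthProj (hhom : IsLengthHomogeneous I) (m : ℤ) :
    (PathAlgebra V K ⧸ I) →ₗ[K] (PathAlgebra V K ⧸ I) :=
  (exists_lengthProj hhom m).choose

theorem lengthProj_pathClass (hhom : IsLengthHomogeneous I) (m : ℤ) (p : QPath V) :
    lengthProj hhom m (pathClass I p) = if (p.length : ℤ) = m then pathClass I p else 0 :=
  (exists_lengthProj hhom m).choose_spec p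

theorem pathClass_mem_lengthGrading (p : QPath V) : pathClass I p ∈ lengthGrading I p.length :=
  Submodule.subset_span ⟨p, rfl, rfl⟩

theorem isGradingProj_lengthProj (hhom : IsLengthHomogeneous I) :
    IsGradingProj (lengthGrading I) (lengthProj hhom) where
  mem m x := by
    refine quotient_induction I (motive := fun x => lengthProj hhom m x ∈ lengthGrading I m) x
      (by simp) (fun x y hx hy => by rw [map_add]; exact Submodule.add_mem _ hx hy) fun c p => ?_
    rw [map_smul, lengthProj_pathClass]
    refine Submodule.smul_mem _ _ ?_
    split_ifs with h
    · exact h ▸ pathClass_mem_lengthGrading p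
    · exact Submodule.zero_mem _
  self m x hx := by
    induction hx using Submodule.span_induction with
    | zero => simp
    | add x y _ _ hx hy => rw [map_add, hx, hy]
    | smul c x _ hx => rw [map_smul, hx]
    | mem x hx =>
      obtain ⟨p, hp, rfl⟩ := hx
      exact (lengthProj_pathClass hhom m p).trans (if_pos hp)
  other m n hmn x hx := by
    induction hx using Submodule.span_induction with
    | zero => simp
    | add x y _ _ hx hy => rw [map_add, hx, hy, add_zero]
    | smul c x _ hx => rw [map_smul, hx, smul_zero]
    | mem x hx =>
      obtain ⟨p, hp, rfl⟩ := hx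
      exact (lengthProj_pathClass hhom m p).trans (if_neg (by rw [hp]; exact hmn))
  iSup_eq_top := by
    rw [eq_top_iff]
    rintro x -
    exact quotient_induction I (motive := fun x => x ∈ ⨆ m, lengthGrading I m) x
      (Submodule.zero_mem _) (fun x y => Submodule.add_mem _) fun c p =>
        Submodule.smul_mem _ _ (Submodule.mem_iSup_of_mem _ (pathClass_mem_lengthGrading p))

theorem mul_mem_lengthGrading {l m : ℤ} {a b : PathAlgebra V K ⧸ I} (ha : a ∈ lengthGrading I l)
    (hb : b ∈ lengthGrading I m) : a * b ∈ lengthGrading I (l + m) := by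
  induction ha using Submodule.span_induction with
  | zero => simp
  | add x x' _ _ h h' => rw [add_mul]; exact Submodule.add_mem _ h h'
  | smul c x _ h => rw [smul_mul_assoc]; exact Submodule.smul_mem _ _ h
  | mem x hx =>
    obtain ⟨p, hp, rfl⟩ := hx
    induction hb using Submodule.span_induction with
    | zero => simp
    | add x x' _ _ h h' => rw [mul_add]; exact Submodule.add_mem _ h h'
    | smul c x _ h => rw [mul_smul_comm]; exact Submodule.smul_mem _ _ h
    | mem y hy =>
      obtain ⟨q, hq, rfl⟩ := hy
      change pathClass I p * pathClass I q ∈ _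
      rcases pathClass_mul_eq I p q with h | ⟨r, hr, h⟩
      · rw [h]
        exact Submodule.zero_mem _
      · rw [h]
        have := pathClass_mem_lengthGrading (I := I) r
        rwa [length_comp hr, Nat.cast_add, hp, hq] at this

/-- The top element `e_v` of `Λ e_v`. -/
noncomputable def projGen (I : Ideal (PathAlgebra V K)) [I.IsTwoSided] (v : V) : Proj I v :=
  ⟨idem I v, Submodule.mem_span_singleton_self _⟩

theorem pathElt_eq (v : V) (p : QPath V) : pathElt I v p = pathClass I p • projGen I v := rfl

theorem proj_gen (v : V) (x : Proj I v) : ∃ a : PathAlgebra V K ⧸ I, x = a • projGen I v := by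
  obtain ⟨a, ha⟩ := Submodule.mem_span_singleton.1 x.2
  exact ⟨a, Subtype.ext ha.symm⟩

open Classical in
theorem coe_pathElt (v : V) (p : QPath V) :
    (pathElt I v p : PathAlgebra V K ⧸ I) = if p.src = v then pathClass I p else 0 :=
  pathClass_mul_idem I v p

theorem pathElt_nil (v : V) : pathElt I v (QPath.nil v) = projGen I v :=
  Subtype.ext (idem_mul_self I v)

theorem idem_smul_projGen (v : V) : idem I v • projGen I v = projGen I v := pathElt_nil v

/-- `Λ e_v` is spanned by the classes of paths starting at `v`, and the projection keeps or kills
each of them. -/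
theorem lengthProj_mem_proj (hhom : IsLengthHomogeneous I) (v : V) (m : ℤ) (x : Proj I v) :
    lengthProj hhom m x ∈
      (Submodule.span (PathAlgebra V K ⧸ I) {idem I v} : Submodule _ (PathAlgebra V K ⧸ I)) := by
  refine cyclic_induction (proj_gen v) (motive := fun x : Proj I v => lengthProj hhom m x ∈
    (Submodule.span (PathAlgebra V K ⧸ I) {idem I v} : Submodule _ (PathAlgebra V K ⧸ I))) x ?_ ?_ ?_
  · rw [ZeroMemClass.coe_zero, map_zero]
    exact Submodule.zero_mem _
  · intro x y hx hy
    rw [Submodule.coe_add, map_add]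
    exact Submodule.add_mem _ hx hy
  · intro c p
    rw [Submodule.coe_smul_of_tower, map_smul]
    refine Submodule.smul_of_tower_mem _ c ?_
    have h1 := (pathElt I v p).2
    change lengthProj hhom m (pathElt I v p : PathAlgebra V K ⧸ I) ∈ _
    rw [coe_pathElt] at h1 ⊢
    split_ifs at h1 ⊢ with h
    · rw [lengthProj_pathClass]
      split_ifs
      · exact h1
      · exact Submodule.zero_mem _
    · rw [map_zero]
      exact Submodule.zero_mem _

/-- The projection of `Λ e_v` onto the component of degree `m`. -/
noncomputable def projProj (hhom : IsLengthHomogeneous I) (v : V) (m : ℤ) :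
    Proj I v →ₗ[K] Proj I v where
  toFun x := ⟨lengthProj hhom m x, lengthProj_mem_proj hhom v m x⟩
  map_add' _ _ := Subtype.ext (map_add (lengthProj hhom m) _ _)
  map_smul' _ _ := Subtype.ext (map_smul (lengthProj hhom m) _ _)

theorem coe_projProj (hhom : IsLengthHomogeneous I) (v : V) (m : ℤ) (x : Proj I v) :
    (projProj hhom v m x : PathAlgebra V K ⧸ I) = lengthProj hhom m x := rfl

theorem isPathGraded_proj (hhom : IsLengthHomogeneous I) (v : V) :
    IsPathGraded I (projGen I v) (projProj hhom v) where
  gen := proj_gen v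
  pr_path m p := by
    refine Subtype.ext ?_
    rw [coe_projProj]
    change lengthProj hhom m (pathElt I v p : PathAlgebra V K ⧸ I) =
      ((if _ then pathElt I v p else 0 : Proj I v) : PathAlgebra V K ⧸ I)
    rw [apply_ite (Subtype.val), coe_pathElt]
    split_ifs with h h' h'
    · rw [lengthProj_pathClass, if_pos h']
    · rw [lengthProj_pathClass, if_neg h']
      rfl
    · rw [map_zero]
    · rw [map_zero]
      rfl

theorem isGradingProj_projProj (hhom : IsLengthHomogeneous I) (v : V) :
    IsGradingProj (projGrading I v) (projProj hhom v) where
  mem m x := (isGradingProj_lengthProj hhom).mem m x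
  self m x hx := Subtype.ext ((isGradingProj_lengthProj hhom).self m x hx)
  other m n hmn x hx := Subtype.ext ((isGradingProj_lengthProj hhom).other m n hmn x hx)
  iSup_eq_top := by
    rw [eq_top_iff]
    rintro x -
    obtain ⟨s, hs⟩ := (isPathGraded_proj hhom v).exists_sum_pr x
    rw [hs]
    refine Submodule.sum_mem _ fun m _ => Submodule.mem_iSup_of_mem m ?_
    exact (isGradingProj_lengthProj hhom).mem m x

/-- A submodule is homogeneous if and only if it is stable under the projections onto the homogeneous
components. -/
theorem homogeneous_iff {M : Type u} [AddCommGroup M] [Module K M] {gr : ℤ → Submodule K M}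
    {pr : ℤ → M →ₗ[K] M} (h : IsGradingProj gr pr) (C : Submodule K M) :
    C = ⨆ m, C ⊓ gr m ↔ ∀ m, ∀ x ∈ C, pr m x ∈ C := by
  constructor
  · intro hC m x hx
    rw [hC] at hx
    refine Submodule.iSup_induction (fun m => C ⊓ gr m) (motive := fun x => pr m x ∈ C) hx ?_ ?_ ?_
    · intro n x hx
      by_cases hn : n = m
      · subst hn
        rw [h.self _ _ hx.2]
        exact hx.1
      · rw [h.other m n hn x hx.2]
        exact Submodule.zero_mem _
    · rw [map_zero]
      exact Submodule.zero_mem _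
    · intro x y hx hy
      rw [map_add]
      exact Submodule.add_mem _ hx hy
  · intro hC
    refine le_antisymm (fun x hx => ?_) (iSup_le fun m => inf_le_left)
    obtain ⟨s, hs⟩ := h.exists_eq_sum x
    rw [hs]
    exact Submodule.sum_mem _ fun m _ => Submodule.mem_iSup_of_mem m ⟨hC m x hx, h.mem m x⟩

variable {d : ℕ} {v : V}

theorem exists_quotProj (hhom : IsLengthHomogeneous I)
    (C : GrGrassPoint (PathAlgebra V K ⧸ I) (projGrading I v) d) (m : ℤ) :
    ∃ pr : (Proj I v ⧸ C.1) →ₗ[K] (Proj I v ⧸ C.1),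
      ∀ x, pr (C.1.mkQ x) = C.1.mkQ (projProj hhom v m x) := by
  refine exists_quotient_lift C.1 ((C.1.mkQ.restrictScalars K) ∘ₗ projProj hhom v m) fun x hx => ?_
  have := (homogeneous_iff (isGradingProj_projProj hhom v) (C.1.restrictScalars K)).1 C.2.2.2 m x hx
  exact (Submodule.Quotient.mk_eq_zero _).2 this

/-- The projection of the quotient `Λ e_v / C` onto the component of degree `m`. -/
noncomputable def quotProj (hhom : IsLengthHomogeneous I)
    (C : GrGrassPoint (PathAlgebra V K ⧸ I) (projGrading I v) d) (m : ℤ) :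
    (Proj I v ⧸ C.1) →ₗ[K] (Proj I v ⧸ C.1) := (exists_quotProj hhom C m).choose

theorem quotProj_mkQ (hhom : IsLengthHomogeneous I)
    (C : GrGrassPoint (PathAlgebra V K ⧸ I) (projGrading I v) d) (m : ℤ) (x : Proj I v) :
    quotProj hhom C m (C.1.mkQ x) = C.1.mkQ (projProj hhom v m x) :=
  (exists_quotProj hhom C m).choose_spec x

theorem isPathGraded_quot (hhom : IsLengthHomogeneous I)
    (C : GrGrassPoint (PathAlgebra V K ⧸ I) (projGrading I v) d) :
    IsPathGraded I (C.1.mkQ (projGen I v)) (quotProj hhom C) where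
  gen x := by
    obtain ⟨y, rfl⟩ := C.1.mkQ_surjective x
    obtain ⟨a, rfl⟩ := proj_gen v y
    exact ⟨a, map_smul _ _ _⟩
  pr_path m p := by
    rw [← map_smul, quotProj_mkQ, (isPathGraded_proj hhom v).pr_path]
    split_ifs <;> simp

theorem isGradingProj_quotProj (hhom : IsLengthHomogeneous I)
    (C : GrGrassPoint (PathAlgebra V K ⧸ I) (projGrading I v) d) :
    IsGradingProj (fun m => (projGrading I v m).map (C.1.mkQ.restrictScalars K))
      (quotProj hhom C) where
  mem m x := by
    obtain ⟨y, rfl⟩ := C.1.mkQ_surjective x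
    rw [quotProj_mkQ]
    exact ⟨_, (isGradingProj_projProj hhom v).mem m y, rfl⟩
  self m x hx := by
    obtain ⟨y, hy, rfl⟩ := hx
    exact (quotProj_mkQ hhom C m y).trans
      (congrArg C.1.mkQ ((isGradingProj_projProj hhom v).self m y hy))
  other m n hmn x hx := by
    obtain ⟨y, hy, rfl⟩ := hx
    refine (quotProj_mkQ hhom C m y).trans ?_
    rw [(isGradingProj_projProj hhom v).other m n hmn y hy, map_zero]
  iSup_eq_top := by
    rw [← Submodule.map_iSup, (isGradingProj_projProj hhom v).iSup_eq_top, Submodule.map_top,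
      LinearMap.range_eq_top]
    exact C.1.mkQ_surjective

theorem isModuleGrading_quot (hhom : IsLengthHomogeneous I)
    (C : GrGrassPoint (PathAlgebra V K ⧸ I) (projGrading I v) d) :
    IsModuleGrading (lengthGrading I)
      (fun m => (projGrading I v m).map (C.1.mkQ.restrictScalars K)) where
  internal := (isGradingProj_quotProj hhom C).isInternal
  smul_mem := by
    rintro l m a ha _ ⟨x, hx, rfl⟩
    exact ⟨a • x, mul_mem_lengthGrading ha hx, C.1.mkQ.map_smul a x⟩

end Gradings

/-! ### Existence of skeletons -/

section Skeletons

variable {K : Type u} [Field K] {V : Type u} [Quiver.{u} V] [Fintype V]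
  {I : Ideal (PathAlgebra V K)} [I.IsTwoSided]
  {M : Type u} [AddCommGroup M] [Module K M] [Module (PathAlgebra V K ⧸ I) M]
  [IsScalarTower K (PathAlgebra V K ⧸ I) M]

/-- A cyclic module generated by `z = e_v z` has a basis of the form `p z`, where the paths `p` form
a skeleton. -/
theorem exists_skeleton [FiniteDimensional K M] {d : ℕ} (hd : Module.finrank K M = d) {z : M}
    {v : V} (hz : ∀ x : M, ∃ a : PathAlgebra V K ⧸ I, x = a • z) (hv : idem I v • z = z) (hz0 : z ≠ 0) :
    ∃ p : Fin d → QPath V, Function.Injective p ∧ IsSkeleton I v (Set.range p) ∧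
      LinearIndependent K (fun i => pathClass I (p i) • z) ∧
      Submodule.span K (Set.range fun i => pathClass I (p i) • z) = ⊤ := by
  set f : QPath V → M := fun p => pathClass I p • z with hf
  -- Zorn's lemma is applied to sets of paths from `v` which are closed under initial subpaths and
  -- act independently on `z`. Such conditions pass to unions of chains.
  set S : Set (Set (QPath V)) := {σ | (∀ p ∈ σ, p.src = v) ∧
    (∀ p q r, QPath.comp p q = some r → r ∈ σ → q ∈ σ) ∧ LinearIndepOn K f σ} with hS
  have h0 : {QPath.nil v} ∈ S := by
    refine ⟨?_, ?_, ?_⟩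
    · rintro p rfl
      rfl
    · rintro p q r h rfl
      have h1 := length_comp h
      rw [length_nil] at h1
      have h2 := eq_nil_of_length_eq_zero (p := q) (by omega)
      have h3 := src_comp h
      rw [h2, ← h3]
      rfl
    · refine LinearIndepOn.singleton ?_
      change idem I v • z ≠ 0
      rwa [hv]
  obtain ⟨σ, hσ0, hσ⟩ := zorn_subset_nonempty S (by
    intro c hc hchain _
    refine ⟨⋃₀ c, ⟨?_, ?_, ?_⟩, fun s hs => Set.subset_sUnion_of_mem hs⟩
    · rintro p ⟨s, hs, hp⟩
      exact (hc hs).1 p hp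
    · rintro p q r h ⟨s, hs, hr⟩
      exact ⟨s, hs, (hc hs).2.1 p q r h hr⟩
    · exact linearIndepOn_sUnion_of_directed hchain.directedOn fun s hs => (hc hs).2.2) _ h0
  obtain ⟨hσsrc, hσcl, hσli⟩ := hσ.prop
  -- Appending an arrow to a path of `σ` keeps `σ` closed under initial subpaths, so by maximality
  -- the new element must already be dependent.
  have hmax : ∀ p ∈ σ, ∀ (w : V) (a : p.tgt ⟶ w), f (p.snoc a) ∈ Submodule.span K (f '' σ) := by
    intro p hp w a
    by_contra hcon
    have h1 : insert (p.snoc a) σ ∈ S := by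
      refine ⟨?_, ?_, hσli.insert hcon⟩
      · rintro q (rfl | hq)
        · exact hσsrc p hp
        · exact hσsrc q hq
      · rintro p' q r h (rfl | hr)
        · rcases comp_eq_some_snoc h with h' | ⟨p'', h'⟩
          · exact Or.inl h'
          · exact Or.inr (hσcl _ _ _ h' hp)
        · exact Or.inr (hσcl _ _ _ h hr)
    have h2 := hσ.le_of_ge h1 (Set.subset_insert _ _) (Set.mem_insert _ _)
    exact hcon (Submodule.subset_span ⟨_, h2, rfl⟩)
  -- The span is stable under all arrows. It contains `z`, hence all `p z` by induction on the
  -- length.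
  have harrow : ∀ {x w : V} (a : x ⟶ w) (y : M), y ∈ Submodule.span K (f '' σ) →
      pathClass I (QPath.arrow a) • y ∈ Submodule.span K (f '' σ) := by
    intro x w a y hy
    induction hy using Submodule.span_induction with
    | zero => simp
    | add x y _ _ hx hy => rw [smul_add]; exact Submodule.add_mem _ hx hy
    | smul c x _ hx => rw [smul_comm]; exact Submodule.smul_mem _ _ hx
    | mem y hy =>
      obtain ⟨p, hp, rfl⟩ := hy
      by_cases h : p.tgt = x
      · subst h
        have := hmax p hp w a
        simp only [hf] at this ⊢
        rwa [pathClass_snoc, mul_smul] at this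
      · simp only [hf]
        rw [smul_smul, pathClass_mul]
        have : QPath.comp (QPath.arrow a) p = none := dif_neg h
        rw [this, ofOption, map_zero, zero_smul]
        exact Submodule.zero_mem _
  have hall : ∀ (n : ℕ) (p : QPath V), p.length = n → f p ∈ Submodule.span K (f '' σ) := by
    intro n
    induction n with
    | zero =>
      intro p hp
      rw [eq_nil_of_length_eq_zero hp]
      by_cases h : p.src = v
      · rw [h]
        exact Submodule.subset_span ⟨_, hσ0 rfl, rfl⟩
      · have : f (QPath.nil p.src) = 0 := by
          change idem I p.src • z = 0
          rw [← hv, smul_smul, idem_mul_idem_of_ne h, zero_smul]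
        rw [this]
        exact Submodule.zero_mem _
    | succ n ih =>
      intro p hp
      rcases p.eq_nil_or_snoc with h | ⟨q, w, a, rfl⟩
      · rw [h, length_nil] at hp
        omega
      · rw [length_snoc] at hp
        simp only [hf]
        rw [pathClass_snoc, mul_smul]
        exact harrow a _ (ih q (by omega))
  have hspan : Submodule.span K (f '' σ) = ⊤ := by
    rw [eq_top_iff]
    rintro x -
    exact cyclic_induction hz x (Submodule.zero_mem _) (fun _ _ => Submodule.add_mem _)
      fun c p => Submodule.smul_mem _ c (hall _ p rfl)
  have hfin : Finite σ := LinearIndependent.finite_of_isNoetherian hσli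
  have : Fintype σ := Fintype.ofFinite σ
  have hcard : Fintype.card σ = d := by
    refine hd ▸ (Module.finrank_eq_card_basis (Module.Basis.mk hσli ?_)).symm
    rw [← hspan, Set.image_eq_range]
  obtain ⟨e⟩ : Nonempty (Fin d ≃ σ) :=
    ⟨(finCongr hcard.symm).trans (Fintype.equivFin σ).symm⟩
  have hr : Set.range (fun i => (e i : QPath V)) = σ := by
    ext p
    constructor
    · rintro ⟨i, rfl⟩
      exact (e i).2
    · intro hp
      exact ⟨e.symm ⟨p, hp⟩, by simp⟩
  refine ⟨fun i => e i, Subtype.val_injective.comp e.injective, ?_, ?_, ?_⟩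
  · rw [hr]
    refine ⟨⟨_, hσ0 rfl⟩, hσsrc, fun p hp hpI => ?_, hσcl⟩
    refine hσli.ne_zero hp ?_
    have h1 : pathClass I p = 0 := Ideal.Quotient.eq_zero_iff_mem.2 hpI
    simp only [hf, h1, zero_smul]
  · exact hσli.linearIndependent.comp e e.injective
  · have h1 : (Set.range fun i => pathClass I (e i) • z) = f '' σ := by
      conv_rhs => rw [← hr, ← Set.range_comp]
      rfl
    rw [h1, hspan]

end Skeletons

/-! ### The canonical family and the projectivity of its base -/

section CanonicalFamily

variable {K : Type u} [Field K] {V : Type u} [Quiver.{u} V] [Fintype V]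
  {I : Ideal (PathAlgebra V K)} [I.IsTwoSided] {v : V} {d : ℕ}

theorem projGen_ne_zero (hadm : IsAdmissible I) (v : V) : projGen I v ≠ 0 :=
  fun h => idem_ne_zero hadm v (congrArg Subtype.val h)

theorem projProj_zero_projGen (hhom : IsLengthHomogeneous I) (v : V) :
    projProj hhom v 0 (projGen I v) = projGen I v := by
  have := (isPathGraded_proj hhom v).pr_path 0 (QPath.nil v)
  rw [← pathElt_eq, pathElt_nil] at this
  exact this.trans (if_pos rfl)

theorem projGen_notMem_radMod (hadm : IsAdmissible I) (hhom : IsLengthHomogeneous I) (v : V) :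
    projGen I v ∉ radMod (PathAlgebra V K ⧸ I) (Proj I v) := by
  rw [(isPathGraded_proj hhom v).mem_jacobson_iff hadm, projProj_zero_projGen]
  exact projGen_ne_zero hadm v

theorem mkQ_projGen_ne_zero (hadm : IsAdmissible I) (hhom : IsLengthHomogeneous I)
    (C : GrGrassPoint (PathAlgebra V K ⧸ I) (projGrading I v) d) :
    C.1.mkQ (projGen I v) ≠ 0 := fun h =>
  projGen_notMem_radMod hadm hhom v (C.2.1 ((Submodule.Quotient.mk_eq_zero _).1 h))

variable [FiniteDimensional K (PathAlgebra V K ⧸ I)]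

/-- With `d` vectors in a `d`-dimensional quotient, spanning is automatic. The skeleton condition
thus becomes the nonvanishing of a determinant. -/
theorem hasSkeleton_iff_linearIndependent (hadm : IsAdmissible I) (hhom : IsLengthHomogeneous I)
    (C : GrGrassPoint (PathAlgebra V K ⧸ I) (projGrading I v) d) (p : Fin d → QPath V) :
    HasSkeleton I v p C.1 ↔ LinearIndependent K (fun i => C.1.mkQ (pathElt I v (p i))) := by
  refine ((isPathGraded_quot hhom C).hasSkeleton_iff hadm p).trans ⟨fun h => h.1, fun h => ⟨h, ?_⟩⟩
  exact h.span_eq_top_of_card_eq_finrank' (by simp [C.2.2.1])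

theorem map_toGrassmannian (C : GrGrassPoint (PathAlgebra V K ⧸ I) (projGrading I v) d) :
    C.toGrassmannian.1.map ((radMod (PathAlgebra V K ⧸ I) (Proj I v)).subtype.restrictScalars K) =
      C.1.restrictScalars K := by
  ext x
  constructor
  · rintro ⟨y, hy, rfl⟩
    exact hy
  · exact fun hx => ⟨⟨x, C.2.1 hx⟩, hx, rfl⟩

/-- A point of the Grassmannian forces `d ≤ dim Λ e_v`, so the truncated subtraction is an honest
one. -/
theorem finrank_eq_add (C : GrGrassPoint (PathAlgebra V K ⧸ I) (projGrading I v) d) :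
    Module.finrank K (Proj I v) = Module.finrank K (Proj I v) - d + d := by
  have h1 : Module.finrank K (Proj I v ⧸ C.1) + Module.finrank K C.1 = Module.finrank K (Proj I v) :=
    Submodule.finrank_quotient_add_finrank (C.1.restrictScalars K)
  rw [C.2.2.1] at h1
  omega

/-- Linear forms in the Plücker coordinates which detect bases of `Λ e_v / C` and compute coordinates
with respect to them. -/
theorem exists_chartForm (C₀ : GrGrassPoint (PathAlgebra V K ⧸ I) (projGrading I v) d) :
    ∃ G : (Fin d → Proj I v) → MvPolynomial (Fin (Module.finrank K (Proj I v) - d) ↪o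
        Fin (Module.finrank K (radMod (PathAlgebra V K ⧸ I) (Proj I v)))) K,
      (∀ u, (G u).IsHomogeneous 1) ∧
      ∀ C : GrGrassPoint (PathAlgebra V K ⧸ I) (projGrading I v) d,
        (∀ u, MvPolynomial.eval (plucker C.toGrassmannian) (G u) ≠ 0 ↔
          LinearIndependent K (fun i => C.1.mkQ (u i))) ∧
        ∀ u i x (a : Fin d → K), C.1.mkQ x = ∑ j, a j • C.1.mkQ (u j) →
          MvPolynomial.eval (plucker C.toGrassmannian) (G (Function.update u i x)) =
            a i * MvPolynomial.eval (plucker C.toGrassmannian) (G u) := by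
  obtain ⟨G, hG, h⟩ := exists_quotientDet
    ((radMod (PathAlgebra V K ⧸ I) (Proj I v)).subtype.restrictScalars K)
    Subtype.val_injective (finrank_eq_add C₀)
  refine ⟨G, hG, fun C => ?_⟩
  obtain ⟨h1, h2⟩ := h C.toGrassmannian
  rw [map_toGrassmannian] at h1 h2
  have hmem : ∀ (u : Fin d → Proj I v) (a : Fin d → K),
      ∑ j, a j • C.1.mkQ (u j) = C.1.mkQ (∑ j, a j • u j) := by
    intro u a
    rw [map_sum]
    rfl
  refine ⟨fun u => (h1 u).trans ?_, fun u i x a hx => h2 u i x a ?_⟩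
  · rw [Fintype.linearIndependent_iff, Fintype.linearIndependent_iff]
    have : ∀ a : Fin d → K, ∑ j, a j • (C.1.restrictScalars K).mkQ (u j) = 0 ↔
        ∑ j, a j • C.1.mkQ (u j) = 0 := by
      intro a
      rw [hmem]
      have h3 : ∑ j, a j • (C.1.restrictScalars K).mkQ (u j) =
          (C.1.restrictScalars K).mkQ (∑ j, a j • u j) := by
        rw [map_sum]
        rfl
      rw [h3]
      exact (Submodule.Quotient.mk_eq_zero _).trans (Submodule.Quotient.mk_eq_zero _).symm
    simp only [this]
  · rw [hmem, ← sub_eq_zero, ← map_sub] at hx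
    exact (Submodule.Quotient.mk_eq_zero _).1 hx

theorem reg_of_isEmpty {X : FunctionSpace K} (hX : IsEmpty X) (U : Set X) (f : X → K) :
    X.Reg U f := by
  refine X.reg_glue ?_ fun x => (hX.false x).elim
  rw [Set.eq_empty_of_isEmpty U]
  exact isOpen_empty

theorem eq_sum_of_equiv_single {E : Type*} [AddCommGroup E] [Module K E] (f : E ≃ₗ[K] (Fin d → K))
    {b : Fin d → E} (hb : ∀ i, f (b i) = Pi.single i 1) (e : E) : e = ∑ j, f e j • b j := by
  apply f.injective
  rw [map_sum]
  simp only [map_smul, hb]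
  funext i
  simp [Finset.sum_apply, Pi.single_apply]

section Atlas

variable {c : LocalTriv (K := K) (canonicalFamily I v d).fibre d} {p : Fin d → QPath V}

theorem eq_sum_coord
    (htriv : ∀ C (hC : C ∈ c.dom) (i : Fin d),
      c.triv C hC (Submodule.mkQ C.1 (pathElt I v (p i))) = Pi.single i 1)
    {C : grGrassTop I v d} (hC : C ∈ c.dom) (e : (canonicalFamily I v d).fibre C) :
    e = ∑ j, c.coord C e j • (Submodule.mkQ C.1 (pathElt I v (p j)) :
      (canonicalFamily I v d).fibre C) := by
  have h : c.coord C e = c.triv C hC e := dif_pos hC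
  rw [h]
  exact eq_sum_of_equiv_single (c.triv C hC) (htriv C hC) e

theorem frame_eq
    (htriv : ∀ C (hC : C ∈ c.dom) (i : Fin d),
      c.triv C hC (Submodule.mkQ C.1 (pathElt I v (p i))) = Pi.single i 1)
    {C : grGrassTop I v d} (hC : C ∈ c.dom) (j : Fin d) :
    c.frame j C = Submodule.mkQ C.1 (pathElt I v (p j)) := by
  exact (dif_pos hC).trans ((LinearEquiv.symm_apply_eq _).2 (htriv C hC j).symm)

/-- Cramer's rule: the `i`-th coordinate of `x` is the ratio of the chart forms of the frame with
`x` in place `i` and of the frame itself. The domain is exactly where the denominator is nonzero. -/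
theorem reg_coord (hadm : IsAdmissible I) (hhom : IsLengthHomogeneous I)
    (hdom : c.dom = {C | HasSkeleton I v p C.1})
    (htriv : ∀ C (hC : C ∈ c.dom) (i : Fin d),
      c.triv C hC (Submodule.mkQ C.1 (pathElt I v (p i))) = Pi.single i 1)
    (x : Proj I v) (i : Fin d) :
    (grGrassTop I v d).Reg c.dom (fun C => c.coord C (Submodule.mkQ C.1 x) i) := by
  rcases isEmpty_or_nonempty (grGrassTop I v d) with he | ⟨⟨C₀⟩⟩
  · exact reg_of_isEmpty he _ _
  obtain ⟨G, hG, h⟩ := exists_chartForm C₀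
  set u : Fin d → Proj I v := fun i => pathElt I v (p i) with hu
  have h1 := (isMor_induced (grassmannian K (radMod (PathAlgebra V K ⧸ I) (Proj I v))
    (Module.finrank K (Proj I v) - d))
    (fun C : GrGrassPoint (PathAlgebra V K ⧸ I) (projGrading I v) d => C.toGrassmannian)).2 _ _
      (reg_homogeneousSpace_div plucker (hG (Function.update u i x)) (hG u))
  have hd : c.dom = (fun C : GrGrassPoint (PathAlgebra V K ⧸ I) (projGrading I v) d =>
      C.toGrassmannian) ⁻¹' {y | MvPolynomial.eval (plucker y) (G u) ≠ 0} := by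
    rw [hdom]
    ext C
    exact (hasSkeleton_iff_linearIndependent hadm hhom C p).trans ((h C).1 u).symm
  rw [hd]
  refine (grGrassTop I v d).reg_congr h1 fun C hC => ?_
  have hC' : C ∈ c.dom := hd ▸ hC
  have hC'' : MvPolynomial.eval (plucker (GrGrassPoint.toGrassmannian C)) (G u) ≠ 0 := hC
  refine (congrArg (· / _) ((h C).2 u i x _ (eq_sum_coord htriv hC' _))).trans ?_
  exact mul_div_cancel_right₀ _ hC''

end Atlas

/-- The atlas is described by a condition on charts; this provides a chart for each skeleton. -/
theorem exists_mem_atlas (hadm : IsAdmissible I) (hhom : IsLengthHomogeneous I)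
    {p : Fin d → QPath V} (hp : Function.Injective p) (hσ : IsSkeleton I v (Set.range p)) :
    ∃ c ∈ (canonicalFamily I v d).atlas, c.dom = {C | HasSkeleton I v p C.1} ∧
      ∀ C (hC : C ∈ c.dom) (i : Fin d),
        c.triv C hC (Submodule.mkQ C.1 (pathElt I v (p i))) = Pi.single i 1 := by
  have hb : ∀ C : GrGrassPoint (PathAlgebra V K ⧸ I) (projGrading I v) d, HasSkeleton I v p C.1 →
      ∃ e : (Proj I v ⧸ C.1) ≃ₗ[K] (Fin d → K), ∀ i, e (C.1.mkQ (pathElt I v (p i))) =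
        Pi.single i 1 := by
    intro C hC
    obtain ⟨h1, h2⟩ := ((isPathGraded_quot hhom C).hasSkeleton_iff hadm p).1 hC
    refine ⟨(Module.Basis.mk h1 h2.ge).equivFun, fun i => ?_⟩
    have := (Module.Basis.mk h1 h2.ge).equivFun_self i
    rw [Module.Basis.mk_apply] at this
    funext j
    refine (this j).trans ?_
    simp [Pi.single_apply, eq_comm]
  choose e he using hb
  exact ⟨⟨{C | HasSkeleton I v p C.1}, fun C hC => e C hC⟩, ⟨p, hp, hσ, rfl, fun C hC i => he C hC i⟩,
    rfl, fun C hC i => he C hC i⟩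

/-- Every quotient has a skeleton. -/
theorem exists_hasSkeleton (hadm : IsAdmissible I) (hhom : IsLengthHomogeneous I)
    (C : GrGrassPoint (PathAlgebra V K ⧸ I) (projGrading I v) d) :
    ∃ p : Fin d → QPath V, Function.Injective p ∧ IsSkeleton I v (Set.range p) ∧
      HasSkeleton I v p C.1 := by
  have : FiniteDimensional K (Proj I v ⧸ C.1) :=
    inferInstanceAs (FiniteDimensional K (Proj I v ⧸ C.1.restrictScalars K))
  obtain ⟨p, hp, hσ, hli⟩ := exists_skeleton C.2.2.1 (isPathGraded_quot hhom C).gen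
    (v := v) (by rw [← map_smul, idem_smul_projGen]) (mkQ_projGen_ne_zero hadm hhom C)
  exact ⟨p, hp, hσ, ((isPathGraded_quot hhom C).hasSkeleton_iff hadm p).2 hli⟩

/-- Frame vectors are classes of fixed elements of `Λ e_v`, so transition functions and the matrices
of the action are all instances of `reg_coord`. -/
theorem isFamily_canonicalFamily (hadm : IsAdmissible I) (hhom : IsLengthHomogeneous I) (v : V)
    (d : ℕ) : (canonicalFamily I v d).IsFamily (lengthGrading I) := by
  have hbt : ∀ c ∈ (canonicalFamily I v d).atlas, (canonicalFamily I v d).IsBundleTriv c := by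
    rintro c ⟨p, hp, hσ, hdom, htriv⟩
    have hopen : ∀ {c : LocalTriv (K := K) (canonicalFamily I v d).fibre d} {p : Fin d → QPath V},
        c.dom = {C | HasSkeleton I v p C.1} → (∀ C (hC : C ∈ c.dom) (i : Fin d),
          c.triv C hC (Submodule.mkQ C.1 (pathElt I v (p i))) = Pi.single i 1) → IsOpen c.dom := by
      intro c p hdom htriv
      -- For `d = 0` there is no coordinate function from which openness can be read off, but then
      -- the Grassmannian is empty.
      rcases Nat.eq_zero_or_pos d with rfl | hd
      · have he : IsEmpty (grGrassTop I v 0) := by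
          refine ⟨fun C => ?_⟩
          have h1 := mkQ_projGen_ne_zero hadm hhom C
          have : FiniteDimensional K (Proj I v ⧸ C.1) :=
            inferInstanceAs (FiniteDimensional K (Proj I v ⧸ C.1.restrictScalars K))
          have h2 := Module.finrank_zero_iff.1 C.2.2.1
          exact h1 (Subsingleton.elim _ _)
        rw [Set.eq_empty_of_isEmpty c.dom]
        exact isOpen_empty
      · exact (grGrassTop I v d).isOpen_of_reg (reg_coord hadm hhom hdom htriv 0 ⟨0, hd⟩)
    refine ⟨hopen hdom htriv, ?_⟩
    rintro c' ⟨p', hp', hσ', hdom', htriv'⟩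
    have ho := (hopen hdom htriv).inter (hopen hdom' htriv')
    constructor
    · intro i j
      refine (grGrassTop I v d).reg_congr ((grGrassTop I v d).reg_res
        (reg_coord hadm hhom hdom' htriv' (pathElt I v (p j)) i) ho Set.inter_subset_right) ?_
      intro C hC
      rw [frame_eq htriv hC.1]
    · intro i j
      rw [Set.inter_comm]
      refine (grGrassTop I v d).reg_congr ((grGrassTop I v d).reg_res
        (reg_coord hadm hhom hdom htriv (pathElt I v (p' j)) i) ho Set.inter_subset_left) ?_
      intro C hC
      rw [frame_eq htriv' hC.2]
  refine ⟨hbt, ?_, ?_, ?_, ?_, ?_⟩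
  · intro C
    obtain ⟨p, hp, hσ, hs⟩ := exists_hasSkeleton hadm hhom C
    obtain ⟨c, hc, hdom, -⟩ := exists_mem_atlas hadm hhom hp hσ
    exact ⟨c, hc, hdom ▸ hs⟩
  · rintro a c ⟨p, hp, hσ, hdom, htriv⟩ i j
    refine (grGrassTop I v d).reg_congr
      (reg_coord hadm hhom hdom htriv (a • pathElt I v (p j)) i) fun C hC => ?_
    rw [frame_eq htriv hC]
    rfl
  · exact fun C => isModuleGrading_quot hhom C
  · intro m C₀
    obtain ⟨p, hp, hσ, hs⟩ := exists_hasSkeleton hadm hhom C₀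
    obtain ⟨c, hc, hdom, htriv⟩ := exists_mem_atlas hadm hhom hp hσ
    -- Skeleton charts split all the gradings: the component of degree `m` is spanned by the frame
    -- vectors of paths of length `m`.
    refine ⟨c, hbt c hc, hdom ▸ hs, {i | ((p i).length : ℤ) = m}, fun C hC e => ?_⟩
    have hli := (hasSkeleton_iff_linearIndependent hadm hhom C p).1 ((Set.ext_iff.1 hdom C).1 hC)
    have he := eq_sum_coord htriv hC e
    refine (isGradingProj_quotProj hhom C).mem_iff.trans ?_
    have h1 : quotProj hhom C m e = ∑ i, (if ((p i).length : ℤ) = m then c.coord C e i else 0) •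
        Submodule.mkQ C.1 (pathElt I v (p i)) := by
      conv_lhs => rw [he]
      exact (isPathGraded_quot hhom C).pr_sum_path p _ m
    rw [h1]
    constructor
    · intro h i hi
      have h2 : ∑ i, ((if ((p i).length : ℤ) = m then c.coord C e i else 0) - c.coord C e i) •
          Submodule.mkQ C.1 (pathElt I v (p i)) = 0 := by
        simp only [sub_smul, Finset.sum_sub_distrib]
        exact (congrArg (· - _) h).trans (sub_eq_zero.2 he)
      have h3 := Fintype.linearIndependent_iff.1 hli _ h2 i
      have hi' : ¬ ((p i).length : ℤ) = m := hi
      rw [if_neg hi', zero_sub, neg_eq_zero] at h3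
      exact h3
    · intro h
      refine Eq.trans (Finset.sum_congr rfl fun i _ => ?_) he.symm
      split_ifs with hi
      · rfl
      · rw [h i hi]
  · refine ⟨0, fun C => ?_⟩
    rw [eq_top_iff]
    rintro x -
    obtain ⟨a, rfl⟩ := (isPathGraded_quot hhom C).gen x
    refine Submodule.smul_mem _ _ (Submodule.subset_span ⟨projGen I v, ?_, rfl⟩)
    exact (isGradingProj_projProj hhom v).mem_iff.2 (projProj_zero_projGen hhom v)

/-- The graded Grassmannian is a projective variety. -/
theorem isProjectiveVariety_grGrassTop (hadm : IsAdmissible I) (hhom : IsLengthHomogeneous I)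
    (v : V) (d : ℕ) : IsProjectiveVariety (grGrassTop I v d) := by
  rcases isEmpty_or_nonempty (grGrassTop I v d) with he | ⟨⟨C₀⟩⟩
  · exact isProjectiveVariety_of_isEmpty he
  set J := radMod (PathAlgebra V K ⧸ I) (Proj I v) with hJ
  have hstab : ∀ m, ∀ x ∈ J, projProj hhom v m x ∈ J := by
    intro m x hx
    rw [hJ, (isPathGraded_proj hhom v).mem_jacobson_iff hadm] at hx ⊢
    rw [(isPathGraded_proj hhom v).pr_comp, hx, ite_self]
  set S : (PathAlgebra V K ⧸ I) → J →ₗ[K] J := fun a => Algebra.lsmul K K J a with hS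
  set Q : ℤ → J →ₗ[K] J := fun m =>
    { toFun := fun x => ⟨projProj hhom v m x, hstab m x x.2⟩
      map_add' := fun _ _ => Subtype.ext (map_add (projProj hhom v m) _ _)
      map_smul' := fun _ _ => Subtype.ext (map_smul (projProj hhom v m) _ _) } with hQ
  -- Stability under all multiplications means being a submodule, and stability under all `Q m`
  -- means being homogeneous.
  refine isProjectiveVariety_induced_grassmannian _ ?_ (Set.range S ∪ Set.range Q) ?_
  · intro C C' h
    refine Subtype.ext (Submodule.restrictScalars_injective K (PathAlgebra V K ⧸ I) (Proj I v) ?_)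
    rw [← map_toGrassmannian C, ← map_toGrassmannian C']
    exact congrArg (fun D : GrassmannianPoint K J _ => D.1.map (J.subtype.restrictScalars K)) h
  · intro D
    constructor
    · rintro ⟨C, rfl⟩ T (⟨a, rfl⟩ | ⟨m, rfl⟩) w hw
      · exact C.1.smul_mem a hw
      · exact (homogeneous_iff (isGradingProj_projProj hhom v) (C.1.restrictScalars K)).1
          C.2.2.2 m w hw
    · intro hD
      set C' : Submodule (PathAlgebra V K ⧸ I) J :=
        { D.1 with smul_mem' := fun a x hx => hD _ (Or.inl ⟨a, rfl⟩) x hx } with hC'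
      have hle : C'.map J.subtype ≤ J := by
        rintro _ ⟨x, -, rfl⟩
        exact x.2
      have h1 : Module.finrank K (C'.map J.subtype) = Module.finrank K (Proj I v) - d := by
        have h2 : Module.finrank K (C'.map J.subtype) = Module.finrank K C' :=
          ((Submodule.equivMapOfInjective J.subtype Subtype.val_injective C').restrictScalars
            K).finrank_eq.symm
        exact h2.trans D.2
      have h3 : Module.finrank K (Proj I v ⧸ C'.map J.subtype) +
          Module.finrank K (C'.map J.subtype) = Module.finrank K (Proj I v) :=
        Submodule.finrank_quotient_add_finrank ((C'.map J.subtype).restrictScalars K)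
      have h4 := finrank_eq_add C₀
      refine ⟨⟨C'.map J.subtype, hle, by omega, ?_⟩, ?_⟩
      · refine (homogeneous_iff (isGradingProj_projProj hhom v) _).2 ?_
        rintro m _ ⟨x, hx, rfl⟩
        exact ⟨Q m x, hD _ (Or.inr ⟨m, rfl⟩) x hx, rfl⟩
      · refine Subtype.ext ?_
        ext x
        constructor
        · rintro ⟨y, hy, hyx⟩
          have : y = x := Subtype.ext hyx
          exact this ▸ hy
        · exact fun hx => ⟨x, hx, rfl⟩

end CanonicalFamily

/-! ### Pullbacks of families -/

section Pullback

variable {K : Type u} [Field K] {A : Type u} [Ring A] [Algebra K A] {d : ℕ}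

theorem FamilyData.IsBundleTriv.pullback {X Y : FunctionSpace K} {D : FamilyData K A X d}
    {c : LocalTriv (K := K) D.fibre d} (hc : D.IsBundleTriv c) {τ : Y → X} (hτ : IsMor Y X τ) :
    (D.pullback τ).IsBundleTriv (X := Y) (c.pullback τ) := by
  refine ⟨hc.1.preimage hτ.1, ?_⟩
  rintro _ ⟨c', hc', rfl⟩
  exact ⟨fun i j => hτ.2 _ _ ((hc.2 c' hc').1 i j), fun i j => hτ.2 _ _ ((hc.2 c' hc').2 i j)⟩

/-- The pullback of a family along a morphism is a family. -/
theorem FamilyData.IsFamily.pullback {X Y : FunctionSpace K} {𝒜 : ℤ → Submodule K A}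
    {D : FamilyData K A X d} (hD : D.IsFamily 𝒜) {τ : Y → X} (hτ : IsMor Y X τ) :
    (D.pullback τ).IsFamily (X := Y) 𝒜 where
  atlas_compat := by
    rintro _ ⟨c, hc, rfl⟩
    exact (hD.atlas_compat c hc).pullback hτ
  atlas_cover y := by
    obtain ⟨c, hc, hy⟩ := hD.atlas_cover (τ y)
    exact ⟨c.pullback τ, ⟨c, hc, rfl⟩, hy⟩
  smul_regular := by
    rintro a _ ⟨c, hc, rfl⟩ i j
    exact hτ.2 _ _ (hD.smul_regular a c hc i j)
  grading y := hD.grading (τ y)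
  subbundle m y := by
    obtain ⟨c, hc, hy, s, hs⟩ := hD.subbundle m (τ y)
    exact ⟨c.pullback τ, hc.pullback hτ, hy, s, fun y' hy' e => hs (τ y') hy' e⟩
  generated := by
    obtain ⟨s, hs⟩ := hD.generated
    exact ⟨s, fun y => hs (τ y)⟩

end Pullback

/-! ### Simple modules and tops of quotients of `Λ e_v` -/

section Tops

theorem map_mem_smul_top {R M N : Type*} [Ring R] [AddCommGroup M] [Module R M] [AddCommGroup N]
    [Module R N] (J : Ideal R) (f : M →ₗ[R] N) {x : M} (hx : x ∈ (J • ⊤ : Submodule R M)) :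
    f x ∈ (J • ⊤ : Submodule R N) := by
  refine Submodule.smul_induction_on (p := fun x => f x ∈ (J • ⊤ : Submodule R N)) hx
    (fun r hr n _ => ?_) (fun x y hx hy => ?_)
  · rw [map_smul]
    exact Submodule.smul_mem_smul hr Submodule.mem_top
  · rw [map_add]
    exact add_mem hx hy

theorem map_mkQ_smul_top {R M : Type*} [Ring R] [AddCommGroup M] [Module R M] (J : Ideal R)
    (C : Submodule R M) :
    (J • ⊤ : Submodule R M).map C.mkQ = (J • ⊤ : Submodule R (M ⧸ C)) := by
  refine le_antisymm ?_ ?_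
  · rintro _ ⟨x, hx, rfl⟩
    exact map_mem_smul_top J _ hx
  · intro y hy
    refine Submodule.smul_induction_on
      (p := fun y => y ∈ (J • ⊤ : Submodule R M).map C.mkQ) hy (fun r hr n _ => ?_)
      (fun _ _ => add_mem)
    obtain ⟨n, rfl⟩ := C.mkQ_surjective n
    exact ⟨r • n, Submodule.smul_mem_smul hr Submodule.mem_top, map_smul _ _ _⟩

variable {K : Type u} [Field K] {V : Type u} [Quiver.{u} V] [Fintype V]
  {I : Ideal (PathAlgebra V K)} [I.IsTwoSided] {v : V}

theorem coe_smul_projGen (u : Proj I v) :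
    (u : PathAlgebra V K ⧸ I) • projGen I v = u := by
  obtain ⟨a, rfl⟩ := proj_gen v u
  have : ((a • projGen I v : Proj I v) : PathAlgebra V K ⧸ I) = a * idem I v := rfl
  rw [this, mul_smul, idem_smul_projGen]

/-- Modulo the radical an element of the algebra is a combination of vertex idempotents, and only
the one at `v` acts nontrivially on `e_v`. So `P = K e_v + J P`. -/
theorem exists_sub_smul_mem_radMod (hadm : IsAdmissible I) (x : Proj I v) :
    ∃ c : K, x - c • projGen I v ∈ radMod (PathAlgebra V K ⧸ I) (Proj I v) := by
  classical
  obtain ⟨a, rfl⟩ := proj_gen v x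
  obtain ⟨c, hc⟩ := exists_eq_sum_idem a
  refine ⟨c v, ?_⟩
  have h := Submodule.smul_mem_smul (pathSpan_one_le_jacobson hadm hc)
    (Submodule.mem_top (x := projGen I v))
  have h1 : (∑ w, c w • idem I w) • projGen I v = c v • projGen I v := by
    rw [Finset.sum_smul, Finset.sum_eq_single v]
    · rw [smul_assoc, idem_smul_projGen]
    · intro w _ hw
      rw [smul_assoc, ← idem_smul_projGen, ← mul_smul, idem_mul_idem_of_ne hw, zero_smul, smul_zero]
    · simp
  rwa [sub_smul, h1] at h

theorem simple_eq_smul (hadm : IsAdmissible I) (x : Simple I v) :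
    ∃ c : K, x = c • (radMod (PathAlgebra V K ⧸ I) (Proj I v)).mkQ (projGen I v) := by
  obtain ⟨x, rfl⟩ := Submodule.mkQ_surjective _ x
  obtain ⟨c, hc⟩ := exists_sub_smul_mem_radMod hadm x
  exact ⟨c, (Submodule.Quotient.eq _).2 hc⟩

theorem simple_proportional (hadm : IsAdmissible I) {x : Simple I v} (hx : x ≠ 0)
    (y : Simple I v) : ∃ c : K, y = c • x := by
  obtain ⟨a, rfl⟩ := simple_eq_smul hadm x
  obtain ⟨b, rfl⟩ := simple_eq_smul hadm y
  have ha : a ≠ 0 := by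
    rintro rfl
    exact hx (zero_smul _ _)
  exact ⟨b / a, by rw [smul_smul, div_mul_cancel₀ _ ha]⟩

theorem idem_smul_simple (hadm : IsAdmissible I) (x : Simple I v) : idem I v • x = x := by
  obtain ⟨a, rfl⟩ := simple_eq_smul hadm x
  rw [smul_comm, ← map_smul, idem_smul_projGen]

theorem simple_nontrivial (hadm : IsAdmissible I) (hhom : IsLengthHomogeneous I) :
    ∃ x : Simple I v, x ≠ 0 :=
  ⟨(radMod (PathAlgebra V K ⧸ I) (Proj I v)).mkQ (projGen I v), fun h =>
    projGen_notMem_radMod hadm hhom v ((Submodule.Quotient.mk_eq_zero _).1 h)⟩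

/-- Every simple module is the top of an indecomposable projective module. -/
theorem exists_equiv_simple (hadm : IsAdmissible I) (T : Type u) [AddCommGroup T]
    [Module (PathAlgebra V K ⧸ I) T] [IsSimpleModule (PathAlgebra V K ⧸ I) T] :
    ∃ v : V, Nonempty (T ≃ₗ[PathAlgebra V K ⧸ I] Simple I v) := by
  have := IsSimpleModule.nontrivial (PathAlgebra V K ⧸ I) T
  obtain ⟨t₀, ht₀⟩ := exists_ne (0 : T)
  obtain ⟨v, hv⟩ : ∃ v, idem I v • t₀ ≠ 0 := by
    by_contra! h
    apply ht₀
    rw [← one_smul (PathAlgebra V K ⧸ I) t₀, ← sum_idem, Finset.sum_smul]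
    exact Finset.sum_eq_zero fun v _ => h v
  set t := idem I v • t₀ with ht
  have hvt : idem I v • t = t := by rw [ht, ← mul_smul, idem_mul_self]
  let f : Proj I v →ₗ[PathAlgebra V K ⧸ I] T :=
    (LinearMap.toSpanSingleton (PathAlgebra V K ⧸ I) T t) ∘ₗ Submodule.subtype _
  have hf : f (projGen I v) = t := hvt
  have hf0 : f ≠ 0 := by
    intro h
    rw [h] at hf
    exact hv hf.symm
  -- The radical annihilates the simple module, so the kernel contains `J P`. It is no larger
  -- because `P = K e_v + J P` and `f` does not kill `e_v`.
  have hker : LinearMap.ker f = radMod (PathAlgebra V K ⧸ I) (Proj I v) := by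
    have hle : radMod (PathAlgebra V K ⧸ I) (Proj I v) ≤ LinearMap.ker f := by
      intro x hx
      have h := map_mem_smul_top _ f hx
      have h0 : (Ring.jacobson (PathAlgebra V K ⧸ I) • ⊤ : Submodule (PathAlgebra V K ⧸ I) T) = ⊥ := by
        refine eq_bot_iff.2 fun y hy => ?_
        refine Submodule.smul_induction_on (p := fun y => y ∈ (⊥ : Submodule (PathAlgebra V K ⧸ I) T)) hy
          (fun r hr n _ => ?_) (fun _ _ => add_mem)
        have := IsSemisimpleModule.jacobson_le_annihilator (PathAlgebra V K ⧸ I) T hr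
        exact Module.mem_annihilator.1 this n
      rw [h0] at h
      exact h
    refine le_antisymm (fun x hx => ?_) hle
    obtain ⟨c, hc⟩ := exists_sub_smul_mem_radMod hadm x
    have h1 := hle hc
    have h2 : c • projGen I v ∈ LinearMap.ker f := by
      have := (LinearMap.ker f).sub_mem hx h1
      rwa [sub_sub_cancel] at this
    have h3 : c = 0 := by
      by_contra hc0
      have h4 := (LinearMap.ker f).smul_mem (algebraMap K (PathAlgebra V K ⧸ I) c⁻¹) h2
      rw [algebraMap_smul, smul_smul, inv_mul_cancel₀ hc0, one_smul, LinearMap.mem_ker, hf] at h4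
      exact hv h4
    rw [h3, zero_smul, sub_zero] at hc
    exact hc
  exact ⟨v, ⟨((Submodule.quotEquivOfEq _ _ hker).symm.trans
    (f.quotKerEquivOfSurjective (LinearMap.surjective_of_ne_zero hf0))).symm⟩⟩

theorem hasTop_quotient {C : Submodule (PathAlgebra V K ⧸ I) (Proj I v)}
    (hC : C ≤ radMod (PathAlgebra V K ⧸ I) (Proj I v)) :
    HasTop (PathAlgebra V K ⧸ I) (Simple I v) (Proj I v ⧸ C) :=
  ⟨(Submodule.quotEquivOfEq _ _ (map_mkQ_smul_top _ C).symm).trans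
    (Submodule.quotientQuotientEquivQuotient C _ hC)⟩

end Tops

/-! ### A graded module with simple top and its essentially unique generator -/

section GradedFibre

variable {K : Type u} [Field K] {V : Type u} [Quiver.{u} V] [Fintype V]
  {I : Ideal (PathAlgebra V K)} [I.IsTwoSided] {v : V}
  {M : Type u} [AddCommGroup M] [Module K M] [Module (PathAlgebra V K ⧸ I) M]
  [IsScalarTower K (PathAlgebra V K ⧸ I) M] {gr : ℤ → Submodule K M} {pr : ℤ → M →ₗ[K] M} {s : ℤ}

theorem pr_pathClass_smul (hM : IsModuleGrading (lengthGrading I) gr) (hpr : IsGradingProj gr pr)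
    (m : ℤ) (p : QPath V) (x : M) :
    pr m (pathClass I p • x) = pathClass I p • pr (m - p.length) x := by
  obtain ⟨t, ht⟩ := hpr.exists_eq_sum x
  rw [ht, Finset.smul_sum, map_sum, map_sum, Finset.smul_sum]
  refine Finset.sum_congr rfl fun n _ => ?_
  have h := hM.smul_mem _ _ _ (pathClass_mem_lengthGrading p) _ (hpr.mem n x)
  rw [hpr.comp_eq]
  split_ifs with hn
  · rw [show (p.length : ℤ) + n = m by omega] at h
    rw [hpr.self _ _ h, ← hn]
  · rw [smul_zero]
    exact hpr.other _ _ (by omega) _ h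

theorem pr_smul_of_mem (hhom : IsLengthHomogeneous I) (hM : IsModuleGrading (lengthGrading I) gr)
    (hpr : IsGradingProj gr pr) {g : M} (hg : g ∈ gr s) (m : ℤ) (a : PathAlgebra V K ⧸ I) :
    pr m (a • g) = lengthProj hhom (m - s) a • g := by
  refine quotient_induction I
    (motive := fun a => pr m (a • g) = lengthProj hhom (m - s) a • g) a (by simp)
    (fun x y hx hy => by rw [add_smul, map_add, hx, hy, map_add, add_smul]) (fun c p => ?_)
  rw [smul_assoc, (pr m).map_smul, (lengthProj hhom (m - s)).map_smul, smul_assoc,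
    pr_pathClass_smul hM hpr, lengthProj_pathClass]
  split_ifs with h
  · rw [show m - p.length = s by omega, hpr.self _ _ hg]
  · rw [hpr.other _ s (by omega) _ hg, smul_zero, zero_smul]

/-- The module is generated in degree `s` and paths never lower degrees. -/
theorem pr_eq_zero_of_lt (hM : IsModuleGrading (lengthGrading I) gr) (hpr : IsGradingProj gr pr)
    (hs : Submodule.span (PathAlgebra V K ⧸ I) (gr s : Set M) = ⊤) {m : ℤ} (hm : m < s) (x : M) :
    pr m x = 0 := by
  have hx : x ∈ Submodule.span (PathAlgebra V K ⧸ I) (gr s : Set M) := hs ▸ Submodule.mem_top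
  induction hx using Submodule.span_induction generalizing m with
  | mem x hx => exact hpr.other _ _ hm.ne' _ hx
  | zero => exact map_zero _
  | add x y _ _ hx hy => rw [map_add, hx hm, hy hm, add_zero]
  | smul a x _ hx =>
    refine quotient_induction I (motive := fun a => pr m (a • x) = 0) a (by simp)
      (fun y z hy hz => by rw [add_smul, map_add, hy, hz, add_zero]) (fun c p => ?_)
    rw [smul_assoc, map_smul, pr_pathClass_smul hM hpr, hx (by omega), smul_zero, smul_zero]

/-- Paths of positive length raise degrees strictly and nothing lives below `s`, so `J M` has no
component of degree `s`. -/
theorem eq_zero_of_mem_jacobson (hadm : IsAdmissible I)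
    (hM : IsModuleGrading (lengthGrading I) gr) (hpr : IsGradingProj gr pr)
    (hs : Submodule.span (PathAlgebra V K ⧸ I) (gr s : Set M) = ⊤) {g : M} (hg : g ∈ gr s)
    (hJ : g ∈ radMod (PathAlgebra V K ⧸ I) M) : g = 0 := by
  rw [← hpr.self _ _ hg]
  refine Submodule.smul_induction_on (p := fun x => pr s x = 0) hJ (fun a ha x _ => ?_)
    (fun x y hx hy => by rw [map_add, hx, hy, add_zero])
  have ha' : a ∈ Submodule.span K {x | ∃ p : QPath V, 1 ≤ p.length ∧ x = pathClass I p} :=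
    (mem_jacobson_iff hadm).1 ha
  clear ha
  induction ha' using Submodule.span_induction with
  | mem a ha =>
    obtain ⟨p, hp, rfl⟩ := ha
    rw [pr_pathClass_smul hM hpr, pr_eq_zero_of_lt hM hpr hs (by omega), smul_zero]
  | zero => simp
  | add a b ha hb h1 h2 =>
    rw [add_smul, map_add, h1, h2, add_zero]
  | smul c a ha h1 => rw [smul_assoc, map_smul, h1, smul_zero]

/-- A nonzero element of the generating degree of a graded module with simple top generates. -/
theorem generator_facts (hadm : IsAdmissible I) (hM : IsModuleGrading (lengthGrading I) gr)
    (hs : Submodule.span (PathAlgebra V K ⧸ I) (gr s : Set M) = ⊤)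
    (hT : HasTop (PathAlgebra V K ⧸ I) (Simple I v) M) {g : M} (hg : g ∈ gr s) (hg0 : g ≠ 0) :
    idem I v • g = g ∧ (∀ h ∈ gr s, ∃ c : K, h = c • g) ∧
      ∀ x : M, ∃ a : PathAlgebra V K ⧸ I, x = a • g := by
  obtain ⟨pr, hpr⟩ := IsGradingProj.of_isInternal hM.internal
  obtain ⟨e⟩ := hT
  let ψ : M →ₗ[PathAlgebra V K ⧸ I] Simple I v :=
    e.toLinearMap ∘ₗ (radMod (PathAlgebra V K ⧸ I) M).mkQ
  have hψ : ∀ x, ψ x = 0 → x ∈ radMod (PathAlgebra V K ⧸ I) M := fun x hx =>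
    (Submodule.Quotient.mk_eq_zero _).1 ((LinearEquiv.map_eq_zero_iff e).1 hx)
  -- The generating component embeds in the top, which is a line; the remaining claims can be
  -- checked in the top.
  have hz : ∀ x ∈ gr s, ψ x = 0 → x = 0 := fun x hx h =>
    eq_zero_of_mem_jacobson hadm hM hpr hs hx (hψ x h)
  have h2 : ∀ h ∈ gr s, ∃ c : K, h = c • g := by
    intro h hh
    obtain ⟨c, hc⟩ := simple_proportional hadm (fun h0 => hg0 (hz g hg h0)) (ψ h)
    refine ⟨c, sub_eq_zero.1 (hz _ (sub_mem hh (Submodule.smul_mem _ _ hg)) ?_)⟩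
    rw [map_sub, LinearMap.map_smul_of_tower, hc, sub_self]
  refine ⟨?_, h2, fun x => ?_⟩
  · have h1 : idem I v • g ∈ gr s := by
      have := hM.smul_mem _ _ _ (pathClass_mem_lengthGrading (I := I) (QPath.nil v)) _ hg
      rwa [length_nil, Nat.cast_zero, zero_add] at this
    refine sub_eq_zero.1 (hz _ (sub_mem h1 hg) ?_)
    rw [map_sub, map_smul, idem_smul_simple hadm, sub_self]
  · have hx : x ∈ Submodule.span (PathAlgebra V K ⧸ I) {g} := by
      have hle : Submodule.span (PathAlgebra V K ⧸ I) (gr s : Set M) ≤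
          Submodule.span (PathAlgebra V K ⧸ I) {g} := by
        refine Submodule.span_le.2 fun h hh => ?_
        obtain ⟨c, rfl⟩ := h2 h hh
        rw [← algebraMap_smul (PathAlgebra V K ⧸ I) c g]
        exact Submodule.smul_mem _ _ (Submodule.mem_span_singleton_self g)
      exact hle (hs ▸ Submodule.mem_top)
    obtain ⟨a, ha⟩ := Submodule.mem_span_singleton.1 hx
    exact ⟨a, ha.symm⟩

theorem exists_ne_zero_mem (hadm : IsAdmissible I) (hhom : IsLengthHomogeneous I)
    (hs : Submodule.span (PathAlgebra V K ⧸ I) (gr s : Set M) = ⊤)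
    (hT : HasTop (PathAlgebra V K ⧸ I) (Simple I v) M) : ∃ g ∈ gr s, g ≠ 0 := by
  by_contra! h
  obtain ⟨e⟩ := hT
  obtain ⟨x, hx⟩ := simple_nontrivial (v := v) hadm hhom
  have hb : ∀ y : M, y = 0 := by
    intro y
    have hy : y ∈ Submodule.span (PathAlgebra V K ⧸ I) (gr s : Set M) := hs ▸ Submodule.mem_top
    have hle : Submodule.span (PathAlgebra V K ⧸ I) (gr s : Set M) ≤ ⊥ := Submodule.span_le.2 h
    exact hle hy
  obtain ⟨y, rfl⟩ := e.surjective x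
  obtain ⟨y, rfl⟩ := Submodule.mkQ_surjective _ y
  exact hx (by rw [hb y, map_zero, map_zero])

/-- The action on an element `g`, as a map from `Λ e_v`. -/
noncomputable def actOn (v : V) (g : M) : Proj I v →ₗ[PathAlgebra V K ⧸ I] M :=
  (LinearMap.toSpanSingleton (PathAlgebra V K ⧸ I) M g) ∘ₗ Submodule.subtype _

theorem actOn_apply (g : M) (u : Proj I v) : actOn v g u = (u : PathAlgebra V K ⧸ I) • g := rfl

theorem actOn_projGen {g : M} (hg : idem I v • g = g) : actOn v g (projGen I v) = g := hg

theorem actOn_surjective {g : M} (hg : idem I v • g = g)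
    (hgen : ∀ x : M, ∃ a : PathAlgebra V K ⧸ I, x = a • g) :
    Function.Surjective (actOn (I := I) v g) := by
  intro x
  obtain ⟨a, rfl⟩ := hgen x
  exact ⟨a • projGen I v, by rw [map_smul, actOn_projGen hg]⟩

variable {d : ℕ}

/-- The relations of a generator `g` form a point of the graded Grassmannian. -/
theorem ker_actOn_mem (hadm : IsAdmissible I) (hhom : IsLengthHomogeneous I)
    (hM : IsModuleGrading (lengthGrading I) gr)
    (hs : Submodule.span (PathAlgebra V K ⧸ I) (gr s : Set M) = ⊤)
    (hT : HasTop (PathAlgebra V K ⧸ I) (Simple I v) M) (hd : Module.finrank K M = d) {g : M}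
    (hg : g ∈ gr s) (hg0 : g ≠ 0) :
    LinearMap.ker (actOn (I := I) v g) ≤ radMod (PathAlgebra V K ⧸ I) (Proj I v) ∧
      Module.finrank K (Proj I v ⧸ LinearMap.ker (actOn (I := I) v g)) = d ∧
      (LinearMap.ker (actOn (I := I) v g)).restrictScalars K =
        ⨆ m, (LinearMap.ker (actOn (I := I) v g)).restrictScalars K ⊓ projGrading I v m := by
  obtain ⟨pr, hpr⟩ := IsGradingProj.of_isInternal hM.internal
  obtain ⟨hv, -, hgen⟩ := generator_facts hadm hM hs hT hg hg0
  refine ⟨fun u hu => ?_, ?_, ?_⟩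
  -- Write `u = c e_v + j` with `j` in `J P`. Then `u g = 0` puts `c g` into `J M` and into degree
  -- `s`, so `c = 0`.
  · obtain ⟨c, hc⟩ := exists_sub_smul_mem_radMod hadm u
    have h1 := map_mem_smul_top _ (actOn v g) hc
    rw [map_sub, LinearMap.mem_ker.1 hu, LinearMap.map_smul_of_tower, actOn_projGen hv, zero_sub,
      neg_mem_iff] at h1
    have h2 := eq_zero_of_mem_jacobson hadm hM hpr hs (Submodule.smul_mem _ c hg) h1
    rw [(smul_eq_zero.1 h2).resolve_right hg0, zero_smul, sub_zero] at hc
    exact hc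
  · rw [← hd]
    exact (((actOn v g).quotKerEquivOfSurjective
      (actOn_surjective hv hgen)).restrictScalars K).finrank_eq
  · refine (homogeneous_iff (isGradingProj_projProj hhom v) _).2 fun m u hu => ?_
    have h1 : (u : PathAlgebra V K ⧸ I) • g = 0 := hu
    have h2 := pr_smul_of_mem hhom hM hpr hg (m + s) u
    rw [h1, map_zero, add_sub_cancel_right] at h2
    exact h2.symm

/-- The inverse of `u ↦ u g` has degree `-s`, since `g` of degree `s` corresponds to `e_v` of degree
`0`. -/
theorem gradedIsomorphic_ker_actOn (hadm : IsAdmissible I) (hhom : IsLengthHomogeneous I)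
    (hM : IsModuleGrading (lengthGrading I) gr)
    (hs : Submodule.span (PathAlgebra V K ⧸ I) (gr s : Set M) = ⊤)
    (hT : HasTop (PathAlgebra V K ⧸ I) (Simple I v) M) {g : M} (hg : g ∈ gr s) (hg0 : g ≠ 0) :
    GradedIsomorphic (PathAlgebra V K ⧸ I) gr (fun m => (projGrading I v m).map
      ((LinearMap.ker (actOn (I := I) v g)).mkQ.restrictScalars K)) := by
  obtain ⟨pr, hpr⟩ := IsGradingProj.of_isInternal hM.internal
  obtain ⟨hv, -, hgen⟩ := generator_facts hadm hM hs hT hg hg0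
  refine ⟨-s, ((actOn v g).quotKerEquivOfSurjective (actOn_surjective hv hgen)).symm, ?_⟩
  intro m x hx
  obtain ⟨u, rfl⟩ := actOn_surjective hv hgen x
  refine ⟨projProj hhom v (m - s) u, ?_, ?_⟩
  · exact (isGradingProj_projProj hhom v).mem _ _
  · refine ((LinearEquiv.symm_apply_eq _).2 ?_).symm
    have h1 : pr m (actOn v g u) = actOn v g u := hpr.self _ _ hx
    rw [actOn_apply, pr_smul_of_mem hhom hM hpr hg] at h1
    exact h1.symm

/-- A graded isomorphism must carry `g` to a nonzero multiple of the class of `e_v`, whose relations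
are `C`. This gives the uniqueness of classifying maps. -/
theorem eq_ker_actOn (hadm : IsAdmissible I) (hhom : IsLengthHomogeneous I)
    (hM : IsModuleGrading (lengthGrading I) gr)
    (hs : Submodule.span (PathAlgebra V K ⧸ I) (gr s : Set M) = ⊤)
    {g : M} (hg : g ∈ gr s) (hg0 : g ≠ 0)
    (C : GrGrassPoint (PathAlgebra V K ⧸ I) (projGrading I v) d)
    (he : GradedIsomorphic (PathAlgebra V K ⧸ I) gr
      (fun m => (projGrading I v m).map (C.1.mkQ.restrictScalars K))) :
    C.1 = LinearMap.ker (actOn (I := I) v g) := by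
  obtain ⟨pr, hpr⟩ := IsGradingProj.of_isInternal hM.internal
  obtain ⟨t, e, he⟩ := he
  have h1 := he s g hg
  -- Otherwise `e g`, and hence `g`, would lie in the radical. This forces the degree of `e` to be
  -- `-s`.
  have h2 : quotProj hhom C 0 (e g) ≠ 0 := by
    intro h
    have h3 := ((isPathGraded_quot hhom C).mem_jacobson_iff hadm).2 h
    have h4 := map_mem_smul_top _ e.symm.toLinearMap h3
    have h5 : e.symm.toLinearMap (e g) = g := e.symm_apply_apply g
    rw [h5] at h4
    exact hg0 (eq_zero_of_mem_jacobson hadm hM hpr hs hg h4)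
  have h3 : s + t = 0 := by
    by_contra h
    exact h2 ((isGradingProj_quotProj hhom C).other _ _ h _ h1)
  rw [h3] at h1
  obtain ⟨c, hc⟩ : ∃ c : K, e g = c • C.1.mkQ (projGen I v) := by
    obtain ⟨x, hx⟩ := C.1.mkQ_surjective (e g)
    obtain ⟨c, hc⟩ := exists_sub_smul_mem_radMod hadm x
    refine ⟨c, ?_⟩
    have h4 := ((isPathGraded_proj hhom v).mem_jacobson_iff hadm).1 hc
    rw [map_sub, map_smul, projProj_zero_projGen, sub_eq_zero] at h4
    rw [← (isGradingProj_quotProj hhom C).self _ _ h1, ← hx, quotProj_mkQ, h4,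
      LinearMap.map_smul_of_tower]
  have hc0 : c ≠ 0 := by
    rintro rfl
    rw [zero_smul] at hc
    exact h2 (by rw [hc, map_zero])
  ext u
  rw [LinearMap.mem_ker, actOn_apply, ← LinearEquiv.map_eq_zero_iff e, map_smul, hc, smul_comm,
    smul_eq_zero, or_iff_right hc0, ← map_smul, coe_smul_projGen]
  exact (Submodule.Quotient.mk_eq_zero _).symm

end GradedFibre

/-! ### Regularity of kernels in Plücker coordinates -/

section LocalLift

variable {K : Type u} [Field K]

/-- A family of subspaces which are the kernels of a regular family of surjective linear maps has,
locally, regular Plücker coordinates. -/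
theorem exists_reg_plucker {X : FunctionSpace K} (hX : X.HasInverses) {P W : Type u}
    [AddCommGroup P] [Module K P] [AddCommGroup W] [Module K W] [FiniteDimensional K W] {k d : ℕ}
    (ι : W →ₗ[K] P) (hι : Function.Injective ι) {U : Set X} (hU : IsOpen U)
    (Φ : X → P →ₗ[K] (Fin d → K)) (hΦ : ∀ u i, X.Reg U (fun x => Φ x u i))
    (hsurj : ∀ x ∈ U, Function.Surjective (Φ x)) (y : X → GrassmannianPoint K W k)
    (hy : ∀ x ∈ U, (y x).1.map ι = LinearMap.ker (Φ x)) {x₀ : X} (hx₀ : x₀ ∈ U) :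
    ∃ U' : Set X, x₀ ∈ U' ∧ IsOpen U' ∧ ∃ h' : (Fin k ↪o Fin (Module.finrank K W)) → X → K,
      (∀ t, X.Reg U' (h' t)) ∧ ∀ x ∈ U', ∃ c : K, c ≠ 0 ∧ plucker (y x) = c • fun t => h' t x := by
  classical
  obtain ⟨r, hr⟩ := ι.exists_leftInverse_of_injective (LinearMap.ker_eq_bot.2 hι)
  have hr' : ∀ w, r (ι w) = w := fun w => LinearMap.congr_fun hr w
  -- Preimages of the standard basis at `x₀`, kept fixed as `x` varies; the matrix `M x` of their
  -- images is the identity at `x₀`.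
  choose u hu using fun i : Fin d => hsurj x₀ hx₀ (Pi.single i 1)
  set b := Module.finBasis K W
  set w : Fin k → P := fun j => ι (grassBasis (y x₀) j) with hw
  set M : X → Matrix (Fin d) (Fin d) K := fun x => Matrix.of fun i j => Φ x (u j) i with hM
  -- Cramer's rule without division: a basis vector `w j` of the kernel at `x₀` is corrected so that
  -- it lies in the kernel at every `x`. The entries are regular, and at `x₀` nothing changes.
  set c : X → Fin k → P := fun x j =>
    (M x).det • w j - ∑ i, (M x).cramer (Φ x (w j)) i • u i with hc
  have hdet : X.Reg U (fun x => (M x).det) := reg_det hU fun i j => hΦ (u j) i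
  have hcr : ∀ j i, X.Reg U (fun x => (M x).cramer (Φ x (w j)) i) := by
    intro j i
    simp only [Matrix.cramer_apply]
    refine reg_det hU fun a b' => ?_
    by_cases hb : b' = i
    · simpa [Matrix.updateCol_apply, hb] using hΦ (w j) a
    · simpa [Matrix.updateCol_apply, hb, hM] using hΦ (u b') a
  have hker : ∀ x j, Φ x (c x j) = 0 := by
    intro x j
    have h1 : ∀ a : Fin d → K, Φ x (∑ i, a i • u i) = (M x).mulVec a := by
      intro a
      rw [map_sum]
      funext i
      simp [Matrix.mulVec, dotProduct, hM, mul_comm]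
    rw [hc]
    simp only
    rw [map_sub, h1, Matrix.mulVec_cramer, map_smul, sub_self]
  have hmem : ∀ x ∈ U, ∀ j, r (c x j) ∈ (y x).1 := by
    intro x hx j
    have : c x j ∈ (y x).1.map ι := by
      rw [hy x hx]
      exact hker x j
    obtain ⟨z, hz, hzc⟩ := this
    rw [← hzc, hr']
    exact hz
  have hminor : ∀ t : Fin k ↪o Fin (Module.finrank K W),
      X.Reg U (fun x => minorAlt b t (fun j => r (c x j))) := by
    intro t
    simp only [minorAlt_apply]
    refine reg_det hU fun j i => ?_
    have : (fun x => Matrix.of (fun j i => b.repr (r (c x j)) (t i)) j i) = fun x =>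
        (M x).det * b.repr (r (w j)) (t i) -
          ∑ l, (M x).cramer (Φ x (w j)) l * b.repr (r (u l)) (t i) := by
      funext x
      simp [hc, map_sub, map_sum]
    rw [this]
    refine reg_sub (X.reg_mul hdet (X.reg_const _ hU)) (reg_sum hU _ fun l _ => ?_)
    exact X.reg_mul (hcr j l) (X.reg_const _ hU)
  have hone : M x₀ = 1 := by
    ext i j
    simp [hM, hu, Matrix.one_apply, Pi.single_apply]
  have hc₀ : ∀ j, r (c x₀ j) = grassBasis (y x₀) j := by
    intro j
    have h1 : Φ x₀ (w j) = 0 := by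
      have : w j ∈ LinearMap.ker (Φ x₀) := by
        rw [← hy x₀ hx₀]
        refine ⟨_, ?_, rfl⟩
        rw [← span_grassBasis]
        exact Submodule.subset_span ⟨j, rfl⟩
      exact this
    simp only [hc, h1, hone, map_zero, Matrix.det_one, one_smul, Pi.zero_apply, zero_smul,
      Finset.sum_const_zero, sub_zero]
    exact hr' _
  obtain ⟨t₀, ht₀⟩ := exists_minorAlt_ne_zero b (linearIndependent_grassBasis (y x₀))
  have hopen := (hX U _ (hminor t₀)).1
  refine ⟨{x | x ∈ U ∧ minorAlt b t₀ (fun j => r (c x j)) ≠ 0}, ⟨hx₀, ?_⟩, hopen,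
    fun t x => minorAlt b t (fun j => r (c x j)),
    fun t => X.reg_res (hminor t) hopen fun x hx => hx.1, ?_⟩
  · simp only [hc₀]
    exact ht₀
  · rintro x ⟨hx, hx0⟩
    have hli : LinearIndependent K (fun j => r (c x j)) := by
      by_contra h
      exact hx0 ((minorAlt b t₀).map_linearDependent _ h)
    have hspan : Submodule.span K (Set.range fun j => r (c x j)) = (y x).1 := by
      refine Submodule.eq_of_le_of_finrank_eq (Submodule.span_le.2 ?_) ?_
      · rintro _ ⟨j, rfl⟩
        exact hmem x hx j
      · rw [finrank_span_eq_card hli, (y x).2, Fintype.card_fin]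
    obtain ⟨a, ha, h⟩ := exists_plucker_eq_mul (y x) hli hspan
    exact ⟨a, ha, funext h⟩

end LocalLift

/-! ### The classifying morphism of a family -/

section ClassifyingMap

variable {K : Type u} [Field K] {V : Type u} [Quiver.{u} V] [Fintype V]
  {I : Ideal (PathAlgebra V K)} [I.IsTwoSided] {v : V} {d : ℕ}

/-- A family only provides regularity of the action on frame vectors; this formula extends it to
other sections. -/
theorem coord_smul_eq_sum {A : Type u} [Ring A] [Algebra K A] {X : Type u} (D : FamilyData K A X d)
    (c : LocalTriv (K := K) D.fibre d) {x : X} (hx : x ∈ c.dom) (a : A) (e : D.fibre x) (i : Fin d) :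
    c.coord x (a • e) i = ∑ m, c.coord x e m * c.coord x (a • c.frame m x) i := by
  have hcoord : ∀ e, c.coord x e = c.triv x hx e := fun e => dif_pos hx
  have hframe : ∀ m, c.triv x hx (c.frame m x) = Pi.single m 1 := by
    intro m
    rw [LocalTriv.frame, dif_pos hx, LinearEquiv.apply_symm_apply]
  conv_lhs => rw [eq_sum_of_equiv_single (c.triv x hx) hframe e]
  simp only [hcoord]
  rw [Finset.smul_sum, map_sum, Finset.sum_apply]
  refine Finset.sum_congr rfl fun m _ => ?_
  rw [smul_comm, map_smul]
  rfl

theorem finrank_fibre {A : Type u} [Ring A] [Algebra K A] {X : FunctionSpace K}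
    {𝒜 : ℤ → Submodule K A} {D : FamilyData K A X d} (hD : D.IsFamily 𝒜) (x : X) :
    Module.finrank K (D.fibre x) = d := by
  obtain ⟨c, -, hx⟩ := hD.atlas_cover x
  rw [(c.triv x hx).finrank_eq, Module.finrank_fin_fun]

theorem ker_actOn_smul {M : Type u} [AddCommGroup M] [Module K M] [Module (PathAlgebra V K ⧸ I) M]
    [IsScalarTower K (PathAlgebra V K ⧸ I) M] (g : M) {c : K} (hc : c ≠ 0) :
    LinearMap.ker (actOn (I := I) v (c • g)) = LinearMap.ker (actOn (I := I) v g) := by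
  ext u
  rw [LinearMap.mem_ker, LinearMap.mem_ker, actOn_apply, actOn_apply, smul_comm, smul_eq_zero,
    or_iff_right hc]

variable [FiniteDimensional K (PathAlgebra V K ⧸ I)]

/-- The map which sends the base points of a family to the relations of a generator of the fibre is
a morphism. -/
theorem isMor_of_ker_actOn (hadm : IsAdmissible I) {X : FunctionSpace K} (hX : X.HasInverses)
    {D : FamilyData K (PathAlgebra V K ⧸ I) X d} (hD : D.IsFamily (lengthGrading I))
    (hT : ∀ x, HasTop (PathAlgebra V K ⧸ I) (Simple I v) (D.fibre x)) {s : ℤ}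
    (hs : ∀ x, Submodule.span (PathAlgebra V K ⧸ I) (D.gr x s : Set (D.fibre x)) = ⊤)
    {g : ∀ x, D.fibre x} (hg : ∀ x, g x ∈ D.gr x s) (hg0 : ∀ x, g x ≠ 0)
    (τ : X → grGrassTop I v d)
    (hτ : ∀ x, (τ x).1 = LinearMap.ker (actOn (I := I) v (g x))) : IsMor X (grGrassTop I v d) τ := by
  classical
  refine isMor_to_induced (Z := grassmannian K (radMod (PathAlgebra V K ⧸ I) (Proj I v))
    (Module.finrank K (Proj I v) - d)) _ (isMor_to_homogeneousSpace hX fun x₀ => ?_)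
  obtain ⟨c, hc, hx₀, S, hS⟩ := hD.subbundle s x₀
  obtain ⟨c₀, hc₀, hx₀'⟩ := hD.atlas_cover x₀
  -- The component of degree `s` is nonzero at `x₀`, so some frame vector of the trivialization lies
  -- in it. That vector is a nowhere vanishing local section consisting of generators.
  obtain ⟨j, hjS⟩ : ∃ j, j ∈ S := by
    by_contra! h
    apply hg0 x₀
    have h1 : c.triv x₀ hx₀ (g x₀) = 0 := by
      funext i
      have h2 := (hS x₀ hx₀ (g x₀)).1 (hg x₀) i (h i)
      rwa [LocalTriv.coord, dif_pos hx₀] at h2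
    exact (LinearEquiv.map_eq_zero_iff _).1 h1
  have hframe : ∀ x (hx : x ∈ c.dom), c.triv x hx (c.frame j x) = Pi.single j 1 := by
    intro x hx
    rw [LocalTriv.frame, dif_pos hx, LinearEquiv.apply_symm_apply]
  have hmem : ∀ x ∈ c.dom, c.frame j x ∈ D.gr x s := by
    intro x hx
    refine (hS x hx _).2 fun i hi => ?_
    rw [LocalTriv.coord, dif_pos hx, hframe, Pi.single_apply, if_neg]
    rintro rfl
    exact hi hjS
  have hne : ∀ x ∈ c.dom, c.frame j x ≠ 0 := by
    intro x hx h
    have := hframe x hx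
    rw [h, map_zero] at this
    simpa using congrFun this j
  -- Coordinates are taken in a chart `c₀` of the atlas, where the action is known to be regular,
  -- while the section comes from the trivialization `c` adapted to the grading.
  set Φ : X → Proj I v →ₗ[K] (Fin d → K) := fun x =>
    if h : x ∈ c₀.dom then (c₀.triv x h).toLinearMap ∘ₗ (actOn (I := I) v (c.frame j x)).restrictScalars K
    else 0 with hΦ
  have hΦc : ∀ x ∈ c₀.dom, ∀ u : Proj I v,
      Φ x u = c₀.coord x ((u : PathAlgebra V K ⧸ I) • c.frame j x) := by
    intro x hx u
    rw [hΦ, LocalTriv.coord, dif_pos hx]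
    simp only [dif_pos hx]
    rfl
  have hU : IsOpen (c.dom ∩ c₀.dom) := hc.1.inter (hD.atlas_compat c₀ hc₀).1
  refine exists_reg_plucker hX ((radMod (PathAlgebra V K ⧸ I) (Proj I v)).subtype.restrictScalars K)
    Subtype.val_injective hU Φ ?_ ?_ (fun x => (τ x).toGrassmannian) ?_ ⟨hx₀, hx₀'⟩
  · intro u i
    refine X.reg_congr (f := fun x => ∑ m, c₀.coord x (c.frame j x) m *
      c₀.coord x ((u : PathAlgebra V K ⧸ I) • c₀.frame m x) i) (reg_sum hU _ fun m _ => ?_) ?_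
    · exact X.reg_mul ((hc.2 c₀ hc₀).1 m j)
        (X.reg_res (hD.smul_regular _ c₀ hc₀ i m) hU Set.inter_subset_right)
    · intro x hx
      rw [hΦc x hx.2, coord_smul_eq_sum D c₀ hx.2]
  · intro x hx
    obtain ⟨hv, -, hgen⟩ := generator_facts hadm (hD.grading x) (hs x) (hT x) (hmem x hx.1)
      (hne x hx.1)
    simp only [hΦ, dif_pos hx.2]
    exact (c₀.triv x hx.2).surjective.comp (actOn_surjective hv hgen)
  · intro x hx
    refine (map_toGrassmannian (τ x)).trans ?_
    -- The generators `g x` were chosen without any regularity, but the local section is a nonzero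
    -- multiple of them and has the same relations.
    obtain ⟨-, hprop, -⟩ := generator_facts hadm (hD.grading x) (hs x) (hT x) (hg x) (hg0 x)
    obtain ⟨a, ha⟩ := hprop _ (hmem x hx.1)
    have ha0 : a ≠ 0 := by
      rintro rfl
      exact hne x hx.1 (by rw [ha, zero_smul])
    have h1 := hτ x
    rw [← ker_actOn_smul (v := v) (g x) ha0, ← ha] at h1
    rw [h1]
    ext u
    simp only [hΦ, dif_pos hx.2]
    refine Iff.trans ?_ (LinearEquiv.map_eq_zero_iff (c₀.triv x hx.2)).symm
    rfl

/-- Every family of graded modules with top `Λ e_v / J e_v` is induced by a unique morphism to the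
graded Grassmannian. -/
theorem existsUnique_morphism (hadm : IsAdmissible I) (hhom : IsLengthHomogeneous I)
    {X : FunctionSpace K} (hX : X.HasInverses)
    {D : FamilyData K (PathAlgebra V K ⧸ I) X d} (hD : D.IsFamily (lengthGrading I))
    (hT : ∀ x, HasTop (PathAlgebra V K ⧸ I) (Simple I v) (D.fibre x)) :
    ∃! τ : Morphism X (grGrassTop I v d),
      D.Equivalent ((canonicalFamily I v d).pullback τ.toFun) := by
  obtain ⟨s, hs⟩ := hD.generated
  choose g hg hg0 using fun x => exists_ne_zero_mem hadm hhom (hs x) (hT x)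
  let τ : X → grGrassTop I v d := fun x => ⟨LinearMap.ker (actOn (I := I) v (g x)),
    ker_actOn_mem hadm hhom (hD.grading x) (hs x) (hT x) (finrank_fibre hD x) (hg x) (hg0 x)⟩
  have hτ : IsMor X (grGrassTop I v d) τ :=
    isMor_of_ker_actOn hadm hX hD hT hs hg hg0 τ fun x => rfl
  refine ⟨hτ.toMorphism, fun x => ?_, fun τ' hτ' => ?_⟩
  · exact gradedIsomorphic_ker_actOn hadm hhom (hD.grading x) (hs x) (hT x) (hg x) (hg0 x)
  · refine Morphism.ext (funext fun x => Subtype.ext ?_)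
    exact eq_ker_actOn hadm hhom (hD.grading x) (hs x) (hg x) (hg0 x) (τ'.toFun x) (hτ' x)

end ClassifyingMap

/-! ### Comparing radical layers -/

section RadicalLayers

variable {K : Type u} [Field K] {V : Type u} [Quiver.{u} V] [Fintype V]
  {I : Ideal (PathAlgebra V K)} [I.IsTwoSided]
  {M M' : Type u} [AddCommGroup M] [Module K M] [Module (PathAlgebra V K ⧸ I) M]
  [IsScalarTower K (PathAlgebra V K ⧸ I) M] [AddCommGroup M'] [Module K M']
  [Module (PathAlgebra V K ⧸ I) M'] [IsScalarTower K (PathAlgebra V K ⧸ I) M']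

/-- A linear map which commutes with the vertex idempotents and respects the radical filtrations
induces homomorphisms between the radical layers. -/
theorem exists_radLayer_map (hadm : IsAdmissible I) (φ : M →ₗ[K] M')
    (hφ : ∀ w x, φ (idem I w • x) = idem I w • φ x)
    (hJ : ∀ (l : ℕ), ∀ x ∈ (Ring.jacobson (PathAlgebra V K ⧸ I) ^ l • ⊤ :
      Submodule (PathAlgebra V K ⧸ I) M), φ x ∈ (Ring.jacobson (PathAlgebra V K ⧸ I) ^ l • ⊤ :
        Submodule (PathAlgebra V K ⧸ I) M')) (l : ℕ) :
    ∃ F : RadLayer (PathAlgebra V K ⧸ I) M l →ₗ[PathAlgebra V K ⧸ I]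
      RadLayer (PathAlgebra V K ⧸ I) M' l,
      ∀ x hx, F (Submodule.mkQ _ ⟨x, hx⟩) = Submodule.mkQ _ ⟨φ x, hJ l x hx⟩ := by
  -- Modulo the radical, `a` is a combination of vertex idempotents, with which `φ` commutes; the
  -- remainder lands in the next power of the radical.
  have hdiff : ∀ (a : PathAlgebra V K ⧸ I) (x : M), x ∈ (Ring.jacobson (PathAlgebra V K ⧸ I) ^ l • ⊤ :
      Submodule (PathAlgebra V K ⧸ I) M) → φ (a • x) - a • φ x ∈
        (Ring.jacobson (PathAlgebra V K ⧸ I) ^ (l + 1) • ⊤ :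
          Submodule (PathAlgebra V K ⧸ I) M') := by
    intro a x hx
    obtain ⟨c, hc⟩ := exists_eq_sum_idem a
    have hj := pathSpan_one_le_jacobson hadm hc
    set e := ∑ v, c v • idem I v with he
    have h1 : φ (e • x) = e • φ x := by
      rw [he, Finset.sum_smul, Finset.sum_smul, map_sum]
      refine Finset.sum_congr rfl fun w _ => ?_
      rw [smul_assoc, φ.map_smul, hφ, smul_assoc]
    have h2 : φ (a • x) - a • φ x = φ ((a - e) • x) - (a - e) • φ x := by
      rw [sub_smul, sub_smul, map_sub, h1]
      abel
    rw [h2]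
    refine sub_mem (hJ (l + 1) _ ?_) ?_
    · rw [ideal_pow_succ_smul]
      exact Submodule.smul_mem_smul hj hx
    · rw [ideal_pow_succ_smul]
      exact Submodule.smul_mem_smul hj (hJ l x hx)
  let G : ↥(Ring.jacobson (PathAlgebra V K ⧸ I) ^ l • ⊤ : Submodule (PathAlgebra V K ⧸ I) M)
      →ₗ[PathAlgebra V K ⧸ I] RadLayer (PathAlgebra V K ⧸ I) M' l :=
    { toFun := fun x => Submodule.mkQ _ ⟨φ x, hJ l x x.2⟩
      map_add' := fun x y => by
        rw [← map_add]
        exact congrArg _ (Subtype.ext (map_add φ _ _))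
      map_smul' := fun a x => by
        rw [RingHom.id_apply, ← map_smul]
        exact (Submodule.Quotient.eq _).2 (hdiff a x x.2) }
  refine ⟨Submodule.liftQ _ G fun x hx => ?_, fun x hx => rfl⟩
  exact (Submodule.Quotient.mk_eq_zero _).2 (hJ (l + 1) x hx)

theorem nonempty_radLayer_equiv (hadm : IsAdmissible I) (φ : M ≃ₗ[K] M')
    (hφ : ∀ w x, φ (idem I w • x) = idem I w • φ x)
    (hJ : ∀ (l : ℕ) x, φ x ∈ (Ring.jacobson (PathAlgebra V K ⧸ I) ^ l • ⊤ :
      Submodule (PathAlgebra V K ⧸ I) M') ↔ x ∈ (Ring.jacobson (PathAlgebra V K ⧸ I) ^ l • ⊤ :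
        Submodule (PathAlgebra V K ⧸ I) M)) (l : ℕ) :
    Nonempty (RadLayer (PathAlgebra V K ⧸ I) M l ≃ₗ[PathAlgebra V K ⧸ I]
      RadLayer (PathAlgebra V K ⧸ I) M' l) := by
  obtain ⟨F, hF⟩ := exists_radLayer_map hadm φ.toLinearMap hφ (fun l x hx => (hJ l x).2 hx) l
  obtain ⟨G, hG⟩ := exists_radLayer_map hadm φ.symm.toLinearMap
    (fun w x => by
      refine (LinearEquiv.symm_apply_eq φ).2 ?_
      rw [hφ]
      exact congrArg _ (φ.apply_symm_apply x).symm)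
    (fun l x hx => (hJ l _).1 (by
      have : φ (φ.symm.toLinearMap x) = x := φ.apply_symm_apply x
      rwa [this])) l
  refine ⟨LinearEquiv.ofLinearMap F G ?_ ?_⟩
  · refine LinearMap.ext fun y => ?_
    obtain ⟨⟨y, hy⟩, rfl⟩ := Submodule.mkQ_surjective _ y
    rw [LinearMap.comp_apply, hG, hF]
    exact congrArg _ (Subtype.ext (φ.apply_symm_apply y))
  · refine LinearMap.ext fun y => ?_
    obtain ⟨⟨y, hy⟩, rfl⟩ := Submodule.mkQ_surjective _ y
    rw [LinearMap.comp_apply, hF, hG]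
    exact congrArg _ (Subtype.ext (φ.symm_apply_apply y))

theorem nonempty_radLayer_equiv_of_equiv (hadm : IsAdmissible I)
    (e : M ≃ₗ[PathAlgebra V K ⧸ I] M') (l : ℕ) :
    Nonempty (RadLayer (PathAlgebra V K ⧸ I) M l ≃ₗ[PathAlgebra V K ⧸ I]
      RadLayer (PathAlgebra V K ⧸ I) M' l) := by
  refine nonempty_radLayer_equiv hadm (e.restrictScalars K) (fun w x => e.map_smul _ x)
    (fun l x => ⟨fun h => ?_, fun h => map_mem_smul_top _ e.toLinearMap h⟩) l
  have h1 := map_mem_smul_top _ e.symm.toLinearMap h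
  have h2 : e.symm.toLinearMap (e.restrictScalars K x) = x := e.symm_apply_apply x
  rwa [h2] at h1

theorem HasRadicalLayering.congr {L : ℕ} {S : Fin (L + 1) → Type u} [∀ l, AddCommGroup (S l)]
    [∀ l, Module (PathAlgebra V K ⧸ I) (S l)]
    (h : HasRadicalLayering (PathAlgebra V K ⧸ I) S M)
    (hM : ∀ l : ℕ, Nonempty (RadLayer (PathAlgebra V K ⧸ I) M l ≃ₗ[PathAlgebra V K ⧸ I]
      RadLayer (PathAlgebra V K ⧸ I) M' l)) :
    HasRadicalLayering (PathAlgebra V K ⧸ I) S M' := fun l =>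
  let ⟨e⟩ := h l
  let ⟨f⟩ := hM l
  ⟨f.symm.trans e⟩

/-- The zeroth radical layer is the top. -/
theorem HasRadicalLayering.hasTop {A : Type u} [Ring A] {N : Type u} [AddCommGroup N] [Module A N]
    {L : ℕ} {S : Fin (L + 1) → Type u} [∀ l, AddCommGroup (S l)] [∀ l, Module A (S l)]
    (h : HasRadicalLayering A S N) : HasTop A (S 0) N := by
  obtain ⟨e⟩ := h 0
  let f : ↥(Ring.jacobson A ^ 0 • ⊤ : Submodule A N) →ₗ[A] N ⧸ (Ring.jacobson A • ⊤ : Submodule A N) :=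
    (Ring.jacobson A • ⊤ : Submodule A N).mkQ ∘ₗ Submodule.subtype _
  have hf : Function.Surjective f := by
    intro y
    obtain ⟨y, rfl⟩ := Submodule.mkQ_surjective _ y
    exact ⟨⟨y, by rw [ideal_pow_zero_smul]; trivial⟩, rfl⟩
  have hk : (Ring.jacobson A ^ (0 + 1) • ⊤ : Submodule A N).submoduleOf
      (Ring.jacobson A ^ 0 • ⊤ : Submodule A N) = LinearMap.ker f := by
    ext x
    rw [zero_add, Submodule.pow_one]
    exact (Submodule.Quotient.mk_eq_zero (Ring.jacobson A • ⊤ : Submodule A N) (x := x.1)).symm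
  exact ⟨((Submodule.quotEquivOfEq _ _ hk).trans (f.quotKerEquivOfSurjective hf)).symm.trans e⟩

theorem HasTop.trans {A : Type u} [Ring A] {N T T' : Type u} [AddCommGroup N] [Module A N]
    [AddCommGroup T] [Module A T] [AddCommGroup T'] [Module A T'] (h : HasTop A T N)
    (e : T ≃ₗ[A] T') : HasTop A T' N :=
  let ⟨f⟩ := h
  ⟨f.trans e⟩

variable {z : M} {z' : M'} {pr : ℤ → M →ₗ[K] M} {pr' : ℤ → M' →ₗ[K] M'} {v : V} {d : ℕ}
  {p : Fin d → QPath V}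

/-- The radical layers of a graded module only depend on its skeletons. -/
theorem nonempty_radLayer_equiv_of_basis (hadm : IsAdmissible I) (hz : IsPathGraded I z pr)
    (hz' : IsPathGraded I z' pr')
    (hli : LinearIndependent K fun i => pathClass I (p i) • z)
    (hsp : Submodule.span K (Set.range fun i => pathClass I (p i) • z) = ⊤)
    (hli' : LinearIndependent K fun i => pathClass I (p i) • z')
    (hsp' : Submodule.span K (Set.range fun i => pathClass I (p i) • z') = ⊤) (l : ℕ) :
    Nonempty (RadLayer (PathAlgebra V K ⧸ I) M l ≃ₗ[PathAlgebra V K ⧸ I]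
      RadLayer (PathAlgebra V K ⧸ I) M' l) := by
  classical
  let b := Module.Basis.mk hli hsp.ge
  let b' := Module.Basis.mk hli' hsp'.ge
  -- `φ` matches the basis `p z` with the basis `p z'`. It need not be a module homomorphism, but it
  -- preserves degrees and end vertices of paths, which suffices on the radical layers.
  let φ : M ≃ₗ[K] M' := b.equiv b' (Equiv.refl _)
  have hφb : ∀ i, φ (pathClass I (p i) • z) = pathClass I (p i) • z' := by
    intro i
    have := b.equiv_apply i b' (Equiv.refl _)
    rwa [Module.Basis.mk_apply, Equiv.refl_apply, Module.Basis.mk_apply] at this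
  have hsum : ∀ a : Fin d → K, φ (∑ i, a i • pathClass I (p i) • z) =
      ∑ i, a i • pathClass I (p i) • z' := by
    intro a
    rw [map_sum]
    exact Finset.sum_congr rfl fun i _ => by rw [map_smul, hφb]
  have hrepr : ∀ x : M, ∃ a : Fin d → K, x = ∑ i, a i • pathClass I (p i) • z := by
    intro x
    refine ⟨b.repr x, ?_⟩
    conv_lhs => rw [← b.sum_repr x]
    exact Finset.sum_congr rfl fun i _ => by rw [Module.Basis.mk_apply]
  have hpr : ∀ m x, φ (pr m x) = pr' m (φ x) := by
    intro m x
    obtain ⟨a, rfl⟩ := hrepr x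
    rw [hz.pr_sum_path, hsum, hsum, hz'.pr_sum_path]
  refine nonempty_radLayer_equiv hadm φ (fun w x => ?_) (fun l x => ?_) l
  · obtain ⟨a, rfl⟩ := hrepr x
    rw [hsum, Finset.smul_sum, Finset.smul_sum, map_sum]
    refine Finset.sum_congr rfl fun i _ => ?_
    rw [smul_comm, smul_comm (idem I w) (a i), map_smul, ← mul_smul, ← mul_smul,
      idem_mul_pathClass]
    split_ifs
    · rw [hφb]
    · rw [zero_smul, zero_smul, map_zero]
  · rw [hz'.mem_jacobson_pow_iff hadm, hz.mem_jacobson_pow_iff hadm]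
    refine forall_congr' fun m => imp_congr_right fun _ => ?_
    rw [← hpr, LinearEquiv.map_eq_zero_iff]

end RadicalLayers

/-! ### The locus of a radical layering and the two moduli statements -/

section LayeringLocus

variable {K : Type u} [Field K] {V : Type u} [Quiver.{u} V] [Fintype V]
  {I : Ideal (PathAlgebra V K)} [I.IsTwoSided] [FiniteDimensional K (PathAlgebra V K ⧸ I)]
  {L : ℕ} (S : Fin (L + 1) → Type u) [∀ l, AddCommGroup (S l)]
  [∀ l, Module (PathAlgebra V K ⧸ I) (S l)]

/-- The radical layering is locally constant, and so its level sets are closed. -/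
theorem isClosed_layeringLocus (hadm : IsAdmissible I) (hhom : IsLengthHomogeneous I) (v : V)
    (d : ℕ) : IsClosed (layeringLocus I S v d) := by
  rw [← isOpen_compl_iff, isOpen_iff_forall_mem_open]
  intro C hC
  obtain ⟨p, hp, hσ, hs⟩ := exists_hasSkeleton hadm hhom C
  obtain ⟨c, hc, hdom, -⟩ := exists_mem_atlas hadm hhom hp hσ
  -- All points of a skeleton chart share their radical layers, so a chart around a point outside
  -- the locus misses the locus.
  refine ⟨c.dom, fun C' hC' hl => hC ?_,
    ((isFamily_canonicalFamily hadm hhom v d).atlas_compat c hc).1, (Set.ext_iff.1 hdom C).2 hs⟩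
  have hs' : HasSkeleton I v p C'.1 := (Set.ext_iff.1 hdom C').1 hC'
  obtain ⟨h1, h2⟩ := ((isPathGraded_quot hhom C).hasSkeleton_iff hadm p).1 hs
  obtain ⟨h1', h2'⟩ := ((isPathGraded_quot hhom C').hasSkeleton_iff hadm p).1 hs'
  exact HasRadicalLayering.congr (M := Proj I v ⧸ C'.1) hl (nonempty_radLayer_equiv_of_basis hadm
    (isPathGraded_quot hhom C') (isPathGraded_quot hhom C) h1' h2' h1 h2)

theorem isFineModuliSpace_grGrassTop (hadm : IsAdmissible I) (hhom : IsLengthHomogeneous I)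
    {T : Type u} [AddCommGroup T] [Module (PathAlgebra V K ⧸ I) T] {v : V}
    (e : T ≃ₗ[PathAlgebra V K ⧸ I] Simple I v) (d : ℕ) :
    IsFineModuliSpace (lengthGrading I) (fun M => HasTop (PathAlgebra V K ⧸ I) T M)
      (grGrassTop I v d) (canonicalFamily I v d) where
  isVariety := (isProjectiveVariety_grGrassTop hadm hhom v d).isVariety
  isFamily := isFamily_canonicalFamily hadm hhom v d
  mem_class C := (hasTop_quotient C.2.1).trans e.symm
  universal _ hX _ hD hT :=
    existsUnique_morphism hadm hhom hX.hasInverses hD fun x => (hT x).trans e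

/-- The layer `S 0` is the top, so the family already has a unique morphism to the whole graded
Grassmannian. It lands in the locus because each fibre is isomorphic to the quotient that classifies
it. -/
theorem isFineModuliSpace_grGrassLayering (hadm : IsAdmissible I) (hhom : IsLengthHomogeneous I)
    {v : V} (e : S 0 ≃ₗ[PathAlgebra V K ⧸ I] Simple I v) (d : ℕ) :
    IsFineModuliSpace (lengthGrading I)
      (fun M => HasRadicalLayering (PathAlgebra V K ⧸ I) S M)
      (grGrassLayering I S v d) (canonicalFamilyLayering I S v d) where
  isVariety := ((isProjectiveVariety_grGrassTop hadm hhom v d).sub_of_isClosed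
    (isClosed_layeringLocus S hadm hhom v d)).isVariety
  isFamily := (isFamily_canonicalFamily hadm hhom v d).pullback (isMor_sub_val _ _)
  mem_class C := C.2
  universal X hX D hD hS := by
    obtain ⟨τ, hτ, huniq⟩ := existsUnique_morphism hadm hhom hX.hasInverses hD
      fun x => ((hS x).hasTop).trans e
    have hmem : ∀ x, τ.toFun x ∈ layeringLocus I S v d := by
      intro x
      obtain ⟨_, f, -⟩ := hτ x
      exact (hS x).congr (nonempty_radLayer_equiv_of_equiv hadm f)
    refine ⟨(isMor_to_sub τ.isMor hmem).toMorphism, hτ, fun σ hσ => ?_⟩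
    have h := huniq ((isMor_sub_val _ _).comp σ.isMor).toMorphism hσ
    refine Morphism.ext (funext fun x => Subtype.ext ?_)
    exact congrFun (congrArg Morphism.toFun h) x

end LayeringLocus

end GradedModuli

open GradedModuli in
theorem theorem4p2
    {K : Type u} [Field K] [IsAlgClosed K]
    {V : Type u} [Quiver.{u} V] [Fintype V] [∀ a b : V, Finite (a ⟶ b)]
    (I : Ideal (PathAlgebra V K)) [I.IsTwoSided]
    (hadm : IsAdmissible I) (hhom : IsLengthHomogeneous I)
    [FiniteDimensional K (PathAlgebra V K ⧸ I)]
    (T : Type u) [AddCommGroup T] [Module (PathAlgebra V K ⧸ I) T]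
    [IsSimpleModule (PathAlgebra V K ⧸ I) T] :
    ∃ v : V, Nonempty (T ≃ₗ[PathAlgebra V K ⧸ I] Simple I v) ∧
      (∀ d : ℕ,
        IsFineModuliSpace (lengthGrading I) (fun M => HasTop (PathAlgebra V K ⧸ I) T M)
          (grGrassTop I v d) (canonicalFamily I v d) ∧
        IsProjectiveVariety (grGrassTop I v d)) ∧
      (∀ (L : ℕ), IsGreatest {l | Ring.jacobson (PathAlgebra V K ⧸ I) ^ l ≠ ⊥} L →
        ∀ (S : Fin (L + 1) → Type u) [∀ l, AddCommGroup (S l)] [∀ l, Module K (S l)]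
          [∀ l, Module (PathAlgebra V K ⧸ I) (S l)]
          [∀ l, IsScalarTower K (PathAlgebra V K ⧸ I) (S l)] (d : ℕ),
          IsSemisimpleSequence I S v T d →
          IsFineModuliSpace (lengthGrading I)
            (fun M => HasRadicalLayering (PathAlgebra V K ⧸ I) S M)
            (grGrassLayering I S v d) (canonicalFamilyLayering I S v d) ∧
          IsProjectiveVariety (grGrassLayering I S v d)) := by
  obtain ⟨v, ⟨e⟩⟩ := exists_equiv_simple hadm T
  refine ⟨v, ⟨e⟩, fun d => ⟨isFineModuliSpace_grGrassTop hadm hhom e d,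
    isProjectiveVariety_grGrassTop hadm hhom v d⟩, fun L _ S _ _ _ _ d hS => ?_⟩
  obtain ⟨f⟩ := hS.top
  exact ⟨isFineModuliSpace_grGrassLayering S hadm hhom (f.trans e) d,
    (isProjectiveVariety_grGrassTop hadm hhom v d).sub_of_isClosed
      (isClosed_layeringLocus S hadm hhom v d)⟩
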